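/- **Setting.** Let $D>0$ and let $F\in C^2(\mathbb R)$ have bounded first and second derivatives. Let $u_-\ne u_+$ be such that $F$ is $C^\infty$ on the closed interval between $u_-$ and $u_+$, and put $\gamma=\frac{F(u_+)-F(u_-)}{u_+-u_-}$. Assume the Lax condition $F'(u_+)<\gamma<F'(u_-)$ and the Oleinik condition $(u_+-u_-)\,[F(v)-F(u_-)-\gamma(v-u_-)]>0$ for all $v$ strictly between $u_-$ and $u_+$. Let $U$ be a travelling wave profile: $D\,U'=F(U)-F(u_-)-\gamma(U-u_-)$ on $\mathbb R$ and $U(x)\to u_\pm$ as $x\to\pm\infty$. For $T>0$ let $\mathcal E^1$ be the set of paths $u(t,x)$ on $[0,T]\times\mathbb R$ with $u-U\in C([0,T],H^1(\mathbb R))$. For a kernel $\Phi(x,x')$ and $h\in L^2([0,T],L^2(\mathbb R))$ write $u=\mathcal H[h]$ if $u\in\mathcal E^1$ is a mild solution of $u_t+F(u)_x=Du_{xx}+\Phi h$, $u(0,\cdot)=U$, that is, $$u(t)=S(t)U-\int_0^tS(t-s)\,(F(u(s)))_x\,ds+\int_0^tS(t-s)\,\Phi h(s)\,ds\qquad(0\le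 t\le T),$$ where $S(t)$ is the heat semigroup of $u_t=Du_{xx}$, with kernel $\frac1{\sqrt{4\pi Dt}}e^{-(x-y)^2/(4Dt)}$. Put $$I(u)=\inf_{h:\,u=\mathcal H[h]}\ \tfrac12\int_0^T\|h(t,\cdot)\|_{L^2}^2\,dt\quad(\inf\emptyset=\infty),\qquad \mathcal J(A)=\inf_{u\in A}I(u),$$ $$A=\{u\in\mathcal E^1:\ u(0,x)=U(x),\ u(T,x)=U(x-\gamma T-x_0)\}.$$ The noise kernel is $$\Phi^{l_c}_{L_0}(x,x')=\sigma\,\phi_0\!\Big(\frac x{L_0}\Big)\frac1{l_c}\,\phi_1\!\Big(\frac{x-x'}{l_c}\Big),\qquad \sigma,L_0,l_c>0,$$ with real-valued $\phi_0,\phi_1\in L^1\cap H^1(\mathbb R)$ such that: $\phi_0$ is $C^\infty$ and positive, equal to $1$ on $[-1,1]$, increasing on $(-\infty,-1)$ and decreasing on $(1,\infty)$, and $1/\phi_0$ and all its derivatives have at most polynomial growth; $\hat\phi_1(0)=1$, $\hat\phi_1$ has no zero, and $1/\hat\phi_1$ has at most polynomial growth. For a function $g>0$ of $(x_0,T)$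 (or $g\ge 0$ when $x_0=0$ is allowed), "$\mathcal J(A)\overset{l_c\to0}=\Theta(g)$" means that there are constants $C_1,C_2>0$ such that, for all $(x_0,T)$ in the stated range, $C_1\,g\le\mathcal J(A)\le C_2\,g$ for all sufficiently small $l_c>0$. How small $l_c$ has to be may depend on $x_0$, $T$ and $\phi_1$; the constants $C_1,C_2$, and the thresholds $r,R,\tau$ below, do not depend on $l_c$, on $\phi_1$, or on those of $x_0,T$ that are not said to be fixed. **Statement.** Suppose that the wave is stationary, $\gamma=0$. Then there is a constant $C_0>0$ such that for every $\sigma>0$ and all $\phi_0,\phi_1$ as above, the quantity $\mathcal J(A)$ for the kernel $\Phi^{l_c}_{L_0}$ with $L_0=x_0+C_0$ satisfies: 1. $\mathcal J(A)\overset{l_c\to0}=\Theta(x_0^2/T)$ for small $x_0$ and all $T$: there is $r>0$ such that this holds on $0\le x_0\le r$, $T>0$; 2. $\mathcal J(A)\overset{l_c\to0}=\Theta(x_0)$ for large $x_0$ and any fixed $T>0$: for each $T>0$ there is $R>0$ such that this holds on $x_0\ge R$; 3. $\mathcal J(A)\overset{l_c\to0}=\Theta(x_0/T)$ for large $x_0$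 and small $T$: there are $R,\tau>0$ such that this holds on $x_0\ge R$, $0<T\le\tau$; 4. $\mathcal J(A)\overset{l_c\to0}=\Theta(1/T)$ for any fixed $x_0>0$ and all $T>0$. -/

import Mathlib

open MeasureTheory Filter Topology Set
open scoped ENNReal ContDiff FourierTransform

namespace ShockDisplacement

noncomputable section

/-- `g` is the weak (distributional) derivative of `f` on the real line. -/
def IsWeakDeriv (f g : ℝ → ℝ) : Prop :=
  LocallyIntegrable f ∧ LocallyIntegrable g ∧
    ∀ ψ : ℝ → ℝ, ContDiff ℝ ∞ ψ → HasCompactSupport ψ →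
      ∫ x, f x * deriv ψ x = -∫ x, g x * ψ x

/-- `f` belongs to the Sobolev space `H¹(ℝ)`. -/
def MemH1 (f : ℝ → ℝ) : Prop :=
  MemLp f 2 ∧ ∃ g : ℝ → ℝ, MemLp g 2 ∧ IsWeakDeriv f g

/-- `z ∈ C([0,T], H¹(ℝ))`; here `d t` is the weak derivative of `z t`, and continuity is
for the norm `‖f‖_{L²} + ‖f'‖_{L²}`, which is equivalent to the usual norm of `H¹(ℝ)`. -/
def ContinuousIntoH1 (T : ℝ) (z : ℝ → ℝ → ℝ) : Prop :=
  ∃ d : ℝ → ℝ → ℝ,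
    (∀ t ∈ Icc 0 T, MemLp (z t) 2 ∧ MemLp (d t) 2 ∧ IsWeakDeriv (z t) (d t)) ∧
    ∀ t₀ ∈ Icc 0 T,
      Tendsto (fun t => eLpNorm (z t - z t₀) 2 volume + eLpNorm (d t - d t₀) 2 volume)
        (𝓝[Icc 0 T] t₀) (𝓝 0)

/-- The space `ℰ¹` of paths `u(t,x)` on `[0,T] × ℝ` with `u - U ∈ C([0,T], H¹(ℝ))`.
A path is a function of `t`, then `x`; only its values for `t ∈ [0,T]` matter. -/
def MemE1 (T : ℝ) (U : ℝ → ℝ) (u : ℝ → ℝ → ℝ) : Prop :=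
  ContinuousIntoH1 T (fun t x => u t x - U x)

/-- The kernel of the heat equation `u_t = D u_xx`. -/
def heatKernel (D t x : ℝ) : ℝ :=
  1 / Real.sqrt (4 * Real.pi * D * t) * Real.exp (-x ^ 2 / (4 * D * t))

/-- The heat semigroup `S(t)` of `u_t = D u_xx`, with `S(0)` the identity. -/
def heatSemigroup (D t : ℝ) (f : ℝ → ℝ) (x : ℝ) : ℝ :=
  if t = 0 then f x else ∫ y, heatKernel D t (x - y) * f y

/-- The integral operator with kernel `Φ`. -/
def kernelOp (Φ : ℝ → ℝ → ℝ) (f : ℝ → ℝ) (x : ℝ) : ℝ :=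
  ∫ x', Φ x x' * f x'

/-- `h ∈ L²([0,T], L²(ℝ)) = L²([0,T] × ℝ)`. -/
def IsControl (T : ℝ) (h : ℝ → ℝ → ℝ) : Prop :=
  MemLp (Function.uncurry h) 2 ((volume.restrict (Icc 0 T)).prod volume)

/-- The action `½ ∫₀ᵀ ‖h(t,·)‖²_{L²} dt` of a control. -/
def controlCost (T : ℝ) (h : ℝ → ℝ → ℝ) : ℝ≥0∞ :=
  (1 / 2) * ∫⁻ t in Icc 0 T, ∫⁻ x, ENNReal.ofReal (h t x ^ 2)

/-- `u = ℋ[h]`: the path `u ∈ ℰ¹` is the mild solution on `[0,T]` of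
`u_t + F(u)_x = D u_xx + Φ h`, `u(0,·) = U`, that is,
`u(t) = S(t) U - ∫₀ᵗ S(t-s) (F(u(s)))_x ds + ∫₀ᵗ S(t-s) Φ h(s) ds`.
Here `N s` is the weak derivative of `F(u(s,·))`. -/
def IsMildSolution (F : ℝ → ℝ) (D T : ℝ) (U : ℝ → ℝ) (Φ : ℝ → ℝ → ℝ)
    (h u : ℝ → ℝ → ℝ) : Prop :=
  MemE1 T U u ∧
  ∃ N : ℝ → ℝ → ℝ,
    (∀ s ∈ Icc 0 T, IsWeakDeriv (fun y => F (u s y)) (N s)) ∧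
    ∀ t ∈ Icc 0 T, ∀ᵐ x,
      u t x = heatSemigroup D t U x
        - (∫ s in (0 : ℝ)..t, heatSemigroup D (t - s) (N s) x)
        + ∫ s in (0 : ℝ)..t, heatSemigroup D (t - s) (kernelOp Φ (h s)) x

/-- The rate function `I(u) = inf {½ ∫₀ᵀ ‖h(t,·)‖²_{L²} dt : u = ℋ[h]}`, with `inf ∅ = ∞`. -/
def rateFunction (F : ℝ → ℝ) (D T : ℝ) (U : ℝ → ℝ) (Φ : ℝ → ℝ → ℝ)
    (u : ℝ → ℝ → ℝ) : ℝ≥0∞ :=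
  ⨅ (h : ℝ → ℝ → ℝ) (_ : IsControl T h) (_ : IsMildSolution F D T U Φ h u), controlCost T h

/-- `𝒥(A) = inf_{u ∈ A} I(u)`. -/
def infRate (F : ℝ → ℝ) (D T : ℝ) (U : ℝ → ℝ) (Φ : ℝ → ℝ → ℝ)
    (A : Set (ℝ → ℝ → ℝ)) : ℝ≥0∞ :=
  ⨅ u ∈ A, rateFunction F D T U Φ u

/-- The Rankine–Hugoniot speed `γ`. -/
def shockSpeed (F : ℝ → ℝ) (um up : ℝ) : ℝ :=
  (F up - F um) / (up - um)

/-- The flux is `C²` with bounded first and second derivatives. -/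
def IsAdmissibleFlux (F : ℝ → ℝ) : Prop :=
  ContDiff ℝ 2 F ∧ ∃ C : ℝ, ∀ v, |deriv F v| ≤ C ∧ |deriv (deriv F) v| ≤ C

/-- `U(x - γ t)` is a viscous shock (travelling wave) of `u_t + F(u)_x = D u_xx` that joins
`um` at `-∞` to `up` at `+∞`. The Oleinik condition says that the graph of `F` lies, strictly
between the end states, strictly above its chord if `um < up` and strictly below it if
`up < um`. -/
structure IsViscousShock (F : ℝ → ℝ) (D um up : ℝ) (U : ℝ → ℝ) : Prop where
  ne : um ≠ up
  oleinik : ∀ v, min um up < v → v < max um up →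
    0 < (F v - F um - shockSpeed F um up * (v - um)) * (up - um)
  lax_right : deriv F up < shockSpeed F um up
  lax_left : shockSpeed F um up < deriv F um
  ode : ∀ x, HasDerivAt U ((F (U x) - F um - shockSpeed F um up * (U x - um)) / D) x
  tendsto_left : Tendsto U atBot (𝓝 um)
  tendsto_right : Tendsto U atTop (𝓝 up)

/-- The event that the wave is displaced by `x₀` at time `T`:
`u(0,·) = U` and `u(T,·) = U(· - γ T - x₀)`. -/
def displacementEvent (T γ x₀ : ℝ) (U : ℝ → ℝ) : Set (ℝ → ℝ → ℝ) :=
  {u | MemE1 T U u ∧ u 0 =ᵐ[volume] U ∧ u T =ᵐ[volume] fun x => U (x - γ * T - x₀)}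

/-- The noise kernel `Φ(x,x') = σ φ₀(x/L₀) l_c⁻¹ φ₁((x-x')/l_c)`. -/
def noiseKernel (σ L₀ lc : ℝ) (φ₀ φ₁ : ℝ → ℝ) (x x' : ℝ) : ℝ :=
  σ * φ₀ (x / L₀) * (1 / lc * φ₁ ((x - x') / lc))

/-- The conditions on the spatial envelope `φ₀` of the noise. -/
structure IsEnvelope (φ₀ : ℝ → ℝ) : Prop where
  integrable : Integrable φ₀
  memH1 : MemH1 φ₀
  smooth : ContDiff ℝ ∞ φ₀
  pos : ∀ x, 0 < φ₀ x
  inv_growth : (fun x => 1 / φ₀ x).HasTemperateGrowth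
  monotone_left : MonotoneOn φ₀ (Iio (-1))
  antitone_right : AntitoneOn φ₀ (Ioi 1)
  eq_one : ∀ x ∈ Icc (-1 : ℝ) 1, φ₀ x = 1

/-- The conditions on the local correlation profile `φ₁` of the noise. They do not depend on
which normalization of the frequency variable is used in the Fourier transform. -/
structure IsCorrelationProfile (φ₁ : ℝ → ℝ) : Prop where
  integrable : Integrable φ₁
  memH1 : MemH1 φ₁
  fourier_zero : 𝓕 (fun x => (φ₁ x : ℂ)) 0 = 1
  fourier_ne_zero : ∀ ξ : ℝ, 𝓕 (fun x => (φ₁ x : ℂ)) ξ ≠ 0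
  inv_fourier_growth : ∃ (C : ℝ) (k : ℕ), ∀ ξ : ℝ,
    1 / ‖𝓕 (fun x => (φ₁ x : ℂ)) ξ‖ ≤ C * (1 + |ξ|) ^ k

/-- The quantity `𝒥(A)` of the displacement event `A` for the noise kernel with
`L₀ = γ T + x₀ + C₀`. -/
def displacementRate (F : ℝ → ℝ) (D um up : ℝ) (U : ℝ → ℝ) (C₀ σ : ℝ) (φ₀ φ₁ : ℝ → ℝ)
    (T x₀ lc : ℝ) : ℝ≥0∞ :=
  infRate F D T U (noiseKernel σ (shockSpeed F um up * T + x₀ + C₀) lc φ₀ φ₁)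
    (displacementEvent T (shockSpeed F um up) x₀ U)

/-- `C₁ g ≤ J(l_c) ≤ C₂ g` for all sufficiently small `l_c > 0`. -/
def BoundedAsLcToZero (C₁ C₂ g : ℝ) (J : ℝ → ℝ≥0∞) : Prop :=
  ∀ᶠ lc in 𝓝[>] (0 : ℝ), ENNReal.ofReal (C₁ * g) ≤ J lc ∧ J lc ≤ ENNReal.ofReal (C₂ * g)

end

end ShockDisplacement

open ShockDisplacement

namespace ShockDisplacement

noncomputable section

/-! Everything follows from one lower bound and two upper bounds, collected in
`exists_infRate_bounds`, with noise range L = x₀ + 1.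

The lower bound is conservation of mass. The shift of the profile by x₀ changes the mass by x₀(u₋ -
u₊). The heat semigroup preserves mass. The flux differs from that of the stationary profile by the
derivative of F(u) - F(U), which vanishes at ±∞. Hence the noise must inject exactly this mass
(`displacement_eq_integral_forcing`). With q = σφ₀(·/L), the mass injected by a control h is the
integral of h against q mollified at scale l_c. Cauchy–Schwarz on [0,T] × ℝ and the bound 2‖q‖ for
the norm of the mollified envelope at small l_c give a cost of at least a constant times x₀² / (T(x₀
+ 1)) (`eventually_le_infRate`).

For the upper bounds an explicit path is inserted into the equation and the forcing g that it needs
is computed. All derivatives of the profile decay exponentially, by the Lax condition at both ends,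
and so do those of g. Since 1/φ₀ grows at most polynomially, g/(σφ₀(·/L)) still decays
exponentially, and so its Fourier transform decays faster than any power. It can therefore be
divided by the transform of φ₁ at l_c ξ, which gives a control that produces g. As l_c → 0 the cost
of this control tends to that for white noise, ½∬(g/(σφ₀(·/L)))² (`eventually_exists_control`,
`eventually_infRate_le`).

Two paths suffice. Translation at speed x₀/T needs g = -(x₀/T)U' along the moving wave and costs at
most a constant times (1 + x₀)^k x₀²/T; this is sharp when x₀ is bounded. Linear interpolation
between U and its translate needs a plateau of height of order 1/T on [0, x₀], where the envelope is
1, and terms localized at the two fronts. It costs at most a constant times x₀/T + (1 + T)²/T; this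
is sharp when x₀ is large and T is fixed or small. -/

/-! ### Weak derivatives on the line and the embedding of H¹. -/

theorem exists_support_subset_Ioo {ψ : ℝ → ℝ} (hψ : HasCompactSupport ψ) :
    ∃ A : ℝ, 0 < A ∧ tsupport ψ ⊆ Ioo (-A) A := by
  obtain ⟨r, hr⟩ := hψ.isCompact.isBounded.subset_ball (0 : ℝ)
  refine ⟨max r 1, by positivity, hr.trans ?_⟩
  rw [Real.ball_eq_Ioo]
  refine Ioo_subset_Ioo ?_ ?_ <;> simp

theorem _root_.MeasureTheory.LocallyIntegrable.intervalIntegrable' {g : ℝ → ℝ}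
    (hg : LocallyIntegrable g) (a b : ℝ) : IntervalIntegrable g volume a b :=
  intervalIntegrable_iff.mpr
    ((hg.integrableOn_isCompact isCompact_uIcc).mono_set uIoc_subset_uIcc)

/-- A primitive of a compactly supported smooth function of integral zero is again such. -/
theorem exists_primitive_of_integral_eq_zero {χ : ℝ → ℝ} (hχ : ContDiff ℝ ∞ χ)
    (hc : HasCompactSupport χ) (h0 : ∫ x, χ x = 0) :
    ∃ Ψ : ℝ → ℝ, ContDiff ℝ ∞ Ψ ∧ HasCompactSupport Ψ ∧ deriv Ψ = χ := by
  obtain ⟨A, hA, hs⟩ := exists_support_subset_Ioo hc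
  have hz : ∀ x, x ∉ Ioo (-A) A → χ x = 0 := fun x hx =>
    image_eq_zero_of_notMem_tsupport fun h => hx (hs h)
  have hd : ∀ x, HasDerivAt (fun x => ∫ y in (-A)..x, χ y) (χ x) x := fun x =>
    (hχ.continuous.integral_hasStrictDerivAt (-A) x).hasDerivAt
  have hde : deriv (fun x => ∫ y in (-A)..x, χ y) = χ := funext fun x => (hd x).deriv
  refine ⟨fun x => ∫ y in (-A)..x, χ y, ?_, ?_, hde⟩
  · rw [contDiff_infty_iff_deriv, hde]
    exact ⟨fun x => (hd x).differentiableAt, hχ⟩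
  · refine HasCompactSupport.intro (isCompact_Icc (a := -A) (b := A)) fun x hx => ?_
    by_cases hxl : x < -A
    · refine (intervalIntegral.integral_congr (g := fun _ => 0) fun y hy => ?_).trans (by simp)
      rw [uIcc_of_ge hxl.le] at hy
      exact hz y fun h => by linarith [h.1, hy.2]
    · have hxr : A < x := by
        by_contra h
        exact hx ⟨not_lt.mp hxl, not_lt.mp h⟩
      rw [intervalIntegral.integral_eq_integral_of_support_subset, h0]
      intro y hy
      have : y ∈ Ioo (-A) A := hs (subset_tsupport _ hy)
      exact ⟨this.1, by linarith [this.2]⟩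

/-- The lemma of du Bois-Reymond. -/
theorem ae_eq_const_of_integral_mul_deriv_eq_zero {f : ℝ → ℝ} (hf : LocallyIntegrable f)
    (h : ∀ ψ : ℝ → ℝ, ContDiff ℝ ∞ ψ → HasCompactSupport ψ → ∫ x, f x * deriv ψ x = 0) :
    ∃ c : ℝ, ∀ᵐ x, f x = c := by
  let b : ContDiffBump (0 : ℝ) := ⟨1, 2, one_pos, one_lt_two⟩
  let θ : ℝ → ℝ := b.normed volume
  have hθ : ContDiff ℝ ∞ θ := b.contDiff_normed
  have hθc : HasCompactSupport θ := b.hasCompactSupport_normed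
  have hθi : ∫ x, θ x = 1 := b.integral_normed
  have hint : ∀ ψ : ℝ → ℝ, Continuous ψ → HasCompactSupport ψ →
      Integrable (fun x => f x * ψ x) := fun ψ h1 h2 => by
    simpa [smul_eq_mul, mul_comm] using hf.integrable_smul_left_of_hasCompactSupport h1 h2
  refine ⟨∫ x, f x * θ x, ?_⟩
  refine ae_eq_of_integral_contDiff_smul_eq hf (locallyIntegrable_const _) fun ψ hψ hψc => ?_
  have hψi : Integrable ψ := hψ.continuous.integrable_of_hasCompactSupport hψc
  have hθi' : Integrable θ := hθ.continuous.integrable_of_hasCompactSupport hθc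
  -- Subtracting a multiple of the normalized bump makes the integral of the test function vanish,
  -- so that it becomes the derivative of a test function.
  obtain ⟨Ψ, h1, h2, h3⟩ := exists_primitive_of_integral_eq_zero
    (χ := fun x => ψ x - (∫ y, ψ y) * θ x) (hψ.sub (contDiff_const.mul hθ))
    (hψc.sub hθc.mul_left) (by
      rw [integral_sub hψi (hθi'.const_mul _), integral_const_mul, hθi]; ring)
  have h4 := h Ψ h1 h2
  rw [h3] at h4
  have h5 : ∫ x, f x * (ψ x - (∫ y, ψ y) * θ x)
      = (∫ x, f x * ψ x) - (∫ y, ψ y) * ∫ x, f x * θ x := by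
    rw [← integral_const_mul, ← integral_sub (hint _ hψ.continuous hψc)
      ((hint _ hθ.continuous hθc).const_mul _)]
    congr 1; ext x; ring
  simp only [smul_eq_mul, integral_mul_const]
  rw [h5] at h4
  simp_rw [mul_comm (ψ _)]
  linarith

theorem integral_mul_eq_intervalIntegral {f ψ : ℝ → ℝ} {A : ℝ}
    (hs : tsupport ψ ⊆ Ioo (-A) A) : ∫ x, f x * ψ x = ∫ x in (-A)..A, f x * ψ x := by
  rw [intervalIntegral.integral_eq_integral_of_support_subset]
  intro x hx
  have hx' : ψ x ≠ 0 := fun h => hx (by simp [h])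
  exact Ioo_subset_Ioc_self (hs (subset_tsupport _ hx'))

/-- The primitive of a locally integrable function has that function as weak derivative. -/
theorem isWeakDeriv_primitive {g : ℝ → ℝ} (hg : LocallyIntegrable g) :
    IsWeakDeriv (fun x => ∫ y in (0 : ℝ)..x, g y) g := by
  have hcont : Continuous fun x => ∫ y in (0 : ℝ)..x, g y :=
    intervalIntegral.continuous_primitive (fun a b => hg.intervalIntegrable' a b) 0
  refine ⟨hcont.locallyIntegrable, hg, fun ψ hψ hψc => ?_⟩
  obtain ⟨A, hA, hs⟩ := exists_support_subset_Ioo hψc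
  rw [integral_mul_eq_intervalIntegral (tsupport_deriv_subset.trans hs),
    integral_mul_eq_intervalIntegral hs]
  have hz : ∀ x, x ∉ Ioo (-A) A → ψ x = 0 := fun x hx =>
    image_eq_zero_of_notMem_tsupport fun h => hx (hs h)
  -- The primitive need not be differentiable everywhere; absolute continuity suffices for
  -- integration by parts.
  have hac : AbsolutelyContinuousOnInterval (fun x => ∫ y in (0 : ℝ)..x, g y) (-A) A :=
    (hg.intervalIntegrable' (-A) A).absolutelyContinuousOnInterval_intervalIntegral
      (c := 0) (by rw [uIcc_of_le (by linarith)]; constructor <;> linarith)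
  have hψac : AbsolutelyContinuousOnInterval ψ (-A) A :=
    ContDiffOn.absolutelyContinuousOnInterval (hψ.of_le (by norm_num)).contDiffOn
  rw [hac.integral_mul_deriv_eq_deriv_mul hψac, hz A (by simp), hz (-A) (by simp)]
  simp only [mul_zero, sub_zero, zero_sub]
  congr 1
  apply intervalIntegral.integral_congr_ae
  filter_upwards [_root_.LocallyIntegrable.ae_hasDerivAt_integral hg] with x hx _
  rw [(hx 0).deriv]

/-- A function with a weak derivative agrees almost everywhere with a primitive of it. -/
theorem IsWeakDeriv.exists_ae_eq {f g : ℝ → ℝ} (h : IsWeakDeriv f g) :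
    ∃ c : ℝ, ∀ᵐ x, f x = c + ∫ y in (0 : ℝ)..x, g y := by
  have h' := isWeakDeriv_primitive h.2.1
  obtain ⟨c, hc⟩ := ae_eq_const_of_integral_mul_deriv_eq_zero (h.1.sub h'.1) fun ψ hψ hψc => by
    have hd : Continuous (deriv ψ) := hψ.continuous_deriv (by norm_num)
    have hint : ∀ k : ℝ → ℝ, LocallyIntegrable k → Integrable (fun x => k x * deriv ψ x) :=
      fun k hk => by
      simpa [smul_eq_mul, mul_comm] using
        hk.integrable_smul_left_of_hasCompactSupport hd hψc.deriv
    simp only [Pi.sub_apply, sub_mul]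
    rw [integral_sub (hint _ h.1) (hint _ h'.1), h.2.2 ψ hψ hψc, h'.2.2 ψ hψ hψc]
    ring
  exact ⟨c, hc.mono fun x hx => by simp only [Pi.sub_apply] at hx; linarith⟩

theorem isWeakDeriv_of_hasDerivAt {f g : ℝ → ℝ} (h : ∀ x, HasDerivAt f (g x) x)
    (hg : Continuous g) : IsWeakDeriv f g := by
  have hf : Continuous f := continuous_iff_continuousAt.2 fun x => (h x).continuousAt
  refine ⟨hf.locallyIntegrable, hg.locallyIntegrable, fun ψ hψ hψc => ?_⟩
  obtain ⟨A, hA, hs⟩ := exists_support_subset_Ioo hψc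
  rw [integral_mul_eq_intervalIntegral (tsupport_deriv_subset.trans hs),
    integral_mul_eq_intervalIntegral hs]
  have hz : ∀ x, x ∉ Ioo (-A) A → ψ x = 0 := fun x hx =>
    image_eq_zero_of_notMem_tsupport fun h => hx (hs h)
  have hd : Continuous (deriv ψ) := hψ.continuous_deriv (by norm_num)
  rw [intervalIntegral.integral_mul_deriv_eq_deriv_mul (fun x _ => h x)
    (fun x _ => ((hψ.differentiable (by norm_num)) x).hasDerivAt)
    (hg.intervalIntegrable _ _) (hd.intervalIntegrable _ _), hz A (by simp), hz (-A) (by simp)]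
  simp

theorem IsWeakDeriv.congr_ae {f f' g g' : ℝ → ℝ} (h : IsWeakDeriv f g) (hf : f =ᵐ[volume] f')
    (hg : g =ᵐ[volume] g') : IsWeakDeriv f' g' := by
  refine ⟨h.1.congr hf, h.2.1.congr hg, fun ψ hψ hψc => ?_⟩
  have e1 : ∫ x, f' x * deriv ψ x = ∫ x, f x * deriv ψ x :=
    integral_congr_ae (hf.mono fun x hx => by simp only [hx])
  have e2 : ∫ x, g' x * ψ x = ∫ x, g x * ψ x :=
    integral_congr_ae (hg.mono fun x hx => by simp only [hx])
  rw [e1, e2, h.2.2 ψ hψ hψc]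

theorem IsWeakDeriv.sub {f f' g g' : ℝ → ℝ} (h : IsWeakDeriv f g) (h' : IsWeakDeriv f' g') :
    IsWeakDeriv (fun x => f x - f' x) (fun x => g x - g' x) := by
  refine ⟨h.1.sub h'.1, h.2.1.sub h'.2.1, fun ψ hψ hψc => ?_⟩
  have hint : ∀ k p : ℝ → ℝ, LocallyIntegrable k → Continuous p → HasCompactSupport p →
      Integrable (fun x => k x * p x) := fun k p hk hp hpc => by
    simpa [smul_eq_mul, mul_comm] using hk.integrable_smul_left_of_hasCompactSupport hp hpc
  have hd : Continuous (deriv ψ) := hψ.continuous_deriv (by norm_num)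
  simp only [sub_mul]
  rw [integral_sub (hint _ _ h.1 hd hψc.deriv) (hint _ _ h'.1 hd hψc.deriv), h.2.2 ψ hψ hψc,
    h'.2.2 ψ hψ hψc, integral_sub (hint _ _ h.2.1 hψ.continuous hψc)
      (hint _ _ h'.2.1 hψ.continuous hψc)]
  ring

theorem IsWeakDeriv.add {f f' g g' : ℝ → ℝ} (h : IsWeakDeriv f g) (h' : IsWeakDeriv f' g') :
    IsWeakDeriv (fun x => f x + f' x) (fun x => g x + g' x) := by
  have h0 : IsWeakDeriv (fun _ => (0 : ℝ)) (fun _ => 0) :=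
    isWeakDeriv_of_hasDerivAt (fun x => hasDerivAt_const x 0) continuous_const
  simpa using h.sub (h0.sub h')

/-- `k` is the continuous representative of a function with weak derivative `g`. -/
theorem IsWeakDeriv.sub_eq_of_continuous {k g : ℝ → ℝ} (h : IsWeakDeriv k g)
    (hk : Continuous k) (a b : ℝ) : k b - k a = ∫ y in a..b, g y := by
  obtain ⟨c, hc⟩ := h.exists_ae_eq
  have hcont : Continuous fun x => c + ∫ y in (0 : ℝ)..x, g y :=
    continuous_const.add
      (intervalIntegral.continuous_primitive (fun a b => h.2.1.intervalIntegrable' a b) 0)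
  have heq := Continuous.ae_eq_iff_eq volume hk hcont |>.1 hc
  rw [heq]
  simp only [add_sub_add_left_eq_sub]
  exact intervalIntegral.integral_interval_sub_left (h.2.1.intervalIntegrable' _ _)
    (h.2.1.intervalIntegrable' _ _)

/-- The weak derivative of a continuous function is its derivative almost everywhere. -/
theorem IsWeakDeriv.ae_hasDerivAt {k g : ℝ → ℝ} (h : IsWeakDeriv k g)
    (hk : Continuous k) : ∀ᵐ x, HasDerivAt k (g x) x := by
  have hg : LocallyIntegrable g := h.2.1
  filter_upwards [_root_.LocallyIntegrable.ae_hasDerivAt_integral hg] with x hx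
  have : k = fun x => k 0 + ∫ y in (0 : ℝ)..x, g y := by
    ext x; linarith [h.sub_eq_of_continuous hk 0 x]
  rw [this]
  exact (hx 0).const_add _

theorem IsWeakDeriv.exists_continuous {f g : ℝ → ℝ} (h : IsWeakDeriv f g) :
    ∃ k : ℝ → ℝ, Continuous k ∧ f =ᵐ[volume] k := by
  obtain ⟨c, hc⟩ := h.exists_ae_eq
  exact ⟨_, continuous_const.add
      (intervalIntegral.continuous_primitive (fun a b => h.2.1.intervalIntegrable' a b) 0), hc⟩

/-- A local form of the embedding of `H¹` into the continuous functions. -/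
theorem IsWeakDeriv.sq_le {k g : ℝ → ℝ} (h : IsWeakDeriv k g) (hk : Continuous k)
    (hg : MemLp g 2) (x : ℝ) :
    k x ^ 2 ≤ 2 * ∫ y in Ioc x (x + 1), (k y ^ 2 + g y ^ 2) := by
  have hg2 : Integrable (fun y => g y ^ 2) := hg.integrable_sq
  have hx1 : x ≤ x + 1 := by linarith
  have hgl : ∀ a b, IntervalIntegrable g volume a b := h.2.1.intervalIntegrable'
  have hg2i : ∀ a b, IntervalIntegrable (fun y => g y ^ 2) volume a b :=
    fun a b => hg2.intervalIntegrable
  have hki : ∀ a b, IntervalIntegrable (fun y => k y ^ 2) volume a b :=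
    fun a b => (hk.pow 2).intervalIntegrable a b
  set G := ∫ t in x..(x + 1), g t ^ 2
  have key : ∀ y ∈ Icc x (x + 1), k x ^ 2 ≤ 2 * k y ^ 2 + 2 * G := by
    intro y hy
    have e := h.sub_eq_of_continuous hk x y
    set I := ∫ t in x..y, g t with hI
    have hyx : 0 ≤ y - x := by linarith [hy.1]
    have hy1 : y - x ≤ 1 := by linarith [hy.2]
    -- Expanding this square gives I² ≤ ∫ g², a Cauchy–Schwarz inequality that uses y - x ≤ 1.
    have hpos : 0 ≤ ∫ t in x..y, (g t - I) ^ 2 :=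
      intervalIntegral.integral_nonneg hy.1 fun t _ => sq_nonneg _
    have hexp : ∫ t in x..y, (g t - I) ^ 2
        = (∫ t in x..y, g t ^ 2) - 2 * I * I + (y - x) * I ^ 2 := by
      have : ∀ t, (g t - I) ^ 2 = g t ^ 2 - 2 * I * g t + I ^ 2 := fun t => by ring
      simp_rw [this]
      rw [intervalIntegral.integral_add ((hg2i _ _).sub ((hgl _ _).const_mul _))
        (by simp), intervalIntegral.integral_sub (hg2i _ _) ((hgl _ _).const_mul _)]
      simp [hI]
    have hGm : ∫ t in x..y, g t ^ 2 ≤ G :=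
      intervalIntegral.integral_mono_interval le_rfl hy.1 hy.2
        (ae_of_all _ fun t => sq_nonneg (g t)) (hg2i _ _)
    have hIG : I ^ 2 ≤ G := by nlinarith [sq_nonneg I]
    have : k x = k y - I := by linarith
    rw [this]
    nlinarith [sq_nonneg (k y + I)]
  have hint : ∫ _ in x..(x + 1), k x ^ 2 ≤ ∫ y in x..(x + 1), (2 * k y ^ 2 + 2 * G) :=
    intervalIntegral.integral_mono_on hx1 (by simp)
      (((hki _ _).const_mul 2).add (by simp)) key
  rw [intervalIntegral.integral_add ((hki _ _).const_mul 2) (by simp),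
    intervalIntegral.integral_const_mul] at hint
  simp only [intervalIntegral.integral_const, add_sub_cancel_left, one_smul] at hint
  rw [← intervalIntegral.integral_of_le hx1, intervalIntegral.integral_add (hki _ _) (hg2i _ _)]
  linarith

theorem IsWeakDeriv.sq_le_integral {k g : ℝ → ℝ} (h : IsWeakDeriv k g) (hk : Continuous k)
    (hk2 : MemLp k 2) (hg : MemLp g 2) (x : ℝ) :
    k x ^ 2 ≤ 2 * ∫ y, (k y ^ 2 + g y ^ 2) := by
  refine (h.sq_le hk hg x).trans ?_
  gcongr
  · exact ae_of_all _ fun y => by positivity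
  · exact hk2.integrable_sq.add hg.integrable_sq
  · exact Measure.restrict_le_self

/-- By `sq_le` the value at x is controlled by the energy on [x, x + 1]. This energy is a difference
of two values of a primitive that converges at both ends of the line. -/
theorem IsWeakDeriv.tendsto_zero {k g : ℝ → ℝ} (h : IsWeakDeriv k g) (hk : Continuous k)
    (hk2 : MemLp k 2) (hg : MemLp g 2) :
    Tendsto k atTop (𝓝 0) ∧ Tendsto k atBot (𝓝 0) := by
  set e : ℝ → ℝ := fun y => k y ^ 2 + g y ^ 2
  have he : Integrable e := hk2.integrable_sq.add hg.integrable_sq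
  have hprim : ∀ x, ∫ y in Ioc x (x + 1), e y
      = (∫ y in (0 : ℝ)..(x + 1), e y) - ∫ y in (0 : ℝ)..x, e y := fun x => by
    rw [← intervalIntegral.integral_of_le (by linarith),
      intervalIntegral.integral_interval_sub_left he.intervalIntegrable he.intervalIntegrable]
  have hsq : ∀ l : Filter ℝ, Tendsto (fun x => ∫ y in Ioc x (x + 1), e y) l (𝓝 0) →
      Tendsto k l (𝓝 0) := fun l hl => by
    have h1 : Tendsto (fun x => k x ^ 2) l (𝓝 0) :=
      squeeze_zero (fun x => sq_nonneg _) (fun x => h.sq_le hk hg x) (by simpa using hl.const_mul 2)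
    have h2 := h1.sqrt
    simp only [Real.sqrt_sq_eq_abs, Real.sqrt_zero] at h2
    exact (tendsto_zero_iff_abs_tendsto_zero _).2 h2
  constructor
  · apply hsq
    simp_rw [hprim]
    have := intervalIntegral_tendsto_integral_Ioi 0 he.integrableOn tendsto_id
    simpa using ((this.comp (tendsto_atTop_add_const_right _ 1 tendsto_id)).sub this)
  · apply hsq
    simp_rw [hprim]
    have := intervalIntegral_tendsto_integral_Iic 0 he.integrableOn tendsto_id
    have h2 : Tendsto (fun x => ∫ y in (0 : ℝ)..x, e y) atBot (𝓝 (-∫ y in Iic 0, e y)) := by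
      refine this.neg.congr fun x => ?_
      rw [intervalIntegral.integral_symm, id]; simp
    simpa using ((h2.comp (tendsto_atBot_add_const_right _ 1 tendsto_id)).sub h2)

/-- The chain rule bound for the weak derivative of `F ∘ k`. -/
theorem IsWeakDeriv.abs_le_of_comp {F k g N : ℝ → ℝ} {C : ℝ} (h : IsWeakDeriv k g)
    (hk : Continuous k) (hF : Differentiable ℝ F) (hC : ∀ v, |deriv F v| ≤ C)
    (hN : IsWeakDeriv (fun x => F (k x)) N) : ∀ᵐ x, |N x| ≤ C * |g x| := by
  filter_upwards [h.ae_hasDerivAt hk, hN.ae_hasDerivAt (hF.continuous.comp hk)] with x h1 h2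
  have h3 := (hF (k x)).hasDerivAt.comp x h1
  rw [h2.unique h3, abs_mul]
  gcongr
  exact hC _

/-! ### The heat semigroup as a Gaussian average, and Duhamel's formula. -/

/-- The standard Gaussian measure on the line. -/
abbrev unitGaussian : Measure ℝ := ProbabilityTheory.gaussianReal 0 1

theorem unitGaussian_map_affine (x c : ℝ) :
    unitGaussian.map (fun z => x + c * z)
      = ProbabilityTheory.gaussianReal x (NNReal.mk (c ^ 2) (sq_nonneg c)) := by
  have h1 : (fun z => x + c * z) = (fun z => x + z) ∘ (fun z => c * z) := rfl
  rw [h1, ← Measure.map_map (by fun_prop) (by fun_prop),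
    ProbabilityTheory.gaussianReal_map_const_mul, ProbabilityTheory.gaussianReal_map_const_add]
  simp

/-- The substitution y = x + √(2Dt) z moves the time dependence from the singular kernel into the
argument of f, over a fixed probability measure. The formula remains valid at t = 0, where the
semigroup is the identity by convention. -/
theorem heatSemigroup_eq_integral_unitGaussian {D t : ℝ} (hD : 0 < D) (ht : 0 ≤ t) (f : ℝ → ℝ)
    (x : ℝ) :
    heatSemigroup D t f x = ∫ z, f (x + Real.sqrt (2 * D * t) * z) ∂unitGaussian := by
  rcases ht.eq_or_lt with rfl | ht
  · simp [heatSemigroup]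
  have h2 : 0 < 2 * D * t := by positivity
  have hc : Real.sqrt (2 * D * t) ≠ 0 := (Real.sqrt_pos.2 h2).ne'
  have hemb : MeasurableEmbedding (fun z : ℝ => x + Real.sqrt (2 * D * t) * z) :=
    ((Homeomorph.mulLeft₀ _ hc).trans (Homeomorph.addLeft x)).measurableEmbedding
  rw [← hemb.integral_map, unitGaussian_map_affine,
    ProbabilityTheory.integral_gaussianReal_eq_integral_smul]
  · simp only [heatSemigroup, ht.ne', if_false, smul_eq_mul]
    congr 1
    ext y
    congr 1
    simp only [heatKernel, ProbabilityTheory.gaussianPDFReal_def, NNReal.coe_mk,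
      Real.sq_sqrt h2.le, one_div]
    congr 2
    · congr 1; ring
    · rw [← neg_sq (x - y)]; congr 1 <;> ring_nf
  · intro h
    have : (Real.sqrt (2 * D * t)) ^ 2 = 0 := congrArg NNReal.toReal h
    exact hc (by simpa using this)

theorem integrable_id_unitGaussian : Integrable (fun z : ℝ => z) unitGaussian :=
  (ProbabilityTheory.memLp_id_gaussianReal 1).integrable (by simp)

/-- Gaussian integration by parts. -/
theorem integral_mul_unitGaussian {p p' : ℝ → ℝ} {M : ℝ} (hp : ∀ z, HasDerivAt p (p' z) z)
    (hp' : Continuous p') (hM : ∀ z, |p z| ≤ M) (hM' : ∀ z, |p' z| ≤ M) :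
    ∫ z, z * p z ∂unitGaussian = ∫ z, p' z ∂unitGaussian := by
  have hpc : Continuous p := continuous_iff_continuousAt.2 fun x => (hp x).continuousAt
  set g : ℝ → ℝ := ProbabilityTheory.gaussianPDFReal 0 1 with hg
  have hgd : ∀ z, HasDerivAt g (-(z * g z)) z := fun z => by
    have hge : g = fun x => (Real.sqrt (2 * Real.pi))⁻¹ * Real.exp (-x ^ 2 / 2) := by
      ext x; simp [hg, ProbabilityTheory.gaussianPDFReal_def]
    rw [hge]
    have h0 : HasDerivAt (fun x : ℝ => -x ^ 2 / 2) (-z) z := by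
      have := ((hasDerivAt_pow 2 z).neg).div_const 2
      convert! this using 1; simp; ring
    have := (h0.exp).const_mul (Real.sqrt (2 * Real.pi))⁻¹
    convert! this using 1; ring
  have hgi : Integrable g := ProbabilityTheory.integrable_gaussianPDFReal 0 1
  have hgzi : Integrable (fun z => z * g z) := by
    have h := integrable_id_unitGaussian
    rw [unitGaussian, ProbabilityTheory.gaussianReal_of_var_ne_zero _ one_ne_zero,
      integrable_withDensity_iff_integrable_smul₀' (by fun_prop)
        (ae_of_all _ fun _ => ProbabilityTheory.gaussianPDF_lt_top)] at h
    simpa [ProbabilityTheory.toReal_gaussianPDF, mul_comm] using h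
  have e := integral_mul_deriv_eq_deriv_mul_of_integrable (u := p) (v := g) (u' := p')
    (v' := fun z => -(z * g z)) (fun z _ => hp z) (fun z _ => hgd z)
    (hgzi.neg.bdd_mul hpc.aestronglyMeasurable (ae_of_all _ hM))
    (hgi.bdd_mul hp'.aestronglyMeasurable (ae_of_all _ hM'))
    (hgi.bdd_mul hpc.aestronglyMeasurable (ae_of_all _ hM))
  rw [unitGaussian, ProbabilityTheory.integral_gaussianReal_eq_integral_smul one_ne_zero,
    ProbabilityTheory.integral_gaussianReal_eq_integral_smul one_ne_zero]
  simp only [smul_eq_mul]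
  have e1 : ∫ z, p z * -(z * g z) = -∫ z, g z * (z * p z) := by
    rw [← integral_neg]; congr 1; ext z; ring
  have e2 : ∫ z, p' z * g z = ∫ z, g z * p' z := by congr 1; ext z; ring
  rw [e1, e2] at e
  linarith

/-- The point is continuity up to s = t, where the kernel degenerates; the fundamental theorem of
calculus on the closed interval needs it. -/
theorem continuousOn_integral_heat {D T t M x : ℝ} {g : ℝ → ℝ → ℝ} (htT : t ≤ T)
    (hg : Continuous (Function.uncurry g)) (hM : ∀ s ∈ Icc 0 T, ∀ y, |g s y| ≤ M) :
    ContinuousOn (fun s => ∫ z, g s (x + Real.sqrt (2 * D * (t - s)) * z) ∂unitGaussian)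
      (Icc 0 t) := by
  have hcomp : Continuous fun p : ℝ × ℝ => g p.1 (x + Real.sqrt (2 * D * (t - p.1)) * p.2) :=
    hg.comp (by fun_prop : Continuous fun p : ℝ × ℝ =>
      (p.1, x + Real.sqrt (2 * D * (t - p.1)) * p.2))
  refine continuousOn_of_dominated (bound := fun _ => M) (fun s _ => ?_) (fun s hs => ?_)
    (integrable_const _) (ae_of_all _ fun z => ?_)
  · exact (hcomp.comp (by fun_prop : Continuous fun z : ℝ => (s, z))).aestronglyMeasurable
  · exact ae_of_all _ fun z => hM s ⟨hs.1, hs.2.trans htT⟩ _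
  · exact (hcomp.comp (by fun_prop : Continuous fun s : ℝ => (s, z))).continuousOn

/-- Duhamel's formula for a smooth bounded function. -/
theorem duhamel {D T M : ℝ} (hD : 0 < D) {v vt vx vxx : ℝ → ℝ → ℝ}
    (hchain : ∀ (y : ℝ → ℝ) (y' s : ℝ), HasDerivAt y y' s →
      HasDerivAt (fun r => v r (y r)) (vt s (y s) + vx s (y s) * y') s)
    (hxx : ∀ s x, HasDerivAt (vx s) (vxx s x) x)
    (cv : Continuous (Function.uncurry v)) (cvt : Continuous (Function.uncurry vt))
    (cvx : Continuous (Function.uncurry vx)) (cvxx : Continuous (Function.uncurry vxx))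
    (bv : ∀ s ∈ Icc 0 T, ∀ x, |v s x| ≤ M) (bvt : ∀ s ∈ Icc 0 T, ∀ x, |vt s x| ≤ M)
    (bvx : ∀ s ∈ Icc 0 T, ∀ x, |vx s x| ≤ M) (bvxx : ∀ s ∈ Icc 0 T, ∀ x, |vxx s x| ≤ M)
    {t : ℝ} (ht : t ∈ Icc 0 T) (x : ℝ) :
    v t x = heatSemigroup D t (v 0) x
      + ∫ s in (0 : ℝ)..t, heatSemigroup D (t - s) (fun y => vt s y - D * vxx s y) x := by
  have cslice : ∀ {g : ℝ → ℝ → ℝ}, Continuous (Function.uncurry g) → ∀ s, Continuous (g s) :=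
    fun hg s => hg.comp (by fun_prop : Continuous fun y : ℝ => (s, y))
  set c : ℝ → ℝ := fun s => Real.sqrt (2 * D * (t - s)) with hc
  set k : ℝ → ℝ := fun s => ∫ z, v s (x + c s * z) ∂unitGaussian with hk
  set g : ℝ → ℝ → ℝ := fun s y => vt s y - D * vxx s y with hg
  have hgc : Continuous (Function.uncurry g) := cvt.sub (continuous_const.mul cvxx)
  have hgM : ∀ s ∈ Icc 0 T, ∀ y, |g s y| ≤ M + D * M := fun s hs y => by
    refine (abs_sub _ _).trans (add_le_add (bvt s hs y) ?_)
    rw [abs_mul, abs_of_pos hD]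
    exact mul_le_mul_of_nonneg_left (bvxx s hs y) hD.le
  have hkc : ContinuousOn k (Icc 0 t) := continuousOn_integral_heat ht.2 cv bv
  have hgi : ContinuousOn (fun s => ∫ z, g s (x + c s * z) ∂unitGaussian) (Icc 0 t) :=
    continuousOn_integral_heat ht.2 hgc hgM
  -- Since c' = -D/c, differentiating v(s, x + c z) produces the extra term -(D/c) z v_x. Gaussian
  -- integration by parts turns its average into that of -D v_xx.
  have hderiv : ∀ s ∈ Ioo 0 t, HasDerivAt k (∫ z, g s (x + c s * z) ∂unitGaussian) s := by
    intro s hs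
    set c' : ℝ → ℝ := fun r => -D / c r with hc'
    have hcpos : ∀ r < t, 0 < c r := fun r hr =>
      Real.sqrt_pos.2 (mul_pos (by positivity) (by linarith))
    have hcd : ∀ r < t, HasDerivAt c (c' r) r := fun r hr => by
      have h0 : 2 * D * (t - r) ≠ 0 := (mul_pos (by positivity) (by linarith)).ne'
      have := (((hasDerivAt_id r).const_sub t).const_mul (2 * D)).sqrt h0
      convert! this using 1
      have := (hcpos r hr).ne'
      simp only [hc', hc] at this ⊢
      simp only [id]
      field_simp
    -- The derivative of c blows up at t. Staying to the left of the midpoint keeps it bounded, and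
    -- the resulting majorant is linear in |z|, hence integrable for the Gaussian.
    set m := (s + t) / 2 with hm
    have hsm : s < m := by rw [hm]; linarith [hs.2]
    have hmt : m < t := by rw [hm]; linarith [hs.2]
    have hnhds : Ioo 0 m ∈ 𝓝 s := Ioo_mem_nhds hs.1 hsm
    have hK : ∀ r ∈ Ioo 0 m, |c' r| ≤ D / c m := fun r hr => by
      have h1 := hcpos r (hr.2.trans hmt)
      have h2 := hcpos m hmt
      simp only [hc']
      rw [abs_div, abs_neg, abs_of_pos hD, abs_of_pos h1]
      refine div_le_div_of_nonneg_left hD.le h2 (Real.sqrt_le_sqrt ?_)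
      have := hr.2
      gcongr
    have hM0 : 0 ≤ M := (abs_nonneg _).trans (bv 0 ⟨le_rfl, ht.1.trans ht.2⟩ 0)
    have hTr : ∀ r ∈ Ioo 0 m, r ∈ Icc 0 T := fun r hr =>
      ⟨hr.1.le, (hr.2.trans hmt).le.trans ht.2⟩
    have main := hasDerivAt_integral_of_dominated_loc_of_deriv_le (μ := unitGaussian)
      (F := fun r z => v r (x + c r * z))
      (F' := fun r z => vt r (x + c r * z) + vx r (x + c r * z) * (c' r * z))
      (bound := fun z => M + M * (D / c m * |z|)) (x₀ := s) (s := Ioo 0 m) hnhds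
      (Eventually.of_forall fun r => ((cslice cv r).comp (by fun_prop)).aestronglyMeasurable)
      (Integrable.of_bound ((cslice cv s).comp (by fun_prop)).aestronglyMeasurable M
        (ae_of_all _ fun z => bv s (hTr s ⟨hs.1, hsm⟩) _))
      (((cslice cvt s).comp (by fun_prop)).add
        (((cslice cvx s).comp (by fun_prop)).mul (by fun_prop))).aestronglyMeasurable
      (ae_of_all _ fun z r hr => by
        rw [Real.norm_eq_abs]
        refine (abs_add_le _ _).trans (add_le_add (bvt r (hTr r hr) _) ?_)
        rw [abs_mul, abs_mul]
        refine mul_le_mul (bvx r (hTr r hr) _)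
          (mul_le_mul_of_nonneg_right (hK r hr) (abs_nonneg z)) (by positivity) hM0)
      ((integrable_const M).add ((integrable_id_unitGaussian.abs.const_mul _).const_mul _))
      (ae_of_all _ fun z r hr => by
        have := hchain (fun r => x + c r * z) (c' r * z) r
          (((hcd r (hr.2.trans hmt)).mul_const z).const_add x)
        exact this)
    convert! main.2 using 1
    have hsI := hTr s ⟨hs.1, hsm⟩
    have st := integral_mul_unitGaussian (p := fun z => vx s (x + c s * z))
      (p' := fun z => vxx s (x + c s * z) * c s) (M := max M (M * |c s|)) (fun z => by
        have h1 : HasDerivAt (fun z => x + c s * z) (c s) z := by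
          simpa using ((hasDerivAt_id z).const_mul (c s)).const_add x
        exact (hxx s (x + c s * z)).comp z h1)
      (((cslice cvxx s).comp (by fun_prop)).mul continuous_const)
      (fun z => (bvx s hsI _).trans (le_max_left _ _))
      (fun z => by
        rw [abs_mul]
        exact (mul_le_mul_of_nonneg_right (bvxx s hsI _) (abs_nonneg _)).trans (le_max_right _ _))
    have i1 : Integrable (fun z => vt s (x + c s * z)) unitGaussian :=
      Integrable.of_bound ((cslice cvt s).comp (by fun_prop)).aestronglyMeasurable M
        (ae_of_all _ fun z => bvt s hsI _)
    have i2 : Integrable (fun z => vxx s (x + c s * z)) unitGaussian :=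
      Integrable.of_bound ((cslice cvxx s).comp (by fun_prop)).aestronglyMeasurable M
        (ae_of_all _ fun z => bvxx s hsI _)
    have i3 : Integrable (fun z => z * vx s (x + c s * z)) unitGaussian := by
      have := integrable_id_unitGaussian.bdd_mul (c := M)
        ((cslice cvx s).comp (by fun_prop : Continuous fun z => x + c s * z)).aestronglyMeasurable
        (ae_of_all _ fun z => bvx s hsI _)
      simpa [mul_comm] using this
    have e3 : ∀ z, vt s (x + c s * z) + vx s (x + c s * z) * (c' s * z)
        = vt s (x + c s * z) + c' s * (z * vx s (x + c s * z)) := fun z => by ring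
    simp_rw [e3]
    rw [integral_add i1 (i3.const_mul _), integral_const_mul, st, integral_mul_const,
      integral_sub i1 (i2.const_mul _), integral_const_mul]
    have := (hcpos s hs.2).ne'
    simp only [hc']
    field_simp
    ring
  have ftc := intervalIntegral.integral_eq_sub_of_hasDerivAt_of_le ht.1 hkc hderiv
    (by
      rw [← uIcc_of_le ht.1] at hgi
      exact hgi.intervalIntegrable)
  have hkt : k t = v t x := by simp [hk, hc]
  have hk0 : k 0 = heatSemigroup D t (v 0) x := by
    rw [heatSemigroup_eq_integral_unitGaussian hD ht.1]; simp [hk, hc]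
  have hI : ∫ s in (0 : ℝ)..t, heatSemigroup D (t - s) (fun y => vt s y - D * vxx s y) x
      = ∫ s in (0 : ℝ)..t, ∫ z, g s (x + c s * z) ∂unitGaussian := by
    refine intervalIntegral.integral_congr fun s hs => ?_
    rw [uIcc_of_le ht.1] at hs
    exact heatSemigroup_eq_integral_unitGaussian hD (by linarith [hs.2]) _ _
  rw [hI, ftc, hkt, hk0]
  ring

/-! ### Fourier transform and deconvolution. -/

theorem integral_fourier_mul_eq_flip {f g : ℝ → ℂ} (hf : Integrable f) (hg : Integrable g) :
    ∫ ξ, 𝓕 f ξ * g ξ = ∫ x, f x * 𝓕 g x := by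
  simpa using! (VectorFourier.integral_fourierIntegral_smul_eq_flip (L := innerₗ ℝ)
    Real.continuous_fourierChar continuous_inner hf hg)

theorem continuous_fourier {f : ℝ → ℂ} (hf : Integrable f) : Continuous (𝓕 f) :=
  VectorFourier.fourierIntegral_continuous (L := innerₗ ℝ) Real.continuous_fourierChar
    continuous_inner hf

/-- The `L²` Fourier transform of an integrable function is given by the Fourier integral. -/
theorem fourier_toLp_ae_eq {m : ℝ → ℂ} (hm : Integrable m) (hm2 : MemLp m 2) :
    (𝓕 hm2.toLp : Lp ℂ 2 (volume : Measure ℝ)) =ᵐ[volume] 𝓕 m := by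
  have hL : LocallyIntegrable (𝓕 hm2.toLp : Lp ℂ 2 (volume : Measure ℝ)) :=
    (Lp.memLp _).locallyIntegrable (by norm_num)
  refine ae_eq_of_integral_contDiff_smul_eq hL (continuous_fourier hm).locallyIntegrable
    fun ψ hψ hψc => ?_
  have hψ' : ContDiff ℝ ∞ (fun x => (ψ x : ℂ)) := Complex.ofRealCLM.contDiff.comp hψ
  have hψc' : HasCompactSupport (fun x => (ψ x : ℂ)) :=
    hψc.comp_left (g := ((↑) : ℝ → ℂ)) Complex.ofReal_zero
  set S : SchwartzMap ℝ ℂ := hψc'.toSchwartzMap hψ' with hS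
  have hSa : ∀ x, S x = (ψ x : ℂ) := fun x => rfl
  -- Both transforms move onto the test function when they are paired with it, and so define the
  -- same distribution.
  have e := congrArg (fun T => T S) (Lp.fourier_toTemperedDistribution_eq hm2.toLp)
  simp only [TemperedDistribution.fourier_apply, Lp.toTemperedDistribution_apply] at e
  have e1 : ∫ x, (𝓕 S) x • (hm2.toLp : ℝ → ℂ) x = ∫ x, 𝓕 (fun x => (ψ x : ℂ)) x * m x := by
    refine integral_congr_ae (hm2.coeFn_toLp.mono fun x hx => ?_)
    simp only [hx, smul_eq_mul]
    rw [SchwartzMap.fourier_coe]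
    rfl
  rw [e1, integral_fourier_mul_eq_flip
    (hψ'.continuous.integrable_of_hasCompactSupport hψc') hm] at e
  simp only [hSa, smul_eq_mul] at e
  simpa [Complex.real_smul] using e.symm

/-- Plancherel's theorem for square integrable integrable functions. -/
theorem lintegral_fourier_sq {m : ℝ → ℂ} (hm : Integrable m) (hm2 : MemLp m 2) :
    ∫⁻ x, ‖𝓕 m x‖ₑ ^ 2 = ∫⁻ x, ‖m x‖ₑ ^ 2 := by
  have key : ∀ f : ℝ → ℂ, ∫⁻ x, ‖f x‖ₑ ^ 2 = eLpNorm f 2 volume ^ 2 := fun f => by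
    rw [eLpNorm_eq_lintegral_rpow_enorm_toReal (by norm_num) (by norm_num), ← ENNReal.rpow_natCast,
      ← ENNReal.rpow_mul]
    simp
  rw [key, key, ← eLpNorm_congr_ae (fourier_toLp_ae_eq hm hm2), ← eLpNorm_congr_ae hm2.coeFn_toLp,
    ← Lp.enorm_def, ← Lp.enorm_def, ← ofReal_norm, ← ofReal_norm, Lp.norm_fourier_eq]

theorem lintegral_fourierInv_sq {m : ℝ → ℂ} (hm : Integrable m) (hm2 : MemLp m 2) :
    ∫⁻ x, ‖𝓕⁻ m x‖ₑ ^ 2 = ∫⁻ x, ‖m x‖ₑ ^ 2 := by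
  simp_rw [Real.fourierInv_eq_fourier_neg]
  rw [← lintegral_fourier_sq hm hm2]
  exact lintegral_neg_eq_self (fun x => ‖𝓕 m x‖ₑ ^ 2)

/-- Convolution with an integrable function is a Fourier multiplier. -/
theorem integral_mul_fourierInv_comp {φ m : ℝ → ℂ} (hφ : Integrable φ) (hm : Integrable m)
    (x l : ℝ) :
    ∫ z, φ z * 𝓕⁻ m (x - l * z) = 𝓕⁻ (fun ξ => 𝓕 φ (l * ξ) * m ξ) x := by
  have hF : Integrable (fun p : ℝ × ℝ => φ p.1 * m p.2) (volume.prod volume) := hφ.mul_prod hm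
  have hF2 : Integrable (fun p : ℝ × ℝ =>
      (Real.fourierChar (p.2 * (x - l * p.1)) : ℂ) * (φ p.1 * m p.2)) (volume.prod volume) := by
    refine hF.bdd_mul (c := 1) ?_ (ae_of_all _ fun p => (Circle.norm_coe _).le)
    exact ((by fun_prop : Continuous ((↑) : Circle → ℂ)).comp
      (Real.continuous_fourierChar.comp (by fun_prop))).aestronglyMeasurable
  have e1 : ∀ z, φ z * 𝓕⁻ m (x - l * z)
      = ∫ ξ, (Real.fourierChar (ξ * (x - l * z)) : ℂ) * (φ z * m ξ) := fun z => by
    rw [Real.fourierInv_eq, ← integral_const_mul]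
    congr 1; ext ξ
    simp only [Circle.smul_def, smul_eq_mul, RCLike.inner_apply, conj_trivial]
    rw [mul_comm ξ]; ring
  simp_rw [e1]
  rw [integral_integral_swap hF2, Real.fourierInv_eq]
  congr 1; ext ξ
  rw [Real.fourier_real_eq, ← integral_mul_const, Circle.smul_def, smul_eq_mul,
    ← integral_const_mul]
  congr 1; ext z
  simp only [Circle.smul_def, smul_eq_mul, RCLike.inner_apply, conj_trivial]
  have : (Real.fourierChar (ξ * (x - l * z)) : ℂ)
      = (Real.fourierChar (x * ξ) : ℂ) * (Real.fourierChar (-(z * (l * ξ))) : ℂ) := by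
    rw [← Circle.coe_mul, ← AddChar.map_add_eq_mul]
    congr 2; ring
  rw [this]; ring

/-- The Fourier multiplier with which convolution by `l⁻¹ φ(·/l)` is undone. -/
def deconvolution (φ : ℝ → ℂ) (l : ℝ) (w : ℝ → ℝ) (x : ℝ) : ℝ :=
  (𝓕⁻ (fun ξ => 𝓕 (fun y => (w y : ℂ)) ξ / 𝓕 φ (l * ξ)) x).re

/-- On the Fourier side the convolution multiplies by the transform of φ at lξ, which cancels the
division in `deconvolution`. Taking real parts is harmless because φ and w are real. -/
theorem conv_deconvolution {φ w : ℝ → ℝ} {l : ℝ} (hl : 0 < l) (hφ : Integrable φ)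
    (h0 : ∀ ξ, 𝓕 (fun x => (φ x : ℂ)) ξ ≠ 0) (hw : Continuous w) (hwi : Integrable w)
    (hF : Integrable (𝓕 (fun y => (w y : ℂ))))
    (hm : Integrable (fun ξ => 𝓕 (fun y => (w y : ℂ)) ξ / 𝓕 (fun x => (φ x : ℂ)) (l * ξ)))
    (x : ℝ) :
    ∫ x', 1 / l * φ ((x - x') / l) * deconvolution (fun x => (φ x : ℂ)) l w x' = w x := by
  set m := fun ξ => 𝓕 (fun y => (w y : ℂ)) ξ / 𝓕 (fun x => (φ x : ℂ)) (l * ξ) with hmdef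
  have hcv := integral_mul_fourierInv_comp (φ := fun x => (φ x : ℂ)) hφ.ofReal hm x l
  have hmm : (fun ξ => 𝓕 (fun x => (φ x : ℂ)) (l * ξ) * m ξ) = 𝓕 (fun y => (w y : ℂ)) := by
    ext ξ; simp only [hmdef]; rw [mul_div_cancel₀ _ (h0 _)]
  rw [hmm, Continuous.fourierInv_fourier_eq (by fun_prop) hwi.ofReal hF] at hcv
  have hsub : ∫ x', 1 / l * φ ((x - x') / l) * deconvolution (fun x => (φ x : ℂ)) l w x'
      = ∫ z, φ z * deconvolution (fun x => (φ x : ℂ)) l w (x - l * z) := by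
    have h1 := integral_sub_left_eq_self (fun y => 1 / l * φ (y / l) *
      deconvolution (fun x => (φ x : ℂ)) l w (x - y)) volume x
    simp only [sub_sub_cancel] at h1
    rw [h1]
    have h2 := Measure.integral_comp_mul_left (fun y => 1 / l * φ (y / l) *
      deconvolution (fun x => (φ x : ℂ)) l w (x - y)) l
    rw [abs_of_pos (inv_pos.2 hl), smul_eq_mul] at h2
    have h3 : ∫ y, 1 / l * φ (y / l) * deconvolution (fun x => (φ x : ℂ)) l w (x - y)
        = l * ∫ z, 1 / l * φ (l * z / l) * deconvolution (fun x => (φ x : ℂ)) l w (x - l * z) := by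
      rw [h2]; field_simp
    rw [h3, ← integral_const_mul]
    congr 1; ext z
    rw [mul_div_cancel_left₀ _ hl.ne']
    field_simp
  have hb : ∀ y, ‖𝓕⁻ m y‖ ≤ ∫ ξ, ‖m ξ‖ := fun y => by
    rw [Real.fourierInv_eq]
    refine (norm_integral_le_integral_norm _).trans (le_of_eq ?_)
    simp
  have hc : Continuous (𝓕⁻ m) := by
    have : 𝓕⁻ m = fun x => 𝓕 m (-x) := by ext; rw [Real.fourierInv_eq_fourier_neg]
    rw [this]
    exact (continuous_fourier hm).comp continuous_neg
  have hint : Integrable (fun z => (φ z : ℂ) * 𝓕⁻ m (x - l * z)) := by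
    have := (hφ.ofReal (𝕜 := ℂ)).bdd_mul (f := fun z => 𝓕⁻ m (x - l * z))
      (hc.comp (by fun_prop)).aestronglyMeasurable (ae_of_all _ fun z => hb _)
    simpa [mul_comm] using this
  rw [hsub]
  have h4 := congrArg Complex.re hcv
  simp only [Complex.ofReal_re] at h4
  rw [← h4]
  have h5 := integral_re hint
  simp only [RCLike.re_eq_complex_re, Complex.re_ofReal_mul] at h5
  exact h5

theorem stronglyMeasurable_fourier {w : ℝ → ℝ → ℂ} (hw : StronglyMeasurable fun p : ℝ × ℝ => w p.1 p.2) :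
    StronglyMeasurable (fun p : ℝ × ℝ => 𝓕 (w p.1) p.2) := by
  simp_rw [Real.fourier_real_eq, Circle.smul_def, smul_eq_mul]
  refine StronglyMeasurable.integral_prod_right (f := fun (p : ℝ × ℝ) (v : ℝ) =>
    (Real.fourierChar (-(v * p.2)) : ℂ) * w p.1 v) ?_
  refine StronglyMeasurable.mul (f := fun q : (ℝ × ℝ) × ℝ =>
    (Real.fourierChar (-(q.2 * q.1.2)) : ℂ)) (g := fun q => w q.1.1 q.2) ?_ ?_
  · exact ((by fun_prop : Continuous ((↑) : Circle → ℂ)).comp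
      (Real.continuous_fourierChar.comp (by fun_prop))).stronglyMeasurable
  · exact hw.comp_measurable (by fun_prop : Measurable fun q : (ℝ × ℝ) × ℝ => (q.1.1, q.2))

theorem stronglyMeasurable_fourierInv {w : ℝ → ℝ → ℂ}
    (hw : StronglyMeasurable fun p : ℝ × ℝ => w p.1 p.2) :
    StronglyMeasurable (fun p : ℝ × ℝ => 𝓕⁻ (w p.1) p.2) := by
  simp_rw [Real.fourierInv_eq_fourier_neg]
  exact (stronglyMeasurable_fourier hw).comp_measurable
    (g := fun p : ℝ × ℝ => (p.1, -p.2)) (by fun_prop)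

/-! ### Realizing a smooth decaying forcing by controls of nearly white-noise cost. -/

theorem enorm_sq_eq_ofReal (a : ℝ) : ‖a‖ₑ ^ 2 = ENNReal.ofReal (a ^ 2) := by
  rw [Real.enorm_eq_ofReal_abs, ← ENNReal.ofReal_pow (abs_nonneg _), sq_abs]

theorem lintegral_enorm_sq_lt_top_of_memLp {α : Type*} [MeasurableSpace α] {μ : Measure α}
    {f : α → ℝ} (h : MemLp f 2 μ) : ∫⁻ x, ‖f x‖ₑ ^ 2 ∂μ < ⊤ := by
  have := (eLpNorm_lt_top_iff_lintegral_rpow_enorm_lt_top (by norm_num) (by norm_num)).1 h.2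
  simpa using this

theorem memLp_two_of_lintegral_lt_top {α : Type*} [MeasurableSpace α] {μ : Measure α}
    {f : α → ℝ} (hf : AEStronglyMeasurable f μ) (h : ∫⁻ x, ‖f x‖ₑ ^ 2 ∂μ < ⊤) : MemLp f 2 μ :=
  ⟨hf, (eLpNorm_lt_top_iff_lintegral_rpow_enorm_lt_top (by norm_num) (by norm_num)).2
    (by simpa using h)⟩

/-- A smooth rapidly decaying path is realized by controls, at a cost that converges to the cost
for spatially white noise as the correlation length vanishes. -/
theorem eventually_exists_control {T : ℝ} {φ₁ : ℝ → ℝ} (hφ : IsCorrelationProfile φ₁)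
    {w : ℝ → ℝ → ℝ} {b : ℝ → ℝ} (hwc : Continuous (Function.uncurry w)) (hb : Integrable b)
    (hb2 : MemLp b 2) (hwb : ∀ t ∈ Icc 0 T, ∀ x, |w t x| ≤ b x)
    (hdec : ∀ n : ℕ, ∃ C : ℝ, ∀ t ∈ Icc 0 T, ∀ ξ,
      (1 + |ξ|) ^ n * ‖𝓕 (fun x => (w t x : ℂ)) ξ‖ ≤ C)
    {K : ℝ≥0∞} (hK : (1 / 2) * ∫⁻ t in Icc 0 T, ∫⁻ x, ENNReal.ofReal (w t x ^ 2) < K) :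
    ∀ᶠ lc in 𝓝[>] (0 : ℝ), ∃ h : ℝ → ℝ → ℝ, IsControl T h ∧ controlCost T h ≤ K ∧
      ∀ t ∈ Icc 0 T, ∀ x, ∫ x', 1 / lc * φ₁ ((x - x') / lc) * h t x' = w t x := by
  set W : ℝ → ℝ → ℂ := fun t => 𝓕 (fun x => (w t x : ℂ)) with hW
  set P : ℝ → ℂ := 𝓕 (fun x => (φ₁ x : ℂ)) with hP
  set m : ℝ → ℝ → ℝ → ℂ := fun lc t ξ => W t ξ / P (lc * ξ) with hm
  have hPc : Continuous P := continuous_fourier hφ.integrable.ofReal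
  have hws : ∀ t, Continuous (w t) := fun t => hwc.comp (by fun_prop : Continuous fun y => (t, y))
  have hwi : ∀ t ∈ Icc 0 T, Integrable (w t) := fun t ht =>
    hb.mono' (hws t).aestronglyMeasurable (ae_of_all _ (hwb t ht))
  have hw2 : ∀ t ∈ Icc 0 T, MemLp (w t) 2 := fun t ht =>
    hb2.mono' (hws t).aestronglyMeasurable (ae_of_all _ (hwb t ht))
  have hWc : ∀ t ∈ Icc 0 T, Continuous (W t) := fun t ht => continuous_fourier (hwi t ht).ofReal
  have hWm : StronglyMeasurable (fun p : ℝ × ℝ => W p.1 p.2) :=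
    stronglyMeasurable_fourier (w := fun t x => (w t x : ℂ))
      (Complex.continuous_ofReal.comp hwc).stronglyMeasurable
  have hmm : ∀ lc, StronglyMeasurable (fun p : ℝ × ℝ => m lc p.1 p.2) := fun lc =>
    hWm.div (hPc.comp (by fun_prop : Continuous fun p : ℝ × ℝ => lc * p.2)).stronglyMeasurable
  have hmc : ∀ lc, ∀ t ∈ Icc 0 T, Continuous (m lc t) := fun lc t ht =>
    (hWc t ht).div (hPc.comp (by fun_prop)) fun ξ => hφ.fourier_ne_zero _
  obtain ⟨C₁, k, hC₁⟩ := hφ.inv_fourier_growth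
  -- Of the k + 2 powers of decay, k absorb the growth of 1/P and the remaining two make the
  -- quotient integrable.
  obtain ⟨C₂, hC₂⟩ := hdec (k + 2)
  have hC₁0 : 0 ≤ C₁ := by
    have := (by positivity : 0 ≤ 1 / ‖P 0‖).trans (hC₁ 0)
    simpa using this
  set B := C₁ * |C₂| with hB
  have hB0 : 0 ≤ B := by positivity
  have hsq : ∀ ξ : ℝ, 1 + ξ ^ 2 ≤ (1 + |ξ|) ^ 2 := fun ξ => by
    nlinarith [abs_nonneg ξ, sq_abs ξ]
  -- The restriction lc ≤ 1 gives |lc ξ| ≤ |ξ|, so that the bound is uniform in lc and serves as a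
  -- dominating function below.
  have hbound : ∀ lc ∈ Ioc (0 : ℝ) 1, ∀ t ∈ Icc 0 T, ∀ ξ, ‖m lc t ξ‖ ≤ B * (1 + ξ ^ 2)⁻¹ := by
    intro lc hlc t ht ξ
    have h1 : 1 / ‖P (lc * ξ)‖ ≤ C₁ * (1 + |ξ|) ^ k := by
      refine (hC₁ _).trans (mul_le_mul_of_nonneg_left (pow_le_pow_left₀ (by positivity) ?_ k) hC₁0)
      rw [abs_mul, abs_of_pos hlc.1]
      nlinarith [abs_nonneg ξ, hlc.2]
    have hp : 0 < 1 + |ξ| := by positivity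
    have h2 : ‖W t ξ‖ ≤ |C₂| / (1 + |ξ|) ^ (k + 2) := by
      rw [le_div_iff₀ (by positivity), mul_comm]
      exact (hC₂ t ht ξ).trans (le_abs_self _)
    simp only [hm]
    rw [norm_div, div_eq_mul_one_div]
    calc ‖W t ξ‖ * (1 / ‖P (lc * ξ)‖)
        ≤ |C₂| / (1 + |ξ|) ^ (k + 2) * (C₁ * (1 + |ξ|) ^ k) :=
          mul_le_mul h2 h1 (by positivity) (by positivity)
      _ = B * ((1 + |ξ|) ^ 2)⁻¹ := by
          rw [hB, pow_add]; field_simp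
      _ ≤ B * (1 + ξ ^ 2)⁻¹ := by
          gcongr; exact hsq ξ
  have hle1 : ∀ ξ : ℝ, (1 + ξ ^ 2)⁻¹ ≤ 1 := fun ξ => inv_le_one_of_one_le₀ (by nlinarith)
  have hmi : ∀ lc ∈ Ioc (0 : ℝ) 1, ∀ t ∈ Icc 0 T, Integrable (m lc t) := fun lc hlc t ht =>
    (integrable_inv_one_add_sq.const_mul B).mono' (hmc lc t ht).aestronglyMeasurable
      (ae_of_all _ (hbound lc hlc t ht))
  have hm2 : ∀ lc ∈ Ioc (0 : ℝ) 1, ∀ t ∈ Icc 0 T, MemLp (m lc t) 2 := fun lc hlc t ht => by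
    rw [memLp_two_iff_integrable_sq_norm (hmc lc t ht).aestronglyMeasurable]
    refine (integrable_inv_one_add_sq.const_mul (B ^ 2)).mono'
      ((hmc lc t ht).norm.pow 2).aestronglyMeasurable (ae_of_all _ fun ξ => ?_)
    have hn := hbound lc hlc t ht ξ
    have h0 : 0 ≤ (1 + ξ ^ 2)⁻¹ := by positivity
    rw [Real.norm_eq_abs, abs_of_nonneg (by positivity)]
    calc ‖m lc t ξ‖ ^ 2 ≤ (B * (1 + ξ ^ 2)⁻¹) ^ 2 := by gcongr
      _ = B ^ 2 * ((1 + ξ ^ 2)⁻¹ * (1 + ξ ^ 2)⁻¹) := by ring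
      _ ≤ B ^ 2 * ((1 + ξ ^ 2)⁻¹ * 1) := by
          gcongr; exact hle1 ξ
      _ = _ := by ring
  set μ : Measure (ℝ × ℝ) := (volume.restrict (Icc 0 T)).prod volume with hμ
  set G : ℝ → ℝ≥0∞ := fun lc => ∫⁻ p, ‖m lc p.1 p.2‖ₑ ^ 2 ∂μ with hG
  have haeT : ∀ {q : ℝ × ℝ → Prop}, (∀ p : ℝ × ℝ, p.1 ∈ Icc 0 T → q p) → ∀ᵐ p ∂μ, q p := by
    intro q hq
    have : ∀ᵐ t ∂(volume.restrict (Icc 0 T)), t ∈ Icc 0 T := ae_restrict_mem measurableSet_Icc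
    have := Measure.quasiMeasurePreserving_fst (μ := volume.restrict (Icc 0 T))
      (ν := (volume : Measure ℝ)) |>.ae this
    exact this.mono hq
  have hbi : ∫⁻ p : ℝ × ℝ, ENNReal.ofReal (B ^ 2 * (1 + p.2 ^ 2)⁻¹) ∂μ ≠ ⊤ := by
    have : Integrable (fun p : ℝ × ℝ => (1 : ℝ) * (B ^ 2 * (1 + p.2 ^ 2)⁻¹)) μ :=
      (integrable_const (1 : ℝ)).mul_prod (integrable_inv_one_add_sq.const_mul (B ^ 2))
    simp only [one_mul] at this
    exact this.lintegral_lt_top.ne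
  have hbd2 : ∀ lc ∈ Ioc (0 : ℝ) 1, ∀ p : ℝ × ℝ, p.1 ∈ Icc 0 T →
      ‖m lc p.1 p.2‖ₑ ^ 2 ≤ ENNReal.ofReal (B ^ 2 * (1 + p.2 ^ 2)⁻¹) := by
    intro lc hlc p hp
    rw [← ofReal_norm, ← ENNReal.ofReal_pow (norm_nonneg _)]
    refine ENNReal.ofReal_le_ofReal ?_
    have hn := hbound lc hlc p.1 hp p.2
    have h0 : 0 ≤ (1 + p.2 ^ 2)⁻¹ := by positivity
    calc ‖m lc p.1 p.2‖ ^ 2 ≤ (B * (1 + p.2 ^ 2)⁻¹) ^ 2 := by gcongr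
      _ = B ^ 2 * ((1 + p.2 ^ 2)⁻¹ * (1 + p.2 ^ 2)⁻¹) := by ring
      _ ≤ B ^ 2 * ((1 + p.2 ^ 2)⁻¹ * 1) := by
          gcongr; exact hle1 _
      _ = _ := by ring
  have hlc1 : ∀ᶠ lc in 𝓝[>] (0 : ℝ), lc ∈ Ioc (0 : ℝ) 1 := Ioc_mem_nhdsGT one_pos
  -- The multiplier 1/P(lc ξ) tends to 1/P(0) = 1 for every frequency; by Plancherel the limit is
  -- the squared norm of w.
  have hlim : Tendsto G (𝓝[>] 0) (𝓝 (∫⁻ p, ‖W p.1 p.2‖ₑ ^ 2 ∂μ)) := by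
    refine tendsto_lintegral_filter_of_dominated_convergence _
      (Eventually.of_forall fun lc => ((hmm lc).measurable.enorm.pow_const 2))
      (hlc1.mono fun lc hlc => haeT (hbd2 lc hlc)) hbi (ae_of_all _ fun p => ?_)
    have h1 : Tendsto (fun lc : ℝ => P (lc * p.2)) (𝓝[>] 0) (𝓝 1) := by
      have : Tendsto (fun lc : ℝ => P (lc * p.2)) (𝓝 0) (𝓝 (P (0 * p.2))) :=
        (hPc.comp (by fun_prop : Continuous fun lc : ℝ => lc * p.2)).tendsto 0
      rw [zero_mul, hP, hφ.fourier_zero] at this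
      exact this.mono_left nhdsWithin_le_nhds
    have h2 : Tendsto (fun lc => m lc p.1 p.2) (𝓝[>] 0) (𝓝 (W p.1 p.2)) := by
      have := (tendsto_const_nhds (x := W p.1 p.2)).div h1 one_ne_zero
      rwa [div_one] at this
    exact ((ENNReal.continuous_pow 2).tendsto _).comp h2.enorm
  have hplW : ∫⁻ p, ‖W p.1 p.2‖ₑ ^ 2 ∂μ = ∫⁻ t in Icc 0 T, ∫⁻ x, ENNReal.ofReal (w t x ^ 2) := by
    rw [hμ, lintegral_prod _ (hWm.measurable.enorm.pow_const 2).aemeasurable]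
    refine setLIntegral_congr_fun measurableSet_Icc fun t ht => ?_
    simp only [hW]
    refine (lintegral_fourier_sq (m := fun x => (w t x : ℂ)) (hwi t ht).ofReal
      (hw2 t ht).ofReal).trans (lintegral_congr fun x => ?_)
    rw [← enorm_sq_eq_ofReal, ← ofReal_norm, ← ofReal_norm, Complex.norm_real]
  rw [hplW] at hlim
  have hev : ∀ᶠ lc in 𝓝[>] (0 : ℝ), (1 / 2) * G lc < K :=
    (ENNReal.Tendsto.const_mul hlim (Or.inr (by simp))).eventually_lt_const hK
  filter_upwards [hlc1, hev] with lc hlc hlt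
  set h : ℝ → ℝ → ℝ := fun t => deconvolution (fun x => (φ₁ x : ℂ)) lc (w t) with hh
  have hhm : StronglyMeasurable (Function.uncurry h) := by
    have h1 := stronglyMeasurable_fourierInv (hmm lc)
    exact (Complex.measurable_re.comp h1.measurable).stronglyMeasurable
  -- An inequality suffices here: taking the real part can only decrease the norm.
  have hcost : ∫⁻ t in Icc 0 T, ∫⁻ x, ENNReal.ofReal (h t x ^ 2) ≤ G lc := by
    have hGe : G lc = ∫⁻ t in Icc 0 T, ∫⁻ ξ, ‖m lc t ξ‖ₑ ^ 2 :=
      lintegral_prod _ ((hmm lc).measurable.enorm.pow_const 2).aemeasurable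
    rw [hGe]
    refine setLIntegral_mono_ae' measurableSet_Icc (ae_of_all _ fun t ht => ?_)
    refine le_trans ?_ (lintegral_fourierInv_sq (hmi lc hlc t ht) (hm2 lc hlc t ht)).le
    refine lintegral_mono fun x => ?_
    rw [← enorm_sq_eq_ofReal, ← ofReal_norm, ← ofReal_norm]
    exact pow_le_pow_left₀ zero_le (ENNReal.ofReal_le_ofReal (Complex.abs_re_le_norm _)) 2
  have hGfin : G lc < ⊤ := by
    refine lt_of_le_of_lt (lintegral_mono_ae (haeT (hbd2 lc hlc))) hbi.lt_top
  refine ⟨h, memLp_two_of_lintegral_lt_top hhm.aestronglyMeasurable ?_, ?_, fun t ht x => ?_⟩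
  · rw [lintegral_prod _ (hhm.measurable.enorm.pow_const 2).aemeasurable]
    refine lt_of_le_of_lt (le_of_eq ?_) (hcost.trans_lt hGfin)
    simp_rw [← enorm_sq_eq_ofReal]
    rfl
  · exact (mul_le_mul_right hcost _).trans hlt.le
  · obtain ⟨C₀, hC₀⟩ := hdec 2
    refine conv_deconvolution hlc.1 hφ.integrable hφ.fourier_ne_zero (hws t) (hwi t ht) ?_
      (hmi lc hlc t ht) x
    refine (integrable_inv_one_add_sq.const_mul |C₀|).mono' (hWc t ht).aestronglyMeasurable
      (ae_of_all _ fun ξ => ?_)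
    rw [← div_eq_mul_inv, le_div_iff₀ (by positivity), mul_comm]
    calc (1 + ξ ^ 2) * ‖W t ξ‖ ≤ (1 + |ξ|) ^ 2 * ‖W t ξ‖ := by
          gcongr; exact hsq ξ
      _ ≤ |C₀| := (hC₀ t ht ξ).trans (le_abs_self _)

/-! ### Weighted bounds on derivatives, uniform in a parameter. -/

/-- The functions `f i` and their derivatives up to order `n` are bounded, uniformly in `i`, by
multiples of the weight `ρ`. -/
def DerivBound {ι : Type*} (ρ : ℝ → ℝ) : ℕ → (ι → ℝ → ℝ) → Prop
  | 0, f => (∀ i, Continuous (f i)) ∧ ∃ C, ∀ i x, |f i x| ≤ C * ρ x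
  | n + 1, f => (∀ i, Differentiable ℝ (f i)) ∧ (∃ C, ∀ i x, |f i x| ≤ C * ρ x) ∧
      DerivBound ρ n fun i => deriv (f i)

namespace DerivBound

variable {ι κ : Type*} {ρ ρ' : ℝ → ℝ} {n : ℕ} {f g : ι → ℝ → ℝ}

theorem bound (h : DerivBound ρ n f) : ∃ C, ∀ i x, |f i x| ≤ C * ρ x := by
  cases n with
  | zero => exact h.2
  | succ n => exact h.2.1

theorem continuous (h : DerivBound ρ n f) (i : ι) : Continuous (f i) := by
  cases n with
  | zero => exact h.1 i
  | succ n => exact (h.1 i).continuous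

theorem of_succ (h : DerivBound ρ (n + 1) f) : DerivBound ρ n f := by
  induction n generalizing f with
  | zero => exact ⟨fun i => (h.1 i).continuous, h.2.1⟩
  | succ n ih => exact ⟨h.1, h.2.1, ih h.2.2⟩

theorem mono {C₀ : ℝ} (hρ : ∀ x, 0 ≤ ρ x) (hρρ : ∀ x, ρ x ≤ C₀ * ρ' x)
    (h : DerivBound ρ n f) : DerivBound ρ' n f := by
  have key : ∀ {f : ι → ℝ → ℝ}, (∃ C, ∀ i x, |f i x| ≤ C * ρ x) →
      ∃ C, ∀ i x, |f i x| ≤ C * ρ' x := by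
    rintro f ⟨C, hC⟩
    refine ⟨|C| * C₀, fun i x => (hC i x).trans ?_⟩
    calc C * ρ x ≤ |C| * ρ x := by
          gcongr
          · exact hρ x
          · exact le_abs_self C
      _ ≤ |C| * (C₀ * ρ' x) := by
          gcongr; exact hρρ x
      _ = _ := by ring
  induction n generalizing f with
  | zero => exact ⟨h.1, key h.2⟩
  | succ n ih => exact ⟨h.1, key h.2.1, ih h.2.2⟩

theorem reindex (h : DerivBound ρ n f) (σ : κ → ι) : DerivBound ρ n fun i => f (σ i) := by
  induction n generalizing f with
  | zero =>
    obtain ⟨C, hC⟩ := h.2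
    exact ⟨fun i => h.1 _, C, fun i => hC _⟩
  | succ n ih =>
    obtain ⟨C, hC⟩ := h.2.1
    exact ⟨fun i => h.1 _, ⟨C, fun i => hC _⟩, ih h.2.2⟩

theorem add (hf : DerivBound ρ n f) (hg : DerivBound ρ n g) :
    DerivBound ρ n fun i x => f i x + g i x := by
  have key : ∀ {f g : ι → ℝ → ℝ}, (∃ C, ∀ i x, |f i x| ≤ C * ρ x) →
      (∃ C, ∀ i x, |g i x| ≤ C * ρ x) → ∃ C, ∀ i x, |f i x + g i x| ≤ C * ρ x := by
    rintro f g ⟨C, hC⟩ ⟨C', hC'⟩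
    refine ⟨C + C', fun i x => (abs_add_le _ _).trans ?_⟩
    rw [add_mul]
    exact add_le_add (hC i x) (hC' i x)
  induction n generalizing f g with
  | zero => exact ⟨fun i => (hf.1 i).add (hg.1 i), key hf.2 hg.2⟩
  | succ n ih =>
    refine ⟨fun i => (hf.1 i).add (hg.1 i), key hf.2.1 hg.2.1, ?_⟩
    have : (fun i => deriv fun x => f i x + g i x) = fun i x => deriv (f i) x + deriv (g i) x := by
      ext i x
      exact deriv_fun_add (hf.1 i x) (hg.1 i x)
    rw [this]
    exact ih hf.2.2 hg.2.2

theorem mul (hρ : ∀ x, 0 ≤ ρ x) (hρ' : ∀ x, 0 ≤ ρ' x) (hf : DerivBound ρ n f)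
    (hg : DerivBound ρ' n g) :
    DerivBound (fun x => ρ x * ρ' x) n fun i x => f i x * g i x := by
  have key : ∀ {f g : ι → ℝ → ℝ}, (∃ C, ∀ i x, |f i x| ≤ C * ρ x) →
      (∃ C, ∀ i x, |g i x| ≤ C * ρ' x) → ∃ C, ∀ i x, |f i x * g i x| ≤ C * (ρ x * ρ' x) := by
    rintro f g ⟨C, hC⟩ ⟨C', hC'⟩
    refine ⟨|C| * |C'|, fun i x => ?_⟩
    rw [abs_mul]
    calc |f i x| * |g i x| ≤ (|C| * ρ x) * (|C'| * ρ' x) := by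
          have h1 := (hC i x).trans (mul_le_mul_of_nonneg_right (le_abs_self C) (hρ x))
          have h2 := (hC' i x).trans (mul_le_mul_of_nonneg_right (le_abs_self C') (hρ' x))
          exact mul_le_mul h1 h2 (abs_nonneg _) (mul_nonneg (abs_nonneg _) (hρ x))
      _ = _ := by ring
  induction n generalizing f g with
  | zero => exact ⟨fun i => (hf.1 i).mul (hg.1 i), key hf.2 hg.2⟩
  | succ n ih =>
    refine ⟨fun i => (hf.1 i).mul (hg.1 i), key hf.2.1 hg.2.1, ?_⟩
    have : (fun i => deriv fun x => f i x * g i x)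
        = fun i x => deriv (f i) x * g i x + f i x * deriv (g i) x := by
      ext i x
      exact deriv_fun_mul (hf.1 i x) (hg.1 i x)
    rw [this]
    exact (ih hf.2.2 hg.of_succ).add (ih hf.of_succ hg.2.2)

theorem const {c : ι → ℝ} {M : ℝ} (hM : ∀ i, |c i| ≤ M) :
    DerivBound (fun _ => 1) n fun i _ => c i := by
  have h0 : ∀ n, DerivBound (ι := ι) (fun _ => 1) n fun _ _ => 0 := by
    intro n
    induction n with
    | zero => exact ⟨fun _ => continuous_const, 0, by simp⟩
    | succ n ih => exact ⟨fun _ => differentiable_const _, ⟨0, by simp⟩, by simpa using ih⟩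
  cases n with
  | zero => exact ⟨fun _ => continuous_const, M, fun i _ => by simpa using hM i⟩
  | succ n =>
    exact ⟨fun _ => differentiable_const _, ⟨M, fun i _ => by simpa using hM i⟩,
      by simpa using h0 n⟩

theorem const_mul {c : ι → ℝ} {M : ℝ} (hM : ∀ i, |c i| ≤ M) (hρ : ∀ x, 0 ≤ ρ x)
    (hf : DerivBound ρ n f) : DerivBound ρ n fun i x => c i * f i x := by
  simpa using (const (n := n) hM).mul (fun _ => zero_le_one) hρ hf

/-- Translations by bounded amounts, for a weight that they change by bounded factors only. -/
theorem comp_sub {a : ι → ℝ} {C₀ : ℝ} (hρ : ∀ x, 0 ≤ ρ x) (ha : ∀ i x, ρ (x - a i) ≤ C₀ * ρ x)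
    (hf : DerivBound ρ n f) : DerivBound ρ n fun i x => f i (x - a i) := by
  have key : ∀ {f : ι → ℝ → ℝ}, (∃ C, ∀ i x, |f i x| ≤ C * ρ x) →
      ∃ C, ∀ i x, |f i (x - a i)| ≤ C * ρ x := by
    rintro f ⟨C, hC⟩
    refine ⟨|C| * C₀, fun i x => (hC i _).trans ?_⟩
    calc C * ρ (x - a i) ≤ |C| * ρ (x - a i) :=
          mul_le_mul_of_nonneg_right (le_abs_self C) (hρ _)
      _ ≤ |C| * (C₀ * ρ x) := by
          gcongr; exact ha i x
      _ = _ := by ring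
  induction n generalizing f with
  | zero => exact ⟨fun i => (hf.1 i).comp (by fun_prop), key hf.2⟩
  | succ n ih =>
    refine ⟨fun i => (hf.1 i).comp (by fun_prop), key hf.2.1, ?_⟩
    have : (fun i => deriv fun x => f i (x - a i)) = fun i x => deriv (f i) (x - a i) := by
      ext i x
      exact deriv_comp_sub_const (f i) (a i) x
    rw [this]
    exact ih hf.2.2

/-- Composition with a function that is smooth on a compact set. -/
theorem comp_left {I : Set ℝ} {G : ℝ → ℝ} (hI : IsCompact I) (hu : UniqueDiffOn ℝ I)
    (hG : ContDiffOn ℝ ∞ G I) (hf : DerivBound (fun _ => 1) n f) (hfI : ∀ i x, f i x ∈ I) :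
    DerivBound (fun _ => 1) n fun i x => G (f i x) := by
  have key : ∃ C : ℝ, ∀ i x, |G (f i x)| ≤ C * 1 := by
    obtain ⟨C, hC⟩ := hI.exists_bound_of_continuousOn hG.continuousOn
    exact ⟨C, fun i x => by simpa using hC _ (hfI i x)⟩
  induction n generalizing G with
  | zero => exact ⟨fun i => hG.continuousOn.comp_continuous (hf.1 i) (hfI i), key⟩
  | succ n ih =>
    -- `G` is known to be differentiable only within `I`; the chain rule applies because `f i` never
    -- leaves `I`.
    have hd : ∀ i x, HasDerivAt (fun x => G (f i x))
        (derivWithin G I (f i x) * deriv (f i) x) x := fun i x =>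
      (hG.differentiableOn (by norm_num) _ (hfI i x)).hasDerivWithinAt.comp_hasDerivAt x
        (hf.1 i x).hasDerivAt (Eventually.of_forall (hfI i))
    refine ⟨fun i x => (hd i x).differentiableAt, key, ?_⟩
    have : (fun i => deriv fun x => G (f i x))
        = fun i x => derivWithin G I (f i x) * deriv (f i) x := by
      ext i x
      exact (hd i x).deriv
    rw [this]
    have hG' : ContDiffOn ℝ ∞ (derivWithin G I) I := hG.derivWithin hu (by simp)
    have h1 := ih hG' hf.of_succ (by
      obtain ⟨C, hC⟩ := hI.exists_bound_of_continuousOn hG'.continuousOn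
      exact ⟨C, fun i x => by simpa using hC _ (hfI i x)⟩)
    simpa using h1.mul (fun _ => zero_le_one) (fun _ => zero_le_one) hf.2.2

theorem of_iteratedDeriv {F : ℝ → ℝ} (hF : ContDiff ℝ ∞ F)
    (hb : ∀ j ≤ n, ∃ C, ∀ x, |iteratedDeriv j F x| ≤ C * ρ x) :
    DerivBound ρ n fun _ : ι => F := by
  have h0 : ∃ C, ∀ x, |F x| ≤ C * ρ x := by simpa using hb 0 (Nat.zero_le n)
  obtain ⟨C, hC⟩ := h0
  induction n generalizing F C with
  | zero => exact ⟨fun _ => hF.continuous, C, fun _ => hC⟩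
  | succ n ih =>
    refine ⟨fun _ => hF.differentiable (by norm_num), ⟨C, fun _ => hC⟩, ?_⟩
    obtain ⟨C', hC'⟩ := hb 1 (by omega)
    refine ih (contDiff_infty_iff_deriv.1 hF).2 (fun j hj => ?_) C' (by simpa using hC')
    rw [← iteratedDeriv_succ']
    exact hb (j + 1) (by omega)

/-- The decay of the Fourier transform. -/
theorem fourier_decay (hρ : Integrable ρ) (hf : DerivBound ρ n f) :
    ∃ C, ∀ i ξ, (1 + |ξ|) ^ n * ‖𝓕 (fun x => (f i x : ℂ)) ξ‖ ≤ C := by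
  have base : ∀ {n} {f : ι → ℝ → ℝ}, DerivBound ρ n f →
      ∃ C, ∀ i ξ, ‖𝓕 (fun x => (f i x : ℂ)) ξ‖ ≤ C := by
    intro n f hf
    obtain ⟨C, hC⟩ := hf.bound
    refine ⟨∫ x, C * ρ x, fun i ξ => ?_⟩
    rw [Real.fourier_real_eq]
    refine (norm_integral_le_integral_norm _).trans ?_
    simp only [Circle.norm_smul, Complex.norm_real, Real.norm_eq_abs]
    exact integral_mono_of_nonneg (ae_of_all _ fun x => abs_nonneg _) (hρ.const_mul C)
      (ae_of_all _ (hC i))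
  have hint : ∀ {n} {f : ι → ℝ → ℝ}, DerivBound ρ n f → ∀ i, Integrable (f i) := by
    intro n f hf i
    obtain ⟨C, hC⟩ := hf.bound
    exact (hρ.const_mul C).mono' (hf.continuous i).aestronglyMeasurable (ae_of_all _ (hC i))
  induction n generalizing f with
  | zero =>
    obtain ⟨C, hC⟩ := base hf
    exact ⟨C, fun i ξ => by simpa using hC i ξ⟩
  | succ n ih =>
    obtain ⟨C, hC⟩ := ih hf.of_succ
    obtain ⟨C', hC'⟩ := ih hf.2.2
    refine ⟨C + C', fun i ξ => ?_⟩
    have hd : ∀ x, HasDerivAt (fun x => (f i x : ℂ)) ((deriv (f i) x : ℝ) : ℂ) x := fun x =>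
      (hf.1 i x).hasDerivAt.ofReal_comp
    have hde : deriv (fun x => (f i x : ℂ)) = fun x => ((deriv (f i) x : ℝ) : ℂ) :=
      funext fun x => (hd x).deriv
    have e := Real.fourier_deriv (f := fun x => (f i x : ℂ)) (hint hf i).ofReal
      (fun x => (hd x).differentiableAt) (by rw [hde]; exact (hint hf.2.2 i).ofReal)
    rw [hde] at e
    have e2 := congrArg norm (congrFun e ξ)
    rw [norm_smul] at e2
    have hn : ‖(2 * (Real.pi : ℂ) * Complex.I * (ξ : ℂ))‖ = 2 * Real.pi * |ξ| := by
      simp [abs_of_pos Real.pi_pos]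
    rw [hn] at e2
    have hpi : 1 ≤ 2 * Real.pi := by linarith [Real.pi_gt_three]
    have h3 : |ξ| * ‖𝓕 (fun x => (f i x : ℂ)) ξ‖
        ≤ ‖𝓕 (fun x => ((deriv (f i) x : ℝ) : ℂ)) ξ‖ := by
      rw [e2]
      have : 0 ≤ |ξ| * ‖𝓕 (fun x => (f i x : ℂ)) ξ‖ := by positivity
      nlinarith
    calc (1 + |ξ|) ^ (n + 1) * ‖𝓕 (fun x => (f i x : ℂ)) ξ‖
        = (1 + |ξ|) ^ n * ‖𝓕 (fun x => (f i x : ℂ)) ξ‖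
          + (1 + |ξ|) ^ n * (|ξ| * ‖𝓕 (fun x => (f i x : ℂ)) ξ‖) := by ring
      _ ≤ C + C' := add_le_add (hC i ξ)
          ((mul_le_mul_of_nonneg_left h3 (by positivity)).trans (hC' i ξ))

end DerivBound

theorem derivBound_of_hasTemperateGrowth {ι : Type*} {f : ℝ → ℝ} (hf : f.HasTemperateGrowth)
    (n : ℕ) : ∃ k : ℕ, DerivBound (fun x => (1 + |x|) ^ k) n fun _ : ι => f := by
  obtain ⟨k, C, hC, hb⟩ := hf.norm_iteratedFDeriv_le_uniform n
  refine ⟨k, DerivBound.of_iteratedDeriv hf.1 fun j hj => ⟨C, fun x => ?_⟩⟩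
  have := hb j hj x
  rwa [norm_iteratedFDeriv_eq_norm_iteratedDeriv] at this

/-! ### The stationary profile: confinement, smoothness and exponential decay. -/

theorem IsAdmissibleFlux.differentiable {F : ℝ → ℝ} (hF : IsAdmissibleFlux F) :
    Differentiable ℝ F := hF.1.differentiable (by norm_num)

theorem IsAdmissibleFlux.contDiff_deriv {F : ℝ → ℝ} (hF : IsAdmissibleFlux F) :
    ContDiff ℝ 1 (deriv F) :=
  ((contDiff_succ_iff_deriv (n := 1)).1 (by rw [one_add_one_eq_two]; exact hF.1)).2.2

theorem IsAdmissibleFlux.exists_lipschitz {F : ℝ → ℝ} (hF : IsAdmissibleFlux F) :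
    ∃ C : NNReal, (∀ v, |deriv F v| ≤ C) ∧ LipschitzWith C F := by
  obtain ⟨C, hC⟩ := hF.2
  have hC0 : 0 ≤ C := (abs_nonneg _).trans (hC 0).1
  refine ⟨⟨C, hC0⟩, fun v => (hC v).1, lipschitzWith_of_nnnorm_deriv_le hF.differentiable
    fun v => ?_⟩
  exact NNReal.coe_le_coe.1 (hC v).1

/-- The function (v e^{ax})² has derivative 2(c + a)(v e^{ax})², so it is nonincreasing once c ≤ -a.
-/
theorem tendsto_abs_le_exp {v c : ℝ → ℝ} {a : ℝ} (hv : ∀ x, HasDerivAt v (c x * v x) x)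
    (hc : ∀ᶠ x in atTop, c x ≤ -a) :
    ∃ C X : ℝ, ∀ x, X ≤ x → |v x| ≤ C * Real.exp (-(a * x)) := by
  obtain ⟨X, hX⟩ := eventually_atTop.1 hc
  set E : ℝ → ℝ := fun x => (v x * Real.exp (a * x)) ^ 2 with hE
  have hd : ∀ x, HasDerivAt E (2 * (v x * Real.exp (a * x)) ^ 2 * (c x + a)) x := fun x => by
    have h1 : HasDerivAt (fun x => Real.exp (a * x)) (Real.exp (a * x) * a) x := by
      simpa using ((hasDerivAt_id x).const_mul a).exp
    have := ((hv x).mul h1).pow 2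
    convert! this using 1
    simp only [Pi.mul_apply]
    push_cast; ring
  have hanti : AntitoneOn E (Ici X) := by
    refine antitoneOn_of_deriv_nonpos (convex_Ici X)
      (fun x _ => (hd x).continuousAt.continuousWithinAt)
      (fun x _ => (hd x).differentiableAt.differentiableWithinAt) fun x hx => ?_
    rw [interior_Ici] at hx
    rw [(hd x).deriv]
    have := hX x (le_of_lt hx)
    exact mul_nonpos_of_nonneg_of_nonpos (by positivity) (by linarith)
  refine ⟨|v X * Real.exp (a * X)|, X, fun x hx => ?_⟩
  have h := hanti (mem_Ici.2 le_rfl) (mem_Ici.2 hx) hx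
  have h' := sq_le_sq.1 h
  rw [abs_mul, Real.abs_exp] at h'
  rw [Real.exp_neg, ← div_eq_mul_inv, le_div_iff₀ (Real.exp_pos _)]
  exact h'

namespace IsViscousShock

variable {F : ℝ → ℝ} {D um up : ℝ} {U : ℝ → ℝ}

theorem flux_eq (hU : IsViscousShock F D um up U) (hγ : shockSpeed F um up = 0) : F up = F um := by
  rw [shockSpeed, div_eq_zero_iff] at hγ
  rcases hγ with h | h
  · linarith
  · exact absurd (by linarith) hU.ne

theorem hasDerivAt (hU : IsViscousShock F D um up U) (hγ : shockSpeed F um up = 0) (x : ℝ) :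
    HasDerivAt U ((F (U x) - F um) / D) x := by
  simpa [hγ] using hU.ode x

theorem continuous (hU : IsViscousShock F D um up U) : Continuous U :=
  continuous_iff_continuousAt.2 fun x => (hU.ode x).continuousAt

/-- Such an e is an equilibrium of the profile equation, whose right-hand side is Lipschitz. By
uniqueness, a profile that reaches e would be constant and could not join different end states. -/
theorem ne_endpoint (hU : IsViscousShock F D um up U) (hγ : shockSpeed F um up = 0)
    (hF : IsAdmissibleFlux F) {e : ℝ} (he : F e = F um) (x₁ : ℝ) : U x₁ ≠ e := by
  intro h1
  obtain ⟨C, -, hC⟩ := hF.exists_lipschitz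
  have hlip : LipschitzWith (‖D⁻¹‖₊ * C) (fun v => D⁻¹ * (F v - F um)) := by
    refine LipschitzWith.of_dist_le_mul fun x y => ?_
    have := hC.dist_le_mul x y
    rw [Real.dist_eq] at this ⊢
    rw [← mul_sub, abs_mul, sub_sub_sub_cancel_right]
    push_cast
    rw [mul_assoc]
    exact mul_le_mul_of_nonneg_left this (abs_nonneg _)
  have heq : U = fun _ => e := by
    refine ODE_solution_unique_univ (v := fun _ v => D⁻¹ * (F v - F um)) (s := fun _ => univ)
      (K := ‖D⁻¹‖₊ * C) (t₀ := x₁) (fun _ => hlip.lipschitzOnWith) (fun x => ⟨?_, mem_univ _⟩)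
      (fun x => ⟨?_, mem_univ _⟩) h1
    · convert! hU.hasDerivAt hγ x using 1
      rw [div_eq_inv_mul]
    · simpa [he] using hasDerivAt_const x e
  have h2 := hU.tendsto_left
  have h3 := hU.tendsto_right
  rw [heq] at h2 h3
  exact hU.ne ((tendsto_nhds_unique h2 tendsto_const_nhds).trans
    (tendsto_nhds_unique h3 tendsto_const_nhds).symm)

/-- A profile with a value outside the interval could not cross the nearby endpoint, by the
intermediate value theorem. It would stay beyond it, and both limits would then equal that endpoint.
-/
theorem mem_uIcc (hU : IsViscousShock F D um up U) (hγ : shockSpeed F um up = 0)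
    (hF : IsAdmissibleFlux F) (x : ℝ) : U x ∈ uIcc um up := by
  have hne : ∀ e, e = um ∨ e = up → ∀ x, U x ≠ e := by
    rintro e (rfl | rfl) x
    · exact hU.ne_endpoint hγ hF rfl x
    · exact hU.ne_endpoint hγ hF (hU.flux_eq hγ) x
  constructor
  · by_contra hlt
    rw [not_le] at hlt
    have hm := hne (min um up) (min_choice um up)
    have hall : ∀ y, U y ≤ min um up := fun y => by
      by_contra hy
      obtain ⟨z, hz⟩ := mem_range_of_exists_le_of_exists_ge hU.continuous ⟨x, hlt.le⟩
        ⟨y, (not_le.1 hy).le⟩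
      exact hm z hz
    have h1 := le_of_tendsto hU.tendsto_left (Eventually.of_forall hall)
    have h2 := le_of_tendsto hU.tendsto_right (Eventually.of_forall hall)
    exact hU.ne (le_antisymm (h1.trans (min_le_right _ _)) (h2.trans (min_le_left _ _)))
  · by_contra hlt
    rw [not_le] at hlt
    have hm := hne (max um up) (max_choice um up)
    have hall : ∀ y, max um up ≤ U y := fun y => by
      by_contra hy
      obtain ⟨z, hz⟩ := mem_range_of_exists_le_of_exists_ge hU.continuous
        ⟨y, (not_le.1 hy).le⟩ ⟨x, hlt.le⟩
      exact hm z hz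
    have h1 := ge_of_tendsto hU.tendsto_left (Eventually.of_forall hall)
    have h2 := ge_of_tendsto hU.tendsto_right (Eventually.of_forall hall)
    exact hU.ne (le_antisymm ((le_max_left _ _).trans h2) ((le_max_right _ _).trans h1))

theorem deriv_eq (hU : IsViscousShock F D um up U) (hγ : shockSpeed F um up = 0) :
    deriv U = fun x => (F (U x) - F um) / D := funext fun x => (hU.hasDerivAt hγ x).deriv

/-- This linear equation for U' serves twice: the limits of its coefficient at ±∞ have the signs
given by the Lax condition, which yields decay, and it expresses higher derivatives through lower
ones. -/
theorem hasDerivAt_deriv (hU : IsViscousShock F D um up U) (hγ : shockSpeed F um up = 0)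
    (hF : IsAdmissibleFlux F) (x : ℝ) :
    HasDerivAt (deriv U) (deriv F (U x) / D * deriv U x) x := by
  rw [hU.deriv_eq hγ]
  have := (((hF.differentiable (U x)).hasDerivAt.comp x (hU.hasDerivAt hγ x)).sub_const
    (F um)).div_const D
  convert! this using 1
  ring

/-- The profile converges exponentially fast. -/
theorem exists_abs_deriv_le (hU : IsViscousShock F D um up U) (hγ : shockSpeed F um up = 0)
    (hF : IsAdmissibleFlux F) (hD : 0 < D) :
    ∃ a C : ℝ, 0 < a ∧ ∀ x, |deriv U x| ≤ C * Real.exp (-(a * |x|)) := by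
  have hcF : Continuous (deriv F) := hF.contDiff_deriv.continuous
  have hr : Tendsto (fun x => deriv F (U x) / D) atTop (𝓝 (deriv F up / D)) :=
    ((hcF.tendsto up).comp hU.tendsto_right).div_const D
  have hl : Tendsto (fun x => -(deriv F (U (-x)) / D)) atTop (𝓝 (-(deriv F um / D))) :=
    ((((hcF.tendsto um).comp hU.tendsto_left).comp tendsto_neg_atTop_atBot).div_const D).neg
  have hrn : deriv F up / D < 0 := div_neg_of_neg_of_pos (by linarith [hU.lax_right]) hD
  have hln : -(deriv F um / D) < 0 := neg_neg_of_pos (div_pos (by linarith [hU.lax_left]) hD)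
  -- Half of the smaller linear rate, which leaves room for the coefficient to differ from its
  -- limit.
  set a := min (-(deriv F up / D) / 2) (deriv F um / D / 2) with ha
  have ha0 : 0 < a := lt_min (by linarith) (by linarith)
  have har : a ≤ -(deriv F up / D) / 2 := min_le_left _ _
  have hal : a ≤ deriv F um / D / 2 := min_le_right _ _
  obtain ⟨C₁, X₁, h₁⟩ := tendsto_abs_le_exp (a := a) (hU.hasDerivAt_deriv hγ hF)
    ((hr.eventually_lt_const (u := -a) (by linarith)).mono fun x hx => hx.le)
  -- The left end is treated as the right end of the reflected profile.
  obtain ⟨C₂, X₂, h₂⟩ := tendsto_abs_le_exp (a := a) (v := fun x => deriv U (-x))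
    (c := fun x => -(deriv F (U (-x)) / D)) (fun x => by
      have := (hU.hasDerivAt_deriv hγ hF (-x)).scomp x (hasDerivAt_neg x)
      convert! this using 1
      simp)
    ((hl.eventually_lt_const (u := -a) (by linarith)).mono fun x hx => hx.le)
  have hc : Continuous (deriv U) :=
    continuous_iff_continuousAt.2 fun x => (hU.hasDerivAt_deriv hγ hF x).continuousAt
  set X := max (max X₁ X₂) 0 with hX
  obtain ⟨C₃, h₃⟩ := (isCompact_Icc (a := -X) (b := X)).exists_bound_of_continuousOn
    hc.continuousOn
  have hX0 : 0 ≤ X := le_max_right _ _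
  have hC₃ : 0 ≤ C₃ := (norm_nonneg _).trans (h₃ 0 ⟨by linarith, hX0⟩)
  refine ⟨a, max (max |C₁| |C₂|) (C₃ * Real.exp (a * X)), ha0, fun x => ?_⟩
  have he := (Real.exp_pos (-(a * |x|))).le
  rcases le_total X x with hx | hx
  · rw [abs_of_nonneg (hX0.trans hx)] at he ⊢
    refine (h₁ x (((le_max_left _ _).trans (le_max_left _ _)).trans hx)).trans
      (mul_le_mul_of_nonneg_right ?_ he)
    exact (le_abs_self _).trans ((le_max_left _ _).trans (le_max_left _ _))
  rcases le_total x (-X) with hx' | hx'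
  · rw [abs_of_nonpos (by linarith : x ≤ 0)] at he ⊢
    have := h₂ (-x) (((le_max_right _ _).trans (le_max_left _ _)).trans (le_neg_of_le_neg hx'))
    rw [neg_neg] at this
    refine this.trans (mul_le_mul_of_nonneg_right ?_ he)
    exact (le_abs_self _).trans ((le_max_right _ _).trans (le_max_left _ _))
  · calc |deriv U x| ≤ C₃ := h₃ x ⟨hx', hx⟩
      _ ≤ C₃ * (Real.exp (a * X) * Real.exp (-(a * |x|))) := by
          rw [← Real.exp_add]
          refine le_mul_of_one_le_right hC₃ (Real.one_le_exp ?_)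
          have : |x| ≤ X := abs_le.2 ⟨hx', hx⟩
          nlinarith
      _ = C₃ * Real.exp (a * X) * Real.exp (-(a * |x|)) := by ring
      _ ≤ _ := mul_le_mul_of_nonneg_right (le_max_right _ _) he

theorem uniqueDiffOn (hU : IsViscousShock F D um up U) : UniqueDiffOn ℝ (uIcc um up) :=
  uniqueDiffOn_Icc (by simpa using hU.ne.symm)

theorem contDiffOn_deriv (hU : IsViscousShock F D um up U) (hF : IsAdmissibleFlux F)
    (hFs : ContDiffOn ℝ ∞ F (uIcc um up)) : ContDiffOn ℝ ∞ (deriv F) (uIcc um up) :=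
  (hFs.derivWithin hU.uniqueDiffOn (by simp)).congr fun v hv =>
    ((hF.differentiable v).derivWithin (hU.uniqueDiffOn v hv)).symm

/-- All derivatives of the profile decay exponentially fast. -/
theorem exists_derivBound (hU : IsViscousShock F D um up U) (hγ : shockSpeed F um up = 0)
    (hF : IsAdmissibleFlux F) (hFs : ContDiffOn ℝ ∞ F (uIcc um up)) (hD : 0 < D) :
    ∃ a : ℝ, 0 < a ∧ ∀ n : ℕ, DerivBound (fun _ => 1) n (fun _ : Unit => U) ∧
      DerivBound (fun x => Real.exp (-(a * |x|))) n (fun _ : Unit => deriv U) := by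
  obtain ⟨a, C, ha, hC⟩ := hU.exists_abs_deriv_le hγ hF hD
  have hbU : ∃ C, ∀ (_ : Unit) x, |U x| ≤ C * 1 := by
    obtain ⟨C, hC⟩ := (isCompact_uIcc (a := um) (b := up)).exists_bound_of_continuousOn
      continuous_id.continuousOn
    exact ⟨C, fun _ x => by simpa using hC _ (hU.mem_uIcc hγ hF x)⟩
  have hc : Continuous (deriv U) :=
    continuous_iff_continuousAt.2 fun x => (hU.hasDerivAt_deriv hγ hF x).continuousAt
  refine ⟨a, ha, fun n => ?_⟩
  induction n with
  | zero => exact ⟨⟨fun _ => hU.continuous, hbU⟩, ⟨fun _ => hc, C, fun _ => hC⟩⟩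
  | succ n ih =>
    refine ⟨⟨fun _ x => (hU.hasDerivAt hγ x).differentiableAt, hbU,
      ih.2.mono (C₀ := 1) (fun x => (Real.exp_pos _).le) fun x => ?_⟩,
      ⟨fun _ x => (hU.hasDerivAt_deriv hγ hF x).differentiableAt, ⟨C, fun _ => hC⟩, ?_⟩⟩
    · simp only [mul_one, Real.exp_le_one_iff, Left.neg_nonpos_iff]
      positivity
    -- Bootstrap through U'' = (F'(U)/D) U': one more derivative of U' is a bounded smooth factor
    -- times U', and the decay comes from U' alone.
    · have h1 := ih.1.comp_left isCompact_uIcc hU.uniqueDiffOn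
        ((hU.contDiffOn_deriv hF hFs).div_const D) (fun _ => hU.mem_uIcc hγ hF)
      have h2 := h1.mul (fun _ => zero_le_one) (fun x => (Real.exp_pos _).le) ih.2
      have h3 : deriv (deriv U) = fun x => deriv F (U x) / D * deriv U x :=
        funext fun x => (hU.hasDerivAt_deriv hγ hF x).deriv
      simp only [one_mul] at h2
      simpa only [h3] using h2

end IsViscousShock

/-! ### Mollification in L². -/

theorem eLpNorm_two_sq {α E : Type*} [MeasurableSpace α] [NormedAddCommGroup E] (f : α → E)
    (μ : Measure α) : eLpNorm f 2 μ ^ 2 = ∫⁻ x, ‖f x‖ₑ ^ 2 ∂μ := by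
  rw [eLpNorm_eq_lintegral_rpow_enorm_toReal (by norm_num) (by norm_num), ← ENNReal.rpow_natCast,
    ← ENNReal.rpow_mul]
  simp

theorem lintegral_mul_sq_le {α : Type*} [MeasurableSpace α] {μ : Measure α} {f g : α → ℝ≥0∞}
    (hf : AEMeasurable f μ) (hg : AEMeasurable g μ) :
    (∫⁻ x, f x * g x ∂μ) ^ 2 ≤ (∫⁻ x, f x ^ 2 ∂μ) * ∫⁻ x, g x ^ 2 ∂μ := by
  have h := ENNReal.lintegral_mul_le_Lp_mul_Lq μ Real.HolderConjugate.two_two hf hg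
  have h2 := pow_le_pow_left₀ zero_le h 2
  refine h2.trans (le_of_eq ?_)
  rw [mul_pow, ← ENNReal.rpow_natCast, ← ENNReal.rpow_natCast, ← ENNReal.rpow_mul,
    ← ENNReal.rpow_mul]
  simp

/-- Translations act continuously on `L²`. -/
theorem tendsto_eLpNorm_translate {q : ℝ → ℝ} (hq : MemLp q 2) :
    Tendsto (fun h : ℝ => eLpNorm (fun x => q (x + h) - q x) 2 volume) (𝓝 0) (𝓝 0) := by
  let g : ℝ → C(ℝ, ℝ) := fun h => ⟨fun x => x + h, by fun_prop⟩
  have hgm : ∀ h, MeasurePreserving (g h) volume volume := fun h =>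
    measurePreserving_add_right volume h
  have hgc : Continuous g := by
    have : g = (ContinuousMap.curry ⟨fun p : ℝ × ℝ => p.2 + p.1, by fun_prop⟩) := by
      ext h x; rfl
    rw [this]
    exact ContinuousMap.continuous _
  have ht : Tendsto (fun h => Lp.compMeasurePreserving (g h) (hgm h) hq.toLp) (𝓝 0)
      (𝓝 (Lp.compMeasurePreserving (g 0) (hgm 0) hq.toLp)) :=
    tendsto_const_nhds.compMeasurePreservingLp (hgc.tendsto 0) hgm (hgm 0) (by norm_num)
  rw [tendsto_iff_edist_tendsto_0] at ht
  refine ht.congr fun h => ?_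
  rw [Lp.edist_def]
  refine eLpNorm_congr_ae ?_
  filter_upwards [Lp.coeFn_compMeasurePreserving hq.toLp (hgm h),
    Lp.coeFn_compMeasurePreserving hq.toLp (hgm 0),
    (hgm h).quasiMeasurePreserving.ae (hq.coeFn_toLp), hq.coeFn_toLp] with x h1 h2 h3 h4
  simp only [Pi.sub_apply, h1, h2, Function.comp_apply]
  have : (g 0) x = x := add_zero x
  rw [this, h3, h4]
  rfl

/-- The mollification of `q` with the kernel `l⁻¹ φ(·/l)`. -/
def mollify (φ : ℝ → ℝ) (l : ℝ) (q : ℝ → ℝ) (x : ℝ) : ℝ := ∫ z, φ z * q (x + l * z)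

/-- Cauchy–Schwarz for the measure |φ| dz bounds the squared error by a multiple of the |φ|-average
of the squared translation errors ‖q(· + lz) - q‖². These tend to zero with l and are at most
(2‖q‖)², so dominated convergence applies. The absolute value is needed because φ may change sign.
-/
theorem tendsto_eLpNorm_mollify_sub {φ q : ℝ → ℝ} (hφ : Integrable φ) (hφ1 : ∫ z, φ z = 1)
    (hq : Continuous q) {M : ℝ} (hqM : ∀ x, |q x| ≤ M) (hq2 : MemLp q 2) :
    Tendsto (fun l : ℝ => eLpNorm (fun x => mollify φ l q x - q x) 2 volume)
      (𝓝 0) (𝓝 0) := by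
  set m : ℝ → ℝ≥0∞ := fun h => eLpNorm (fun x => q (x + h) - q x) 2 volume ^ 2 with hm
  have hme : ∀ h, m h = ∫⁻ x, ‖q (x + h) - q x‖ₑ ^ 2 := fun h => eLpNorm_two_sq _ _
  have hmm : Measurable m := by
    simp_rw [funext hme]
    refine Measurable.lintegral_prod_right' (f := fun p : ℝ × ℝ => ‖q (p.2 + p.1) - q p.2‖ₑ ^ 2) ?_
    have : Continuous fun p : ℝ × ℝ => q (p.2 + p.1) - q p.2 := by fun_prop
    exact this.measurable.enorm.pow_const 2
  have hm0 : Tendsto m (𝓝 0) (𝓝 0) := by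
    simpa [Function.comp_def, hm] using
      ((ENNReal.continuous_pow 2).tendsto _).comp (tendsto_eLpNorm_translate hq2)
  have hmB : ∀ h, m h ≤ (2 * eLpNorm q 2 volume) ^ 2 := fun h => by
    refine pow_le_pow_left₀ zero_le ?_ 2
    have hmp := measurePreserving_add_right (volume : Measure ℝ) h
    refine (eLpNorm_sub_le (f := fun x => q (x + h)) (by fun_prop) (by fun_prop)
      one_le_two).trans ?_
    rw [two_mul]
    refine add_le_add (le_of_eq ?_) le_rfl
    exact eLpNorm_comp_measurePreserving (g := q) hq.aestronglyMeasurable hmp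
  have hfin : (2 * eLpNorm q 2 volume) ^ 2 ≠ ⊤ :=
    ENNReal.pow_ne_top (ENNReal.mul_ne_top (by simp) hq2.2.ne)
  have hφe : ∫⁻ z, ‖φ z‖ₑ ≠ ⊤ := hφ.2.ne
  have hdct : Tendsto (fun l : ℝ => ∫⁻ z, ‖φ z‖ₑ * m (l * z)) (𝓝 0) (𝓝 (∫⁻ _ : ℝ, 0)) := by
    refine tendsto_lintegral_filter_of_dominated_convergence' (fun z =>
      ‖φ z‖ₑ * (2 * eLpNorm q 2 volume) ^ 2) (Eventually.of_forall fun l => ?_)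
      (Eventually.of_forall fun l => ae_of_all _ fun z => by gcongr; exact hmB _) ?_
      (ae_of_all _ fun z => ?_)
    · exact hφ.1.enorm.mul (hmm.comp (by fun_prop)).aemeasurable
    · rw [lintegral_mul_const' _ _ hfin]
      exact ENNReal.mul_ne_top hφe hfin
    · have h1 : Tendsto (fun l : ℝ => l * z) (𝓝 0) (𝓝 0) := by
        simpa using (continuous_mul_const z).tendsto 0
      simpa using ENNReal.Tendsto.const_mul (a := ‖φ z‖ₑ) (hm0.comp h1)
        (Or.inr (enorm_ne_top))
  have hbound : ∀ l : ℝ, eLpNorm (fun x => mollify φ l q x - q x) 2 volume ^ 2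
      ≤ (∫⁻ z, ‖φ z‖ₑ) * ∫⁻ z, ‖φ z‖ₑ * m (l * z) := by
    intro l
    rw [eLpNorm_two_sq]
    have hpt : ∀ x, ‖mollify φ l q x - q x‖ₑ ^ 2
        ≤ (∫⁻ z, ‖φ z‖ₑ) * ∫⁻ z, ‖φ z‖ₑ * ‖q (x + l * z) - q x‖ₑ ^ 2 := by
      intro x
      have hi : Integrable (fun z => φ z * q (x + l * z)) := by
        have := hφ.bdd_mul (f := fun z => q (x + l * z))
          (hq.comp (by fun_prop : Continuous fun z => x + l * z)).aestronglyMeasurable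
          (ae_of_all _ fun z => hqM _)
        simpa [mul_comm] using this
      have he : mollify φ l q x - q x = ∫ z, φ z * (q (x + l * z) - q x) := by
        simp only [mollify, mul_sub]
        rw [integral_sub hi (hφ.mul_const _), integral_mul_const, hφ1, one_mul]
      have hc : Continuous fun z => q (x + l * z) - q x := by fun_prop
      have hcs := lintegral_mul_sq_le (μ := volume.withDensity fun z => ‖φ z‖ₑ)
        (f := fun _ => 1) (g := fun z => ‖q (x + l * z) - q x‖ₑ) aemeasurable_const
        hc.measurable.enorm.aemeasurable
      have hw : ∀ g : ℝ → ℝ≥0∞, Measurable g →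
          ∫⁻ z, g z ∂(volume.withDensity fun z => ‖φ z‖ₑ) = ∫⁻ z, ‖φ z‖ₑ * g z := fun g hg =>
        lintegral_withDensity_eq_lintegral_mul₀ hφ.1.enorm hg.aemeasurable
      simp only [one_mul, one_pow] at hcs
      rw [hw _ hc.measurable.enorm, hw _ measurable_const,
        hw _ (hc.measurable.enorm.pow_const 2)] at hcs
      simp only [mul_one] at hcs
      refine le_trans (pow_le_pow_left₀ zero_le ?_ 2) hcs
      rw [he]
      refine (enorm_integral_le_lintegral_enorm _).trans (le_of_eq ?_)
      simp [enorm_mul]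
    refine (lintegral_mono hpt).trans ?_
    rw [lintegral_const_mul' _ _ hφe, lintegral_lintegral_swap]
    · refine mul_le_mul_right (le_of_eq (lintegral_congr fun z => ?_)) _
      rw [hme, lintegral_const_mul' _ _ enorm_ne_top]
    · have h1 : Continuous fun p : ℝ × ℝ => q (p.1 + l * p.2) - q p.1 := by fun_prop
      exact (hφ.1.comp_snd.enorm).mul (h1.measurable.enorm.pow_const 2).aemeasurable
  have h2 : Tendsto (fun l : ℝ => eLpNorm (fun x => mollify φ l q x - q x) 2 volume ^ 2)
      (𝓝 0) (𝓝 0) := by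
    refine tendsto_of_tendsto_of_tendsto_of_le_of_le tendsto_const_nhds ?_ (fun _ => zero_le)
      hbound
    have := ENNReal.Tendsto.const_mul (a := ∫⁻ z, ‖φ z‖ₑ) hdct (Or.inr hφe)
    simpa using this
  have h3 := (ENNReal.continuous_rpow_const (y := (2 : ℝ)⁻¹)).tendsto 0 |>.comp h2
  rw [ENNReal.zero_rpow_of_pos (by norm_num)] at h3
  refine h3.congr fun l => ?_
  simp only [Function.comp_apply]
  rw [← ENNReal.rpow_natCast, ← ENNReal.rpow_mul]
  simp

theorem continuous_mollify {φ q : ℝ → ℝ} (hφ : Integrable φ) (hq : Continuous q) (l : ℝ)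
    {M : ℝ} (hqM : ∀ x, |q x| ≤ M) : Continuous (mollify φ l q) := by
  refine continuous_of_dominated (bound := fun z => |φ z| * M) (fun x => ?_)
    (fun x => ae_of_all _ fun z => ?_) (hφ.abs.mul_const M) (ae_of_all _ fun z => by fun_prop)
  · exact hφ.1.mul (hq.comp (by fun_prop)).aestronglyMeasurable
  · rw [norm_mul]
    exact mul_le_mul_of_nonneg_left (hqM _) (abs_nonneg _)

/-- How small l has to be depends on φ, but the factor 2 does not. This makes the constant of the
lower bound independent of the correlation profile. -/
theorem eventually_eLpNorm_mollify_le {φ q : ℝ → ℝ} (hφ : Integrable φ) (hφ1 : ∫ z, φ z = 1)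
    (hq : Continuous q) {M : ℝ} (hqM : ∀ x, |q x| ≤ M) (hq2 : MemLp q 2)
    (hq0 : eLpNorm q 2 volume ≠ 0) :
    ∀ᶠ l in 𝓝 (0 : ℝ), eLpNorm (mollify φ l q) 2 volume ≤ 2 * eLpNorm q 2 volume := by
  have h := (tendsto_eLpNorm_mollify_sub hφ hφ1 hq hqM hq2).eventually_lt_const
    (pos_iff_ne_zero.2 hq0)
  filter_upwards [h] with l hl
  have hc := continuous_mollify hφ hq l hqM
  have : mollify φ l q = (fun x => mollify φ l q x - q x) + q := by ext x; simp
  rw [this, two_mul]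
  exact (eLpNorm_add_le (hc.sub hq).aestronglyMeasurable hq.aestronglyMeasurable
    one_le_two).trans (add_le_add hl.le le_rfl)

theorem ennreal_mul_le_sq_add_sq (a b : ℝ≥0∞) : a * b ≤ a ^ 2 + b ^ 2 := by
  rcases le_total a b with h | h
  · calc a * b ≤ b * b := by gcongr
      _ = b ^ 2 := (sq b).symm
      _ ≤ _ := le_add_self
  · calc a * b ≤ a * a := by gcongr
      _ = a ^ 2 := (sq a).symm
      _ ≤ _ := le_self_add

/-! ### The mass injected by a control. -/

/-- The spatially correlated forcing that is generated by the control `h`. -/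
def forcing (φ : ℝ → ℝ) (l : ℝ) (q : ℝ → ℝ) (h : ℝ → ℝ → ℝ) (s y : ℝ) : ℝ :=
  ∫ x', q y * (1 / l * φ ((y - x') / l)) * h s x'

/-- Only finiteness is at stake, to justify Fubini. So the crude bound ab ≤ a² + b² suffices, after
which the kernel integrates to its L¹ norm in either variable. -/
theorem lintegral_forcing_le {φ q η : ℝ → ℝ} {l : ℝ} (hφm : Measurable φ) (hqm : Measurable q)
    (hη : Measurable η) :
    ∫⁻ y, ∫⁻ x', ‖q y * (1 / l * φ ((y - x') / l)) * η x'‖ₑ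
      ≤ (∫⁻ u, ‖1 / l * φ (u / l)‖ₑ) * ((∫⁻ y, ‖q y‖ₑ ^ 2) + ∫⁻ x, ‖η x‖ₑ ^ 2) := by
  set k : ℝ → ℝ≥0∞ := fun u => ‖1 / l * φ (u / l)‖ₑ with hk
  have hkm : Measurable k := by
    have : Measurable fun u => 1 / l * φ (u / l) := by fun_prop
    exact this.enorm
  have hk2 : Measurable fun p : ℝ × ℝ => k (p.1 - p.2) := hkm.comp (by fun_prop)
  have hk1 : ∀ y, Measurable fun x' => k (y - x') := fun y => hkm.comp (by fun_prop)
  calc ∫⁻ y, ∫⁻ x', ‖q y * (1 / l * φ ((y - x') / l)) * η x'‖ₑ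
      ≤ ∫⁻ y, ∫⁻ x', (‖q y‖ₑ ^ 2 * k (y - x') + ‖η x'‖ₑ ^ 2 * k (y - x')) := by
        refine lintegral_mono fun y => lintegral_mono fun x' => ?_
        simp only [enorm_mul, hk]
        rw [← add_mul, mul_right_comm]
        gcongr
        exact ennreal_mul_le_sq_add_sq _ _
    _ = (∫⁻ y, ‖q y‖ₑ ^ 2 * ∫⁻ x', k (y - x')) + ∫⁻ x', ‖η x'‖ₑ ^ 2 * ∫⁻ y, k (y - x') := by
        have e1 : ∀ y, ∫⁻ x', (‖q y‖ₑ ^ 2 * k (y - x') + ‖η x'‖ₑ ^ 2 * k (y - x'))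
            = ‖q y‖ₑ ^ 2 * (∫⁻ x', k (y - x')) + ∫⁻ x', ‖η x'‖ₑ ^ 2 * k (y - x') := fun y => by
          rw [lintegral_add_left ((hk1 y).const_mul _), lintegral_const_mul _ (hk1 y)]
        simp_rw [e1]
        have hm1 : Measurable fun y => ‖q y‖ₑ ^ 2 * ∫⁻ x', k (y - x') :=
          (hqm.enorm.pow_const 2).mul hk2.lintegral_prod_right'
        rw [lintegral_add_left hm1, lintegral_lintegral_swap]
        · congr 1
          refine lintegral_congr fun x' => ?_
          exact lintegral_const_mul' _ _ (ENNReal.pow_ne_top enorm_ne_top)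
        · exact (((hη.comp measurable_snd).enorm.pow_const 2).mul hk2).aemeasurable
    _ = (∫⁻ u, k u) * ((∫⁻ y, ‖q y‖ₑ ^ 2) + ∫⁻ x, ‖η x‖ₑ ^ 2) := by
        simp_rw [lintegral_sub_left_eq_self k, lintegral_sub_right_eq_self k]
        rw [lintegral_mul_const _ (hqm.enorm.pow_const 2), lintegral_mul_const _
          (hη.enorm.pow_const 2)]
        ring

theorem measurable_forcing {φ q : ℝ → ℝ} {l : ℝ} {h : ℝ → ℝ → ℝ} (hφm : Measurable φ)
    (hqm : Measurable q) (hh : Measurable (Function.uncurry h)) :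
    StronglyMeasurable (Function.uncurry (forcing φ l q h)) := by
  refine StronglyMeasurable.integral_prod_right (f := fun (p : ℝ × ℝ) (x' : ℝ) =>
    q p.2 * (1 / l * φ ((p.2 - x') / l)) * h p.1 x') (Measurable.stronglyMeasurable ?_)
  have h1 : Measurable fun p : (ℝ × ℝ) × ℝ => h p.1.1 p.2 :=
    hh.comp (by fun_prop : Measurable fun p : (ℝ × ℝ) × ℝ => (p.1.1, p.2))
  simp only [Function.uncurry_def]
  fun_prop

theorem integrable_forcing {φ q : ℝ → ℝ} {l T : ℝ} {h : ℝ → ℝ → ℝ} (hl : l ≠ 0)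
    (hφm : Measurable φ) (hφ : Integrable φ) (hqm : Measurable q) (hq2 : MemLp q 2)
    (hh : Measurable (Function.uncurry h))
    (hh2 : ∫⁻ s in Icc 0 T, ∫⁻ x, ‖h s x‖ₑ ^ 2 < ⊤) :
    Integrable (Function.uncurry (forcing φ l q h)) ((volume.restrict (Icc 0 T)).prod volume) := by
  have hm := measurable_forcing (l := l) hφm hqm hh
  refine ⟨hm.aestronglyMeasurable, ?_⟩
  have hN : ∫⁻ u, ‖1 / l * φ (u / l)‖ₑ < ⊤ := ((hφ.comp_div hl).const_mul (1 / l)).2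
  have hq : ∫⁻ y, ‖q y‖ₑ ^ 2 < ⊤ := lintegral_enorm_sq_lt_top_of_memLp hq2
  rw [HasFiniteIntegral, lintegral_prod _ hm.measurable.enorm.aemeasurable]
  have hle : ∀ s, ∫⁻ y, ‖Function.uncurry (forcing φ l q h) (s, y)‖ₑ
      ≤ (∫⁻ u, ‖1 / l * φ (u / l)‖ₑ) * ((∫⁻ y, ‖q y‖ₑ ^ 2) + ∫⁻ x, ‖h s x‖ₑ ^ 2) := fun s =>
    (lintegral_mono fun y => enorm_integral_le_lintegral_enorm _).trans
      (lintegral_forcing_le hφm hqm (hh.comp (by fun_prop : Measurable fun x => (s, x))))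
  refine (lintegral_mono hle).trans_lt ?_
  rw [lintegral_const_mul' _ _ hN.ne]
  refine ENNReal.mul_lt_top hN ?_
  rw [lintegral_add_left measurable_const]
  refine ENNReal.add_lt_top.2 ⟨?_, hh2⟩
  simp only [lintegral_const]
  exact ENNReal.mul_lt_top hq (measure_lt_top _ _)

/-- Fubini and the substitution y = x' + lz: the adjoint of the noise operator, applied to the
constant 1, is the mollified envelope. -/
theorem integral_forcing_eq {φ q η : ℝ → ℝ} {l : ℝ} (hl : 0 < l)
    (hφm : Measurable φ) (hφ : Integrable φ) (hqm : Measurable q) (hq2 : MemLp q 2)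
    (hη : Measurable η) (hη2 : ∫⁻ x, ‖η x‖ₑ ^ 2 < ⊤) :
    ∫ y, ∫ x', q y * (1 / l * φ ((y - x') / l)) * η x' = ∫ x', η x' * mollify φ l q x' := by
  rw [integral_integral_swap]
  · congr 1; ext x'
    have h1 : ∫ y, q y * (1 / l * φ ((y - x') / l)) * η x'
        = η x' * ∫ y, 1 / l * φ ((y - x') / l) * q y := by
      rw [← integral_const_mul]; congr 1; ext y; ring
    rw [h1]
    congr 1
    have h2 := integral_add_left_eq_self (μ := volume)
      (fun y => 1 / l * φ ((y - x') / l) * q y) x'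
    simp only [add_sub_cancel_left] at h2
    rw [← h2]
    have h3 := Measure.integral_comp_mul_left (fun y => 1 / l * φ (y / l) * q (x' + y)) l
    rw [abs_of_pos (inv_pos.2 hl), smul_eq_mul] at h3
    have h4 : ∫ y, 1 / l * φ (y / l) * q (x' + y)
        = l * ∫ z, 1 / l * φ (l * z / l) * q (x' + l * z) := by
      rw [h3]; field_simp
    rw [h4, mollify, ← integral_const_mul]
    congr 1; ext z
    rw [mul_div_cancel_left₀ _ hl.ne']
    field_simp
  · have hm : Measurable (Function.uncurry fun y x' => q y * (1 / l * φ ((y - x') / l)) * η x') := by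
      simp only [Function.uncurry_def]
      fun_prop
    refine ⟨hm.aestronglyMeasurable, ?_⟩
    rw [HasFiniteIntegral, lintegral_prod _ hm.enorm.aemeasurable]
    refine (lintegral_forcing_le hφm hqm hη).trans_lt (ENNReal.mul_lt_top ?_ ?_)
    · exact ((hφ.comp_div hl.ne').const_mul (1 / l)).2
    · exact ENNReal.add_lt_top.2 ⟨lintegral_enorm_sq_lt_top_of_memLp hq2, hη2⟩

/-- The total mass that is injected by the forcing is controlled by the cost of the control. -/
theorem enorm_integral_forcing_sq_le {φ q : ℝ → ℝ} {l T : ℝ} {h : ℝ → ℝ → ℝ} (hl : 0 < l)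
    (hφm : Measurable φ) (hφ : Integrable φ) (hq : Continuous q) (hq2 : MemLp q 2) {M : ℝ}
    (hqM : ∀ x, |q x| ≤ M) (hh : Measurable (Function.uncurry h))
    (hh2 : ∫⁻ s in Icc 0 T, ∫⁻ x, ‖h s x‖ₑ ^ 2 < ⊤) :
    ‖∫ p, Function.uncurry (forcing φ l q h) p ∂((volume.restrict (Icc 0 T)).prod volume)‖ₑ ^ 2
      ≤ (∫⁻ s in Icc 0 T, ∫⁻ x, ‖h s x‖ₑ ^ 2)
        * (ENNReal.ofReal T * eLpNorm (mollify φ l q) 2 volume ^ 2) := by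
  set Q := mollify φ l q with hQ
  have hQc : Continuous Q := continuous_mollify hφ hq l hqM
  have hhs : ∀ s, Measurable (h s) := fun s => hh.comp (by fun_prop : Measurable fun x => (s, x))
  rw [integral_prod _ (integrable_forcing hl.ne' hφm hφ hq.measurable hq2 hh hh2)]
  have hm2 : Measurable fun s => ∫⁻ x, ‖h s x‖ₑ ^ 2 :=
    Measurable.lintegral_prod_right' (f := fun p : ℝ × ℝ => ‖h p.1 p.2‖ₑ ^ 2)
      (hh.enorm.pow_const 2)
  have hae : ∀ᵐ s ∂(volume.restrict (Icc 0 T)), ∫⁻ x, ‖h s x‖ₑ ^ 2 < ⊤ :=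
    ae_lt_top hm2 hh2.ne
  have he : ∫ s in Icc 0 T, ∫ y, Function.uncurry (forcing φ l q h) (s, y)
      = ∫ s in Icc 0 T, ∫ x', h s x' * Q x' :=
    integral_congr_ae (hae.mono fun s hs =>
      integral_forcing_eq hl hφm hφ hq.measurable hq2 (hhs s) hs)
  rw [he]
  have hle : ‖∫ s in Icc 0 T, ∫ x', h s x' * Q x'‖ₑ
      ≤ ∫⁻ p : ℝ × ℝ, ‖h p.1 p.2‖ₑ * ‖Q p.2‖ₑ ∂((volume.restrict (Icc 0 T)).prod volume) := by
    have hm3 : Measurable fun p : ℝ × ℝ => ‖h p.1 p.2‖ₑ * ‖Q p.2‖ₑ :=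
      Measurable.mul hh.enorm (hQc.measurable.comp measurable_snd).enorm
    rw [lintegral_prod _ hm3.aemeasurable]
    refine (enorm_integral_le_lintegral_enorm _).trans (lintegral_mono fun s => ?_)
    refine (enorm_integral_le_lintegral_enorm _).trans (le_of_eq ?_)
    simp [enorm_mul]
  -- Cauchy–Schwarz in space-time; the mollified envelope does not depend on time, which produces
  -- the factor T.
  refine (pow_le_pow_left₀ zero_le hle 2).trans ((lintegral_mul_sq_le hh.enorm.aemeasurable
    (hQc.measurable.comp measurable_snd).enorm.aemeasurable).trans (le_of_eq ?_))
  rw [lintegral_prod _ (hh.enorm.pow_const 2).aemeasurable,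
    lintegral_prod _ ((hQc.measurable.comp measurable_snd).enorm.pow_const 2).aemeasurable,
    eLpNorm_two_sq]
  simp only [Function.uncurry_apply_pair, lintegral_const, Measure.restrict_apply,
    MeasurableSet.univ, univ_inter, Real.volume_Icc, sub_zero, Function.comp_apply]
  rw [mul_comm (ENNReal.ofReal T)]

/-! ### Paths in C([0,T], H¹) and the balance of mass. -/

theorem integrable_exp_neg_mul_abs {a : ℝ} (ha : 0 < a) :
    Integrable fun x : ℝ => Real.exp (-(a * |x|)) := by
  have h1 : IntegrableOn (fun x : ℝ => Real.exp (-(a * |x|))) (Ioi 0) :=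
    (exp_neg_integrableOn_Ioi 0 ha).congr_fun (fun x hx => by
      simp only [abs_of_pos (mem_Ioi.1 hx), neg_mul]) measurableSet_Ioi
  rw [← integrableOn_univ, ← Iic_union_Ioi (a := (0 : ℝ))]
  refine IntegrableOn.union ?_ h1
  have h2 := (h1.comp_neg : IntegrableOn (fun x : ℝ => Real.exp (-(a * |(-x)|))) (-(Ioi 0)))
  simp only [abs_neg] at h2
  rw [integrableOn_Iic_iff_integrableOn_Iio]
  simpa using h2

/-- The embedding of `H¹` into the bounded continuous functions. -/
theorem IsWeakDeriv.enorm_le {k g : ℝ → ℝ} (h : IsWeakDeriv k g) (hk : Continuous k)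
    (hk2 : MemLp k 2) (hg : MemLp g 2) (x : ℝ) :
    ‖k x‖ₑ ≤ 2 * (eLpNorm k 2 volume + eLpNorm g 2 volume) := by
  have h1 := h.sq_le_integral hk hk2 hg x
  have h2 : ENNReal.ofReal (k x ^ 2) ≤ ENNReal.ofReal (2 * ∫ y, (k y ^ 2 + g y ^ 2)) :=
    ENNReal.ofReal_le_ofReal h1
  have hconv : ∀ f : ℝ → ℝ, MemLp f 2 → ENNReal.ofReal (∫ y, f y ^ 2) = eLpNorm f 2 volume ^ 2 := by
    intro f hf
    rw [ofReal_integral_eq_lintegral_ofReal hf.integrable_sq (ae_of_all _ fun y => sq_nonneg _),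
      eLpNorm_two_sq]
    exact lintegral_congr fun y => (enorm_sq_eq_ofReal _).symm
  rw [integral_add hk2.integrable_sq hg.integrable_sq, ENNReal.ofReal_mul (by norm_num),
    ENNReal.ofReal_add (integral_nonneg fun y => sq_nonneg _)
      (integral_nonneg fun y => sq_nonneg _), hconv k hk2, hconv g hg, ← enorm_sq_eq_ofReal,
      ENNReal.ofReal_ofNat] at h2
  set a := eLpNorm k 2 volume
  set b := eLpNorm g 2 volume
  have h3 : ‖k x‖ₑ ^ 2 ≤ (2 * (a + b)) ^ 2 := by
    refine h2.trans ?_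
    calc 2 * (a ^ 2 + b ^ 2) ≤ 4 * (a ^ 2 + b ^ 2) := by gcongr; norm_num
      _ ≤ 4 * (a ^ 2 + b ^ 2 + 2 * a * b) := mul_le_mul_right le_self_add _
      _ = (2 * (a + b)) ^ 2 := by ring
  exact (ENNReal.pow_le_pow_left_iff two_ne_zero).1 h3

/-- A path in `C([0,T], H¹)` has a jointly continuous representative. -/
theorem ContinuousIntoH1.exists_continuous {T : ℝ} (hT : 0 ≤ T) {z d : ℝ → ℝ → ℝ}
    (hz : ∀ t ∈ Icc 0 T, MemLp (z t) 2 ∧ MemLp (d t) 2 ∧ IsWeakDeriv (z t) (d t))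
    (hc : ∀ t₀ ∈ Icc 0 T,
      Tendsto (fun t => eLpNorm (z t - z t₀) 2 volume + eLpNorm (d t - d t₀) 2 volume)
        (𝓝[Icc 0 T] t₀) (𝓝 0)) :
    ∃ (k : ℝ → ℝ → ℝ) (B : ℝ≥0∞), Continuous (Function.uncurry k) ∧ B < ⊤ ∧
      (∀ t x, ‖k t x‖ₑ ≤ 2 * B) ∧
      ∀ t ∈ Icc 0 T, z t =ᵐ[volume] k t ∧ Continuous (k t) ∧ IsWeakDeriv (k t) (d t) ∧
        MemLp (k t) 2 ∧ eLpNorm (k t) 2 volume + eLpNorm (d t) 2 volume ≤ B := by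
  choose! k₀ hk₀c hk₀ using fun t ht => (hz t ht).2.2.exists_continuous
  have hw : ∀ t ∈ Icc 0 T, IsWeakDeriv (k₀ t) (d t) := fun t ht =>
    (hz t ht).2.2.congr_ae (hk₀ t ht) (ae_eq_refl _)
  have hk2 : ∀ t ∈ Icc 0 T, MemLp (k₀ t) 2 := fun t ht => (hz t ht).1.ae_eq (hk₀ t ht)
  set e : ℝ → ℝ → ℝ≥0∞ := fun t₀ t =>
    eLpNorm (z t - z t₀) 2 volume + eLpNorm (d t - d t₀) 2 volume with he
  have hdiff : ∀ t ∈ Icc 0 T, ∀ t₀ ∈ Icc 0 T, ∀ x, ‖k₀ t x - k₀ t₀ x‖ₑ ≤ 2 * e t₀ t := by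
    intro t ht t₀ ht₀ x
    have h1 := ((hw t ht).sub (hw t₀ ht₀)).enorm_le ((hk₀c t ht).sub (hk₀c t₀ ht₀))
      ((hk2 t ht).sub (hk2 t₀ ht₀)) ((hz t ht).2.1.sub (hz t₀ ht₀).2.1) x
    refine h1.trans (le_of_eq ?_)
    simp only [he]
    congr 2
    refine eLpNorm_congr_ae ?_
    filter_upwards [hk₀ t ht, hk₀ t₀ ht₀] with y h1 h2
    simp [h1, h2]
  -- Continuity bounds the norm near each time, and compactness of [0,T] makes the bound uniform.
  obtain ⟨B, hB, hBb⟩ : ∃ B : ℝ≥0∞, B < ⊤ ∧ ∀ t ∈ Icc 0 T,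
      eLpNorm (z t) 2 volume + eLpNorm (d t) 2 volume ≤ B := by
    refine isCompact_Icc.induction_on (p := fun s => ∃ B : ℝ≥0∞, B < ⊤ ∧ ∀ t ∈ s,
      eLpNorm (z t) 2 volume + eLpNorm (d t) 2 volume ≤ B) (s := Icc 0 T) ⟨0, by simp, by simp⟩
      (fun s t hst ⟨B, h1, h2⟩ => ⟨B, h1, fun x hx => h2 x (hst hx)⟩)
      (fun s t ⟨B, h1, h2⟩ ⟨B', h1', h2'⟩ => ⟨max B B', max_lt h1 h1', fun x hx =>
        hx.elim (fun h => (h2 x h).trans (le_max_left _ _))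
          fun h => (h2' x h).trans (le_max_right _ _)⟩) fun t₀ ht₀ => ?_
    refine ⟨{t | t ∈ Icc 0 T ∧ e t₀ t < 1}, ?_,
      (eLpNorm (z t₀) 2 volume + eLpNorm (d t₀) 2 volume) + 1, ?_, fun t ht => ?_⟩
    · exact (eventually_mem_nhdsWithin (s := Icc 0 T)).and
        ((hc t₀ ht₀).eventually_lt_const one_pos)
    · exact ENNReal.add_lt_top.2 ⟨ENNReal.add_lt_top.2 ⟨(hz t₀ ht₀).1.2, (hz t₀ ht₀).2.1.2⟩,
        ENNReal.one_lt_top⟩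
    · have h1 : eLpNorm (z t) 2 volume ≤ eLpNorm (z t₀) 2 volume + eLpNorm (z t - z t₀) 2 volume := by
        have := eLpNorm_add_le (p := 2) (hz t₀ ht₀).1.1
          ((hz t ht.1).1.1.sub (hz t₀ ht₀).1.1) one_le_two
        rwa [add_sub_cancel] at this
      have h2 : eLpNorm (d t) 2 volume ≤ eLpNorm (d t₀) 2 volume + eLpNorm (d t - d t₀) 2 volume := by
        have := eLpNorm_add_le (p := 2) (hz t₀ ht₀).2.1.1
          ((hz t ht.1).2.1.1.sub (hz t₀ ht₀).2.1.1) one_le_two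
        rwa [add_sub_cancel] at this
      calc _ ≤ _ := add_le_add h1 h2
        _ = eLpNorm (z t₀) 2 volume + eLpNorm (d t₀) 2 volume + e t₀ t := by
            simp only [he]; ring
        _ ≤ _ := by gcongr; exact ht.2.le
  have hk₀B : ∀ t ∈ Icc 0 T, eLpNorm (k₀ t) 2 volume + eLpNorm (d t) 2 volume ≤ B := fun t ht => by
    rw [← eLpNorm_congr_ae (hk₀ t ht)]; exact hBb t ht
  -- Freezing the path outside [0,T] makes its representative continuous on the whole plane.
  set P : ℝ → ℝ := fun t => (projIcc 0 T hT t : ℝ) with hP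
  have hPmem : ∀ t, P t ∈ Icc 0 T := fun t => (projIcc 0 T hT t).2
  have hPid : ∀ t ∈ Icc 0 T, P t = t := fun t ht => by simp [hP, projIcc_of_mem hT ht]
  have hPc : Continuous P := continuous_subtype_val.comp continuous_projIcc
  refine ⟨fun t => k₀ (P t), B, ?_, hB, fun t x => ?_, fun t ht => ?_⟩
  · rw [continuous_iff_continuousAt]
    rintro ⟨t₀, x₀⟩
    rw [ContinuousAt, tendsto_iff_edist_tendsto_0]
    have hlim1 : Tendsto (fun p : ℝ × ℝ => 2 * e (P t₀) (P p.1)) (𝓝 (t₀, x₀)) (𝓝 0) := by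
      have h1 : Tendsto (fun p : ℝ × ℝ => P p.1) (𝓝 (t₀, x₀)) (𝓝[Icc 0 T] (P t₀)) :=
        tendsto_nhdsWithin_iff.2 ⟨(hPc.comp continuous_fst).tendsto (t₀, x₀),
          Eventually.of_forall fun p => hPmem _⟩
      simpa using ENNReal.Tendsto.const_mul (a := 2) ((hc _ (hPmem t₀)).comp h1) (Or.inr (by simp))
    have hlim2 : Tendsto (fun p : ℝ × ℝ => ‖k₀ (P t₀) p.2 - k₀ (P t₀) x₀‖ₑ) (𝓝 (t₀, x₀)) (𝓝 0) := by
      have h2 : Continuous fun p : ℝ × ℝ => ‖k₀ (P t₀) p.2 - k₀ (P t₀) x₀‖ₑ :=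
        (((hk₀c _ (hPmem t₀)).comp continuous_snd).sub continuous_const).enorm
      simpa using h2.tendsto (t₀, x₀)
    have hsum := hlim1.add hlim2
    rw [add_zero] at hsum
    refine tendsto_of_tendsto_of_tendsto_of_le_of_le tendsto_const_nhds hsum (fun _ => zero_le)
      fun p => ?_
    simp only [Function.uncurry, edist_eq_enorm_sub]
    refine le_trans ?_ (add_le_add (hdiff _ (hPmem p.1) _ (hPmem t₀) p.2) le_rfl)
    rw [← sub_add_sub_cancel _ (k₀ (P t₀) p.2)]
    exact enorm_add_le _ _
  · refine ((hw _ (hPmem t)).enorm_le (hk₀c _ (hPmem t)) (hk2 _ (hPmem t))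
      (hz _ (hPmem t)).2.1 x).trans ?_
    gcongr
    exact hk₀B _ (hPmem t)
  · simp only [hPid t ht]
    exact ⟨hk₀ t ht, hk₀c t ht, hw t ht, hk2 t ht, hk₀B t ht⟩

/-- The difference between the flux of a path in `ℰ¹` and that of the profile. -/
theorem exists_flux_difference {F : ℝ → ℝ} {D T um up : ℝ} {U : ℝ → ℝ} {u N : ℝ → ℝ → ℝ}
    (hF : IsAdmissibleFlux F) (hFs : ContDiffOn ℝ ∞ F (uIcc um up)) (hD : 0 < D)
    (hU : IsViscousShock F D um up U) (hγ : shockSpeed F um up = 0) (hT : 0 ≤ T)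
    (hu : MemE1 T U u) (hN : ∀ s ∈ Icc 0 T, IsWeakDeriv (fun y => F (u s y)) (N s)) :
    ∃ (f m : ℝ → ℝ → ℝ) (C : ℝ) (B : ℝ≥0∞), Continuous (Function.uncurry f) ∧
      (∀ s x, |f s x| ≤ C) ∧ Measurable (Function.uncurry m) ∧ B < ⊤ ∧
      ∀ s ∈ Icc 0 T, Tendsto (f s) atTop (𝓝 0) ∧ Tendsto (f s) atBot (𝓝 0) ∧
        ∫⁻ x, ‖m s x‖ₑ ^ 2 ≤ B ∧
        (N s =ᵐ[volume] fun x => m s x + deriv F (U x) * deriv U x) ∧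
        ∀ a b, ∫ x in a..b, m s x = f s b - f s a := by
  obtain ⟨d, hz, hc⟩ := hu
  obtain ⟨k, B, hkc, hB, hkB, hk⟩ := ContinuousIntoH1.exists_continuous hT hz hc
  obtain ⟨C, hC, hlip⟩ := hF.exists_lipschitz
  obtain ⟨a, ha, hdb⟩ := hU.exists_derivBound hγ hF hFs hD
  have hUc := hU.continuous
  have hU'c : Continuous (deriv U) := (hdb 0).2.continuous ()
  have hU'2 : MemLp (deriv U) 2 := by
    obtain ⟨K, hK⟩ := (hdb 0).2.bound
    have hei := integrable_exp_neg_mul_abs ha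
    rw [memLp_two_iff_integrable_sq hU'c.aestronglyMeasurable]
    refine (hei.const_mul (K ^ 2)).mono' (hU'c.pow 2).aestronglyMeasurable
      (ae_of_all _ fun x => ?_)
    have h1 := hK () x
    have h2 : Real.exp (-(a * |x|)) ≤ 1 := Real.exp_le_one_iff.2 (by
      simp only [Left.neg_nonpos_iff]; positivity)
    have h3 := Real.exp_pos (-(a * |x|))
    rw [Real.norm_eq_abs, abs_of_nonneg (sq_nonneg _), ← sq_abs]
    calc |deriv U x| ^ 2 ≤ (K * Real.exp (-(a * |x|))) ^ 2 := by gcongr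
      _ = K ^ 2 * (Real.exp (-(a * |x|)) * Real.exp (-(a * |x|))) := by ring
      _ ≤ K ^ 2 * (Real.exp (-(a * |x|)) * 1) := by gcongr
      _ = _ := by ring
  set f : ℝ → ℝ → ℝ := fun s x => F (U x + k s x) - F (U x) with hf
  have hfc : Continuous (Function.uncurry f) := by
    have h1 : Continuous fun p : ℝ × ℝ => U p.2 + k p.1 p.2 :=
      (hUc.comp continuous_snd).add hkc
    exact (hF.differentiable.continuous.comp h1).sub
      (hF.differentiable.continuous.comp (hUc.comp continuous_snd))
  have hfk : ∀ s x, |f s x| ≤ C * |k s x| := fun s x => by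
    have := hlip.dist_le_mul (U x + k s x) (U x)
    simpa [Real.dist_eq] using this
  have hd : ∀ x, HasDerivAt U (deriv U x) x := fun x => (hU.hasDerivAt hγ x).differentiableAt.hasDerivAt
  have hFU : IsWeakDeriv (fun x => F (U x)) (fun x => deriv F (U x) * deriv U x) :=
    isWeakDeriv_of_hasDerivAt (fun x => (hF.differentiable (U x)).hasDerivAt.comp x (hd x))
      ((hF.contDiff_deriv.continuous.comp hUc).mul hU'c)
  have hfw : ∀ s ∈ Icc 0 T, IsWeakDeriv (f s) (fun x => N s x - deriv F (U x) * deriv U x) := by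
    intro s hs
    refine IsWeakDeriv.sub ?_ hFU
    refine (hN s hs).congr_ae ((hk s hs).1.mono fun x hx => ?_) (ae_eq_refl _)
    simp only at hx ⊢
    rw [← hx]; congr 1; ring
  have hfs : ∀ s, Continuous (f s) := fun s => hfc.comp (by fun_prop : Continuous fun x => (s, x))
  have hmN : ∀ s ∈ Icc 0 T, ∀ᵐ x, deriv (f s) x = N s x - deriv F (U x) * deriv U x := fun s hs =>
    ((hfw s hs).ae_hasDerivAt (hfs s)).mono fun x hx => hx.deriv
  set R : ℝ≥0∞ := C * (B + 2 * eLpNorm (deriv U) 2 volume) with hR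
  -- The pointwise derivative of f serves as m because it is jointly measurable, whereas N is given
  -- only for each time separately. The two versions agree almost everywhere at each time.
  refine ⟨f, fun s => deriv (f s), C * (2 * B).toReal, R ^ 2, hfc, fun s x => ?_, ?_, ?_,
    fun s hs => ⟨?_, ?_, ?_, ?_, fun a b => ?_⟩⟩
  · refine (hfk s x).trans (mul_le_mul_of_nonneg_left ?_ C.2)
    rw [← Real.norm_eq_abs, ← toReal_enorm]
    exact ENNReal.toReal_mono (ENNReal.mul_ne_top (by simp) hB.ne) (hkB s x)
  · exact measurable_deriv_with_param hfc
  · refine ENNReal.pow_lt_top (ENNReal.mul_lt_top (by simp) (ENNReal.add_lt_top.2 ⟨hB, ?_⟩))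
    exact ENNReal.mul_lt_top (by simp) hU'2.2
  · have h1 := ((hk s hs).2.2.1.tendsto_zero (hk s hs).2.1 (hk s hs).2.2.2.1 (hz s hs).2.1).1
    refine squeeze_zero_norm (fun x => hfk s x) ?_
    simpa using h1.abs.const_mul (C : ℝ)
  · have h1 := ((hk s hs).2.2.1.tendsto_zero (hk s hs).2.1 (hk s hs).2.2.2.1 (hz s hs).2.1).2
    refine squeeze_zero_norm (fun x => hfk s x) ?_
    simpa using h1.abs.const_mul (C : ℝ)
  · rw [← eLpNorm_two_sq]
    refine pow_le_pow_left₀ zero_le ?_ 2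
    have hUk : IsWeakDeriv (fun x => U x + k s x) (fun x => deriv U x + d s x) :=
      (isWeakDeriv_of_hasDerivAt hd hU'c).add (hk s hs).2.2.1
    have hbd := hUk.abs_le_of_comp (hUc.add (hk s hs).2.1) hF.differentiable hC
      ((hN s hs).congr_ae ((hk s hs).1.mono fun x hx => by
        simp only at hx ⊢
        rw [← hx]; congr 1; ring) (ae_eq_refl _))
    have hpt : ∀ᵐ x, ‖deriv (f s) x‖ ≤ (C : ℝ) * ‖|d s x| + 2 * |deriv U x|‖ := by
      filter_upwards [hbd, hmN s hs] with x h1 h2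
      rw [h2, Real.norm_eq_abs, Real.norm_eq_abs,
        abs_of_nonneg (by positivity : 0 ≤ |d s x| + 2 * |deriv U x|)]
      refine (abs_sub _ _).trans ?_
      rw [abs_mul]
      have h3 := mul_le_mul_of_nonneg_right (hC (U x)) (abs_nonneg (deriv U x))
      have h4 := mul_le_mul_of_nonneg_left (abs_add_le (deriv U x) (d s x)) C.coe_nonneg
      rw [mul_add] at h4
      rw [mul_add]
      linarith
    refine (eLpNorm_le_nnreal_smul_eLpNorm_of_ae_le_mul (c := C) hpt 2).trans ?_
    rw [hR, ENNReal.smul_def, smul_eq_mul]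
    refine mul_le_mul_right ?_ _
    have hdm : AEStronglyMeasurable (d s) volume := (hz s hs).2.1.1
    refine (eLpNorm_add_le (f := fun x => |d s x|) (g := fun x => 2 * |deriv U x|)
      hdm.norm (hU'c.abs.const_mul 2).aestronglyMeasurable one_le_two).trans (add_le_add ?_ ?_)
    · refine le_trans (le_of_eq ?_) (le_add_self.trans (hk s hs).2.2.2.2)
      exact eLpNorm_norm (d s)
    · have := eLpNorm_const_smul (2 : ℝ) (fun x => |deriv U x|) 2 (volume : Measure ℝ)
      refine le_of_eq (this.trans ?_)
      congr 1
      · simp [enorm]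
      · exact eLpNorm_norm (deriv U)
  · filter_upwards [hmN s hs] with x hx
    rw [hx]; ring
  · rw [(hfw s hs).sub_eq_of_continuous (hfs s) a b]
    exact intervalIntegral.integral_congr_ae ((hmN s hs).mono fun x hx _ => hx)

/-- The law of a time that is uniform on `[0,T]` (up to normalization), and of an independent
Gaussian. -/
abbrev timeGaussian (T : ℝ) : Measure (ℝ × ℝ) := (volume.restrict (Icc 0 T)).prod unitGaussian

theorem integrable_comp_heat {G : ℝ → ℝ → ℝ} {D T : ℝ} (hG : Measurable (Function.uncurry G))
    (ρ : Measure ℝ) [SFinite ρ]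
    (h : ∫⁻ s in Icc 0 T, ∫⁻ z, ∫⁻ x, ‖G s (x + Real.sqrt (2 * D * (T - s)) * z)‖ₑ ∂ρ ∂unitGaussian
      < ⊤) :
    Integrable (fun q : (ℝ × ℝ) × ℝ => G q.1.1 (q.2 + Real.sqrt (2 * D * (T - q.1.1)) * q.1.2))
      ((timeGaussian T).prod ρ) := by
  have hm : Measurable fun q : (ℝ × ℝ) × ℝ =>
      G q.1.1 (q.2 + Real.sqrt (2 * D * (T - q.1.1)) * q.1.2) :=
    hG.comp (g := Function.uncurry G) (f := fun q : (ℝ × ℝ) × ℝ =>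
      (q.1.1, q.2 + Real.sqrt (2 * D * (T - q.1.1)) * q.1.2)) (by fun_prop)
  refine ⟨hm.aestronglyMeasurable, ?_⟩
  rw [HasFiniteIntegral, lintegral_prod _ hm.enorm.aemeasurable,
    lintegral_prod _ hm.enorm.lintegral_prod_right'.aemeasurable]
  exact h

theorem integral_heatSemigroup_eq {G : ℝ → ℝ → ℝ} {D T x : ℝ} (hD : 0 < D) (hT : 0 ≤ T)
    (h : Integrable (fun p : ℝ × ℝ => G p.1 (x + Real.sqrt (2 * D * (T - p.1)) * p.2))
      (timeGaussian T)) :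
    ∫ s in (0 : ℝ)..T, heatSemigroup D (T - s) (G s) x
      = ∫ p, G p.1 (x + Real.sqrt (2 * D * (T - p.1)) * p.2) ∂(timeGaussian T) := by
  rw [integral_prod _ h, intervalIntegral.integral_of_le hT, ← integral_Icc_eq_integral_Ioc]
  exact setIntegral_congr_fun measurableSet_Icc fun s hs =>
    heatSemigroup_eq_integral_unitGaussian hD (sub_nonneg.2 hs.2) _ _

/-- At s = T the semigroup is the pointwise identity and does not respect almost everywhere
equality, but this is a single time. -/
theorem integral_heatSemigroup_congr {G G' : ℝ → ℝ → ℝ} {D T x : ℝ} (hT : 0 ≤ T)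
    (h : ∀ᵐ s ∂(volume.restrict (Icc 0 T)), G s =ᵐ[volume] G' s) :
    ∫ s in (0 : ℝ)..T, heatSemigroup D (T - s) (G s) x
      = ∫ s in (0 : ℝ)..T, heatSemigroup D (T - s) (G' s) x := by
  rw [intervalIntegral.integral_of_le hT, intervalIntegral.integral_of_le hT,
    ← integral_Icc_eq_integral_Ioc, ← integral_Icc_eq_integral_Ioc]
  have hne : ∀ᵐ s ∂(volume.restrict (Icc 0 T)), s ≠ T :=
    ae_restrict_of_ae (Measure.ae_ne volume T)
  refine integral_congr_ae ?_
  filter_upwards [h, hne] with s hs hsT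
  have : T - s ≠ 0 := sub_ne_zero.2 (Ne.symm hsT)
  simp only [heatSemigroup, this, if_false]
  exact integral_congr_ae (hs.mono fun y hy => by simp only [hy])

/-- The integral telescopes to the difference of two integrals of U over windows of length |x₀| near
-R and R, where U is close to its end states. -/
theorem tendsto_integral_translate_sub {U : ℝ → ℝ} {um up M : ℝ} (hU : Continuous U)
    (hM : ∀ x, |U x| ≤ M) (hl : Tendsto U atBot (𝓝 um)) (hr : Tendsto U atTop (𝓝 up)) (x₀ : ℝ) :
    Tendsto (fun R : ℝ => ∫ x in (-R)..R, (U (x - x₀) - U x)) atTop (𝓝 (x₀ * (um - up))) := by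
  have hi : ∀ a b, IntervalIntegrable U volume a b := fun a b => hU.intervalIntegrable a b
  have he : ∀ R : ℝ, ∫ x in (-R)..R, (U (x - x₀) - U x)
      = (∫ y in (-x₀)..0, U (y + -R)) - ∫ y in (-x₀)..0, U (y + R) := fun R => by
    have h0 : Continuous fun x => U (x - x₀) := by fun_prop
    rw [intervalIntegral.integral_sub (h0.intervalIntegrable _ _) (hi _ _),
      intervalIntegral.integral_comp_sub_right, intervalIntegral.integral_comp_add_right,
      intervalIntegral.integral_comp_add_right]
    have e1 := intervalIntegral.integral_add_adjacent_intervals (hi (-R - x₀) (-R)) (hi (-R) (R - x₀))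
    have e2 := intervalIntegral.integral_add_adjacent_intervals (hi (-R) (R - x₀)) (hi (R - x₀) R)
    have e3 : -x₀ + -R = -R - x₀ := by ring
    have e4 : -x₀ + R = R - x₀ := by ring
    rw [e3, e4, zero_add, zero_add]
    linarith
  simp_rw [he]
  have hlim : ∀ {g : ℝ → ℝ} {e : ℝ}, (∀ y, Tendsto (fun R => U (y + g R)) atTop (𝓝 e)) →
      Tendsto (fun R => ∫ y in (-x₀)..0, U (y + g R)) atTop (𝓝 (x₀ * e)) := by
    intro g e hg
    have := intervalIntegral.tendsto_integral_filter_of_dominated_convergence (μ := volume)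
      (a := -x₀) (b := 0) (l := atTop) (F := fun R y => U (y + g R)) (f := fun _ => e) (fun _ => M)
      (Eventually.of_forall fun R =>
        (hU.comp (continuous_add_const (g R))).aestronglyMeasurable)
      (Eventually.of_forall fun R => ae_of_all _ fun y _ => hM _) (by simp)
      (ae_of_all _ fun y _ => hg y)
    simpa using this
  rw [mul_sub]
  exact (hlim (g := fun R => -R) fun y => hl.comp
    (tendsto_atBot_add_const_left atTop y tendsto_neg_atTop_atBot)).sub
    (hlim (g := fun R => R) fun y => hr.comp (tendsto_atTop_add_const_left atTop y tendsto_id))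

/-- The displacement of the wave requires a proportional amount of injected mass. -/
theorem displacement_eq_integral_forcing {F : ℝ → ℝ} {D T um up x₀ : ℝ} {U : ℝ → ℝ}
    {u N K W : ℝ → ℝ → ℝ}
    (hF : IsAdmissibleFlux F) (hFs : ContDiffOn ℝ ∞ F (uIcc um up)) (hD : 0 < D)
    (hU : IsViscousShock F D um up U) (hγ : shockSpeed F um up = 0) (hT : 0 ≤ T)
    (hu : MemE1 T U u) (hN : ∀ s ∈ Icc 0 T, IsWeakDeriv (fun y => F (u s y)) (N s))
    (hWm : Measurable (Function.uncurry W))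
    (hWi : Integrable (Function.uncurry W) ((volume.restrict (Icc 0 T)).prod volume))
    (hKW : ∀ᵐ s ∂(volume.restrict (Icc 0 T)), K s =ᵐ[volume] W s)
    (hmild : ∀ᵐ x, U (x - x₀) = heatSemigroup D T U x
        - (∫ s in (0 : ℝ)..T, heatSemigroup D (T - s) (N s) x)
        + ∫ s in (0 : ℝ)..T, heatSemigroup D (T - s) (K s) x) :
    x₀ * (um - up) = ∫ p, Function.uncurry W p ∂((volume.restrict (Icc 0 T)).prod volume) := by
  obtain ⟨f, m, C, B, hfc, hfC, hmm, hB, hfm⟩ := exists_flux_difference hF hFs hD hU hγ hT hu hN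
  obtain ⟨a, ha, hdb⟩ := hU.exists_derivBound hγ hF hFs hD
  obtain ⟨M, hM⟩ := (hdb 0).1.bound
  have hUM : ∀ x, |U x| ≤ M := fun x => by simpa using hM () x
  obtain ⟨M₁, hM₁⟩ := (hdb 0).2.bound
  have hM₁0 : 0 ≤ M₁ := by
    have := (abs_nonneg _).trans (hM₁ () 0)
    simpa using this
  have hU'M : ∀ x, |deriv U x| ≤ M₁ := fun x => (hM₁ () x).trans (by
    have : Real.exp (-(a * |x|)) ≤ 1 := Real.exp_le_one_iff.2 (by
      simp only [Left.neg_nonpos_iff]; positivity)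
    nlinarith)
  have hUc := hU.continuous
  have hU'c : Continuous (deriv U) := (hdb 0).2.continuous ()
  obtain ⟨L, hL, -⟩ := hF.exists_lipschitz
  set r : ℝ → ℝ := fun x => deriv F (U x) * deriv U x with hr
  have hrc : Continuous r := (hF.contDiff_deriv.continuous.comp hUc).mul hU'c
  have hrM : ∀ x, |r x| ≤ L * M₁ := fun x => by
    rw [hr, abs_mul]
    exact mul_le_mul (hL _) (hU'M x) (abs_nonneg _) L.coe_nonneg
  have hfin : IsFiniteMeasure (timeGaussian T) := inferInstance
  -- the profile is itself a mild solution without forcing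
  have hduh : ∀ x, U x = heatSemigroup D T U x
      - ∫ p, r (x + Real.sqrt (2 * D * (T - p.1)) * p.2) ∂(timeGaussian T) := fun x => by
    have h1 := duhamel (T := T) (M := max M (max M₁ (L * M₁ / D))) hD (v := fun _ => U)
      (vt := fun _ _ => 0) (vx := fun _ => deriv U)
      (vxx := fun _ x => deriv F (U x) / D * deriv U x)
      (fun y y' s hy => by
        have := (hU.hasDerivAt hγ (y s)).differentiableAt.hasDerivAt.comp s hy
        simpa [Function.comp_def] using this)
      (fun s x => hU.hasDerivAt_deriv hγ hF x) (hUc.comp continuous_snd) continuous_const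
      (hU'c.comp continuous_snd)
      ((((hF.contDiff_deriv.continuous.comp hUc).div_const D).mul hU'c).comp continuous_snd)
      (fun s _ x => (hUM x).trans (le_max_left _ _))
      (fun s _ x => by
        simp only [abs_zero]
        exact ((abs_nonneg _).trans (hUM x)).trans (le_max_left _ _))
      (fun s _ x => (hU'M x).trans ((le_max_left _ _).trans (le_max_right _ _)))
      (fun s _ x => by
        refine le_trans ?_ ((le_max_right _ _).trans (le_max_right _ _))
        have := hrM x
        rw [hr] at this
        rw [div_mul_eq_mul_div, abs_div, abs_of_pos hD]
        gcongr) (right_mem_Icc.2 hT) x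
    have h2 : (fun (s y : ℝ) => (0 : ℝ) - D * (deriv F (U y) / D * deriv U y)) = fun _ y => -r y := by
      ext s y; simp only [hr]; field_simp; ring
    have h3 := integral_heatSemigroup_eq (G := fun _ y => -r y) (x := x) hD hT
      (Integrable.of_bound (C := L * M₁) (Continuous.aestronglyMeasurable (by fun_prop))
        (ae_of_all _ fun p => by simpa using hrM _))
    have h4 : ∀ s, (fun y => (0 : ℝ) - D * (deriv F (U y) / D * deriv U y)) = fun y => -r y :=
      fun s => congrFun h2 s
    simp only [h4 0] at h1
    rw [h3, integral_neg] at h1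
    linarith
  -- integrability of the shifted forcing and flux
  have hWint : Integrable (fun q : (ℝ × ℝ) × ℝ =>
      W q.1.1 (q.2 + Real.sqrt (2 * D * (T - q.1.1)) * q.1.2)) ((timeGaussian T).prod volume) := by
    refine integrable_comp_heat hWm volume ?_
    have h1 : ∀ s z : ℝ, ∫⁻ x, ‖W s (x + Real.sqrt (2 * D * (T - s)) * z)‖ₑ = ∫⁻ x, ‖W s x‖ₑ :=
      fun s z => lintegral_add_right_eq_self (fun x => ‖W s x‖ₑ) _
    simp only [h1, lintegral_const, measure_univ, mul_one]
    have h2 := hWi.2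
    rwa [HasFiniteIntegral, lintegral_prod _ hWm.enorm.aemeasurable] at h2
  have hmint : ∀ R : ℝ, Integrable (fun q : (ℝ × ℝ) × ℝ =>
      m q.1.1 (q.2 + Real.sqrt (2 * D * (T - q.1.1)) * q.1.2))
      ((timeGaussian T).prod (volume.restrict (Ioc (-R) R))) := fun R => by
    refine integrable_comp_heat hmm _ ?_
    have h1 : ∀ s ∈ Icc 0 T, ∀ z : ℝ,
        ∫⁻ x in Ioc (-R) R, ‖m s (x + Real.sqrt (2 * D * (T - s)) * z)‖ₑ
          ≤ volume (Ioc (-R) R) + B := fun s hs z => by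
      -- The flux derivative is only known to be square integrable in x, so it is integrated over
      -- bounded intervals first.
      have h2 : ∀ c : ℝ, ‖c‖ₑ ≤ 1 + ‖c‖ₑ ^ 2 := fun c => by
        have := ennreal_mul_le_sq_add_sq 1 ‖c‖ₑ
        simpa using this
      calc _ ≤ ∫⁻ x in Ioc (-R) R, (1 + ‖m s (x + Real.sqrt (2 * D * (T - s)) * z)‖ₑ ^ 2) :=
            lintegral_mono fun x => h2 _
        _ = volume (Ioc (-R) R)
            + ∫⁻ x in Ioc (-R) R, ‖m s (x + Real.sqrt (2 * D * (T - s)) * z)‖ₑ ^ 2 := by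
            rw [lintegral_add_left measurable_const]; simp
        _ ≤ volume (Ioc (-R) R)
            + ∫⁻ x, ‖m s (x + Real.sqrt (2 * D * (T - s)) * z)‖ₑ ^ 2 := by
            gcongr; exact Measure.restrict_le_self
        _ ≤ _ := by
            rw [lintegral_add_right_eq_self (fun x => ‖m s x‖ₑ ^ 2)]
            gcongr
            exact (hfm s hs).2.2.1
    calc _ ≤ ∫⁻ s in Icc 0 T, (volume (Ioc (-R) R) + B) := by
          refine setLIntegral_mono measurable_const fun s hs => ?_
          refine (lintegral_mono (h1 s hs)).trans ?_
          simp
      _ < ⊤ := by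
          simp only [lintegral_const]
          exact ENNReal.mul_lt_top (ENNReal.add_lt_top.2 ⟨by simp, hB⟩) (measure_lt_top _ _)
  set w : ℝ → ℝ := fun x => ∫ p, W p.1 (x + Real.sqrt (2 * D * (T - p.1)) * p.2) ∂(timeGaussian T)
    with hw
  have hwi : Integrable w := hWint.integral_prod_right
  -- The heat flow preserves mass: for fixed s and z it is a translation in x, and the Gaussian has
  -- total mass one.
  have hwI : ∫ x, w x = ∫ p, Function.uncurry W p ∂((volume.restrict (Icc 0 T)).prod volume) := by
    have h1 := integral_integral_swap (f := fun (p : ℝ × ℝ) x =>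
      W p.1 (x + Real.sqrt (2 * D * (T - p.1)) * p.2)) hWint
    rw [hw, ← h1, integral_prod _ hWi]
    have h2 : ∀ p : ℝ × ℝ, ∫ x, W p.1 (x + Real.sqrt (2 * D * (T - p.1)) * p.2) = ∫ x, W p.1 x :=
      fun p => integral_add_right_eq_self (W p.1) _
    simp only [h2]
    rw [integral_prod (fun p : ℝ × ℝ => ∫ x, W p.1 x) ?_]
    · simp [Function.uncurry]
    · exact hWi.integral_prod_left.comp_fst unitGaussian
  -- the balance of mass on bounded intervals
  have hbal : ∀ R : ℝ, 0 ≤ R → ∫ x in (-R)..R, (U (x - x₀) - U x)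
      = (∫ x in (-R)..R, w x)
        - ∫ p, (f p.1 (R + Real.sqrt (2 * D * (T - p.1)) * p.2)
            - f p.1 (-R + Real.sqrt (2 * D * (T - p.1)) * p.2)) ∂(timeGaussian T) := fun R hR => by
    have hle : -R ≤ R := by linarith
    have h1 : ∀ᵐ x ∂(volume.restrict (Ioc (-R) R)), U (x - x₀) - U x = w x
        - ∫ p, m p.1 (x + Real.sqrt (2 * D * (T - p.1)) * p.2) ∂(timeGaussian T) := by
      filter_upwards [ae_restrict_of_ae hmild, ae_restrict_of_ae hWint.prod_left_ae,
        (hmint R).prod_left_ae] with x hx hxW hxm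
      have hri : Integrable (fun p : ℝ × ℝ => r (x + Real.sqrt (2 * D * (T - p.1)) * p.2))
          (timeGaussian T) :=
        Integrable.of_bound (C := L * M₁) (Continuous.aestronglyMeasurable (by fun_prop))
          (ae_of_all _ fun p => hrM _)
      rw [hx, integral_heatSemigroup_congr hT hKW, integral_heatSemigroup_eq hD hT hxW,
        integral_heatSemigroup_congr (G' := fun s y => m s y + r y) hT
          ((ae_restrict_mem measurableSet_Icc).mono fun s hs => (hfm s hs).2.2.2.1),
        integral_heatSemigroup_eq hD hT (hxm.add hri), integral_add hxm hri]
      rw [hduh x]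
      ring
    have hmi : Integrable (fun x => ∫ p, m p.1 (x + Real.sqrt (2 * D * (T - p.1)) * p.2)
        ∂(timeGaussian T)) (volume.restrict (Ioc (-R) R)) := (hmint R).integral_prod_right
    rw [intervalIntegral.integral_of_le hle, intervalIntegral.integral_of_le hle,
      integral_congr_ae h1, integral_sub hwi.restrict hmi]
    congr 1
    rw [← integral_integral_swap (f := fun (p : ℝ × ℝ) x =>
      m p.1 (x + Real.sqrt (2 * D * (T - p.1)) * p.2)) (hmint R)]
    have hIcc : ∀ᵐ p ∂(timeGaussian T), p.1 ∈ Icc 0 T :=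
      Measure.quasiMeasurePreserving_fst.ae (ae_restrict_mem measurableSet_Icc)
    refine integral_congr_ae (hIcc.mono fun p hp => ?_)
    simp only
    rw [← (hfm p.1 hp).2.2.2.2, ← intervalIntegral.integral_of_le hle,
      intervalIntegral.integral_comp_add_right (fun y => m p.1 y)]
  -- Only boundary values of F(u) - F(U) remain of the flux; they are bounded and vanish at ±∞ for
  -- each s and z.
  have hflux : Tendsto (fun R : ℝ => ∫ p, (f p.1 (R + Real.sqrt (2 * D * (T - p.1)) * p.2)
      - f p.1 (-R + Real.sqrt (2 * D * (T - p.1)) * p.2)) ∂(timeGaussian T)) atTop (𝓝 0) := by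
    have hIcc : ∀ᵐ p ∂(timeGaussian T), p.1 ∈ Icc 0 T :=
      Measure.quasiMeasurePreserving_fst.ae (ae_restrict_mem measurableSet_Icc)
    have hcm : ∀ R : ℝ, Continuous fun p : ℝ × ℝ =>
        f p.1 (R + Real.sqrt (2 * D * (T - p.1)) * p.2) := fun R =>
      hfc.comp (by fun_prop : Continuous fun p : ℝ × ℝ =>
        (p.1, R + Real.sqrt (2 * D * (T - p.1)) * p.2))
    have := tendsto_integral_filter_of_dominated_convergence (μ := timeGaussian T) (l := atTop)
      (F := fun (R : ℝ) (p : ℝ × ℝ) => f p.1 (R + Real.sqrt (2 * D * (T - p.1)) * p.2)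
        - f p.1 (-R + Real.sqrt (2 * D * (T - p.1)) * p.2)) (f := fun _ => (0 : ℝ))
      (fun _ => C + C) (Eventually.of_forall fun R =>
        ((hcm R).sub (hcm (-R))).aestronglyMeasurable)
      (Eventually.of_forall fun R => ae_of_all _ fun p =>
        (abs_sub _ _).trans (add_le_add (hfC _ _) (hfC _ _))) (integrable_const _)
      (hIcc.mono fun p hp => ?_)
    · simpa using this
    · have h1 := (hfm p.1 hp).1.comp (tendsto_atTop_add_const_right atTop
        (Real.sqrt (2 * D * (T - p.1)) * p.2) tendsto_id)
      have h2 := (hfm p.1 hp).2.1.comp (tendsto_atBot_add_const_right atTop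
        (Real.sqrt (2 * D * (T - p.1)) * p.2) tendsto_neg_atTop_atBot)
      simpa using h1.sub h2
  have hlim1 := tendsto_integral_translate_sub hUc hUM hU.tendsto_left hU.tendsto_right x₀
  have hlim2 := (intervalIntegral_tendsto_integral hwi tendsto_neg_atTop_atBot tendsto_id).sub hflux
  rw [sub_zero, hwI] at hlim2
  refine tendsto_nhds_unique hlim1 (hlim2.congr' ?_)
  filter_upwards [eventually_ge_atTop 0] with R hR using (hbal R hR).symm

/-! ### The lower bound on the rate. -/

theorem IsCorrelationProfile.integral_eq_one {φ₁ : ℝ → ℝ} (h : IsCorrelationProfile φ₁) :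
    ∫ x, φ₁ x = 1 := by
  have h0 := h.fourier_zero
  rw [Real.fourier_real_eq] at h0
  simp only [mul_zero, neg_zero, AddChar.map_zero_eq_one, one_smul] at h0
  rw [integral_complex_ofReal] at h0
  exact_mod_cast h0

theorem IsEnvelope.exists_abs_le {φ₀ : ℝ → ℝ} (h : IsEnvelope φ₀) : ∃ M, ∀ x, |φ₀ x| ≤ M := by
  obtain ⟨h2, g, hg, hw⟩ := h.memH1
  refine ⟨Real.sqrt (2 * ∫ y, (φ₀ y ^ 2 + g y ^ 2)), fun x => ?_⟩
  rw [← Real.sqrt_sq_eq_abs]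
  exact Real.sqrt_le_sqrt (hw.sq_le_integral h.smooth.continuous h2 hg x)

theorem IsEnvelope.integral_sq_pos {φ₀ : ℝ → ℝ} (h : IsEnvelope φ₀) : 0 < ∫ x, φ₀ x ^ 2 := by
  rw [integral_pos_iff_support_of_nonneg (fun x => sq_nonneg _) h.memH1.1.integrable_sq]
  have : (Function.support fun x => φ₀ x ^ 2) = univ := by
    ext x; simp [(h.pos x).ne']
  rw [this]
  simp

/-- This allows φ₁ and the control, which are measurable only up to null sets, to be replaced by
measurable representatives, as joint measurability of the forcing requires. -/
theorem kernelOp_noiseKernel_eq {σ L lc : ℝ} {φ₀ φ₁ φ η η' : ℝ → ℝ} (hlc : lc ≠ 0)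
    (hφ : φ₁ =ᵐ[volume] φ) (hη : η =ᵐ[volume] η') (y : ℝ) :
    kernelOp (noiseKernel σ L lc φ₀ φ₁) η y
      = ∫ x', σ * φ₀ (y / L) * (1 / lc * φ ((y - x') / lc)) * η' x' := by
  refine integral_congr_ae ?_
  have hq : Measure.QuasiMeasurePreserving (fun x' : ℝ => (y - x') / lc) volume volume := by
    have h1 : Measure.QuasiMeasurePreserving (fun x : ℝ => x / lc) volume volume := by
      refine ⟨by fun_prop, ?_⟩
      simp only [div_eq_mul_inv]
      rw [Real.map_volume_mul_right (inv_ne_zero hlc)]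
      exact Measure.smul_absolutelyContinuous
    exact h1.comp (Measure.measurePreserving_sub_left volume y).quasiMeasurePreserving
  filter_upwards [hη, hq.ae hφ] with x' h1 h2
  simp only [noiseKernel, h1, h2]

/-- The mass balance equates x₀(u₋ - u₊) with the injected mass, whose square is at most 2 · cost ·
T · ‖mollified q‖², where q = σφ₀(·/L) and ‖q‖² = σ²L∫φ₀². The 8 is this 2 times the square of the
factor 2 lost in mollifying. -/
theorem eventually_le_infRate {F : ℝ → ℝ} {D T um up x₀ σ L : ℝ} {U φ₀ φ₁ : ℝ → ℝ}
    (hF : IsAdmissibleFlux F) (hFs : ContDiffOn ℝ ∞ F (uIcc um up)) (hD : 0 < D)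
    (hU : IsViscousShock F D um up U) (hγ : shockSpeed F um up = 0) (hT : 0 < T) (hσ : 0 < σ)
    (hL : 0 < L) (hφ₀ : IsEnvelope φ₀) (hφ₁ : IsCorrelationProfile φ₁) :
    ∀ᶠ lc in 𝓝[>] (0 : ℝ),
      ENNReal.ofReal (x₀ ^ 2 * (um - up) ^ 2 / (8 * T * σ ^ 2 * L * ∫ x, φ₀ x ^ 2))
        ≤ infRate F D T U (noiseKernel σ L lc φ₀ φ₁) (displacementEvent T 0 x₀ U) := by
  set S := ∫ x, φ₀ x ^ 2 with hS
  have hS0 : 0 < S := hφ₀.integral_sq_pos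
  set q : ℝ → ℝ := fun y => σ * φ₀ (y / L) with hq
  have hqc : Continuous q := by
    have := hφ₀.smooth.continuous
    fun_prop
  obtain ⟨M, hM⟩ := hφ₀.exists_abs_le
  have hqM : ∀ x, |q x| ≤ σ * M := fun x => by
    rw [hq, abs_mul, abs_of_pos hσ]
    exact mul_le_mul_of_nonneg_left (hM _) hσ.le
  have hqi : Integrable fun x => q x ^ 2 := by
    simp only [hq, mul_pow]
    exact (hφ₀.memH1.1.integrable_sq.comp_div hL.ne').const_mul _
  have hqI : ∫ x, q x ^ 2 = σ ^ 2 * L * S := by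
    simp only [hq, mul_pow]
    rw [integral_const_mul, Measure.integral_comp_div (fun x => φ₀ x ^ 2), abs_of_pos hL,
      smul_eq_mul, mul_assoc]
  have hq2 : MemLp q 2 := (memLp_two_iff_integrable_sq hqc.aestronglyMeasurable).2 hqi
  have hqn : eLpNorm q 2 volume ^ 2 = ENNReal.ofReal (σ ^ 2 * L * S) := by
    rw [eLpNorm_two_sq, ← hqI, ofReal_integral_eq_lintegral_ofReal hqi
      (ae_of_all _ fun x => sq_nonneg _)]
    exact lintegral_congr fun x => enorm_sq_eq_ofReal _
  have hq0 : eLpNorm q 2 volume ≠ 0 := by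
    intro h
    rw [h, zero_pow two_ne_zero] at hqn
    have : 0 < ENNReal.ofReal (σ ^ 2 * L * S) := ENNReal.ofReal_pos.2 (by positivity)
    exact this.ne hqn
  set φ : ℝ → ℝ := hφ₁.integrable.1.mk φ₁ with hφ
  have hφae : φ₁ =ᵐ[volume] φ := hφ₁.integrable.1.ae_eq_mk
  have hφm : Measurable φ := hφ₁.integrable.1.stronglyMeasurable_mk.measurable
  have hφi : Integrable φ := hφ₁.integrable.congr hφae
  have hφ1 : ∫ x, φ x = 1 := by rw [← integral_congr_ae hφae, hφ₁.integral_eq_one]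
  filter_upwards [nhdsWithin_le_nhds (eventually_eLpNorm_mollify_le hφi hφ1 hqc hqM hq2 hq0),
    self_mem_nhdsWithin] with lc hlc hlc0
  rw [mem_Ioi] at hlc0
  refine le_iInf₂ fun u hu => le_iInf fun h => le_iInf₂ fun hh hmild => ?_
  obtain ⟨hu1, -, huT⟩ := hu
  obtain ⟨-, N, hN, hmild⟩ := hmild
  set h' : ℝ → ℝ → ℝ := fun s x => hh.1.mk _ (s, x) with hh'
  have hh'e : Function.uncurry h' = hh.1.mk _ := rfl
  have hh'm : Measurable (Function.uncurry h') := hh.1.stronglyMeasurable_mk.measurable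
  have hae : ∀ᵐ s ∂(volume.restrict (Icc 0 T)), h s =ᵐ[volume] h' s :=
    Measure.ae_ae_of_ae_prod hh.1.ae_eq_mk
  have hcost : ∫⁻ s in Icc 0 T, ∫⁻ x, ‖h' s x‖ₑ ^ 2 = 2 * controlCost T h := by
    rw [controlCost, ← mul_assoc, one_div, ENNReal.mul_inv_cancel (by simp) (by simp), one_mul]
    refine lintegral_congr_ae (hae.mono fun s hs => lintegral_congr_ae (hs.mono fun x hx => ?_))
    simp only [enorm_sq_eq_ofReal, hx]
  have hfin : ∫⁻ s in Icc 0 T, ∫⁻ x, ‖h' s x‖ₑ ^ 2 < ⊤ := by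
    have h1 := lintegral_enorm_sq_lt_top_of_memLp (hh.ae_eq hh.1.ae_eq_mk)
    rw [← hh'e, lintegral_prod _ (hh'm.enorm.pow_const 2).aemeasurable] at h1
    exact h1
  have hid := displacement_eq_integral_forcing (x₀ := x₀) hF hFs hD hU hγ hT.le hu1 hN
    (K := fun s => kernelOp (noiseKernel σ L lc φ₀ φ₁) (h s))
    (measurable_forcing hφm hqc.measurable hh'm).measurable
    (integrable_forcing hlc0.ne' hφm hφi hqc.measurable hq2 hh'm hfin)
    (hae.mono fun s hs => ae_of_all _ fun y => kernelOp_noiseKernel_eq hlc0.ne' hφae hs y)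
    (by
      filter_upwards [hmild T (right_mem_Icc.2 hT.le), huT] with x h1 h2
      rw [← h1, h2]; simp)
  have hle := enorm_integral_forcing_sq_le hlc0 hφm hφi hqc hq2 hqM hh'm hfin
  rw [← hid, enorm_sq_eq_ofReal, hcost] at hle
  have h8 : (0 : ℝ) < 8 * T * σ ^ 2 * L * S := by positivity
  rw [ENNReal.ofReal_div_of_pos h8]
  refine ENNReal.div_le_of_le_mul ?_
  rw [← mul_pow]
  refine hle.trans ?_
  calc 2 * controlCost T h * (ENNReal.ofReal T * eLpNorm (mollify φ lc q) 2 volume ^ 2)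
      ≤ 2 * controlCost T h * (ENNReal.ofReal T * (2 * eLpNorm q 2 volume) ^ 2) := by gcongr
    _ = controlCost T h * (ENNReal.ofReal 8 * ENNReal.ofReal T * ENNReal.ofReal (σ ^ 2 * L * S)) := by
        rw [mul_pow, hqn, ENNReal.ofReal_ofNat]
        ring
    _ = _ := by
        rw [← ENNReal.ofReal_mul (by norm_num), ← ENNReal.ofReal_mul (by positivity)]
        congr 2
        ring

/-! ### Explicit paths, the forcing that they need, and its realization. -/

theorem exp_neg_mul_abs_sub_le {a b B : ℝ} (ha : 0 ≤ a) (hb : |b| ≤ B) (x : ℝ) :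
    Real.exp (-(a * |x - b|)) ≤ Real.exp (a * B) * Real.exp (-(a * |x|)) := by
  rw [← Real.exp_add, Real.exp_le_exp]
  have h1 : |x| ≤ |x - b| + |b| := by
    simpa using abs_add_le (x - b) b
  nlinarith

theorem abs_comp_sub_sub_le {f : ℝ → ℝ} {a B C b b' : ℝ} (ha : 0 ≤ a) (hf : Differentiable ℝ f)
    (hC : ∀ x, |deriv f x| ≤ C * Real.exp (-(a * |x|))) (hb : |b| ≤ B) (hb' : |b'| ≤ B) (x : ℝ) :
    |f (x - b) - f (x - b')| ≤ C * Real.exp (a * B) * |b - b'| * Real.exp (-(a * |x|)) := by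
  have hC0 : 0 ≤ C := by
    have := (abs_nonneg _).trans (hC 0)
    simpa using this
  have h := Convex.norm_image_sub_le_of_norm_deriv_le (s := Icc (-B) B)
    (f := fun s => f (x - s)) (C := C * Real.exp (a * B) * Real.exp (-(a * |x|)))
    (fun s _ => (hf.comp (differentiable_id.const_sub x)).differentiableAt) (fun s hs => by
      rw [deriv_comp_const_sub, norm_neg, Real.norm_eq_abs, mul_assoc]
      exact (hC _).trans (mul_le_mul_of_nonneg_left
        (exp_neg_mul_abs_sub_le ha (abs_le.2 hs) x) hC0))
    (convex_Icc _ _) (abs_le.1 hb') (abs_le.1 hb)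
  rw [Real.norm_eq_abs, Real.norm_eq_abs] at h
  linarith

/-- A path that translates `G` with speed `c` and, at the same time, interpolates linearly between
`G` and its translate by `x₀`. -/
def wavePath (G : ℝ → ℝ) (c κ x₀ t x : ℝ) : ℝ := G (x - c * t) + κ * t * (G (x - x₀) - G x)

theorem continuous_wavePath {G : ℝ → ℝ} (hG : Continuous G) (c κ x₀ : ℝ) :
    Continuous (Function.uncurry (wavePath G c κ x₀)) := by
  simp only [Function.uncurry_def, wavePath]
  fun_prop

theorem hasDerivAt_wavePath {G G' : ℝ → ℝ} (hG : ∀ x, HasDerivAt G (G' x) x) (c κ x₀ t x : ℝ) :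
    HasDerivAt (wavePath G c κ x₀ t) (wavePath G' c κ x₀ t x) x :=
  ((hG _).comp_sub_const x (c * t)).add
    ((((hG _).comp_sub_const x x₀).sub (hG x)).const_mul (κ * t))

theorem derivBound_wavePath {G ρ : ℝ → ℝ} {n : ℕ} {c κ x₀ T : ℝ} (hρ : ∀ x, 0 ≤ ρ x)
    (hρt : ∀ B, ∃ C₀, ∀ b, |b| ≤ B → ∀ x, ρ (x - b) ≤ C₀ * ρ x)
    (hG : DerivBound ρ n fun _ : Unit => G) :
    DerivBound ρ n fun t : Icc 0 T => wavePath G c κ x₀ t := by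
  have ht : ∀ t : Icc 0 T, |(t : ℝ)| ≤ T := fun t => by
    rw [abs_of_nonneg t.2.1]; exact t.2.2
  have hsh : ∀ {b : Icc 0 T → ℝ} {B : ℝ}, (∀ t, |b t| ≤ B) →
      DerivBound ρ n fun t x => G (x - b t) := fun {b B} hb => by
    obtain ⟨C₀, hC₀⟩ := hρt B
    exact (hG.reindex fun _ => ()).comp_sub hρ (fun t x => hC₀ _ (hb t) x)
  have h1 := hsh (b := fun t => c * t) (B := |c| * T) fun t => by
    rw [abs_mul]; exact mul_le_mul_of_nonneg_left (ht t) (abs_nonneg c)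
  have h2 := hsh (b := fun _ => x₀) (B := |x₀|) fun t => le_rfl
  have h3 := (hG.reindex fun _ : Icc 0 T => ()).const_mul (c := fun _ => -1) (M := 1)
    (fun _ => by simp) hρ
  have h4 := (h2.add h3).const_mul (c := fun t : Icc 0 T => κ * t) (M := |κ| * T)
    (fun t => by
      rw [abs_mul]; exact mul_le_mul_of_nonneg_left (ht t) (abs_nonneg κ)) hρ
  have h5 := h1.add h4
  simp only [neg_mul, one_mul, ← sub_eq_add_neg] at h5
  exact h5

/-- `G` itself need not decay (the profile does not), but by the mean value theorem its increments
inherit the decay of G'. -/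
theorem derivBound_translate_sub {G : ℝ → ℝ} {a : ℝ} (ha : 0 ≤ a) (hG : Differentiable ℝ G) {n : ℕ}
    (hG' : DerivBound (fun x => Real.exp (-(a * |x|))) n fun _ : Unit => deriv G) {ι : Type*}
    (x₀ : ℝ) : DerivBound (fun x => Real.exp (-(a * |x|))) n fun (_ : ι) x => G (x - x₀) - G x := by
  obtain ⟨C, hC⟩ := hG'.bound
  have hb : ∃ C', ∀ (_ : ι) x, |G (x - x₀) - G x| ≤ C' * Real.exp (-(a * |x|)) :=
    ⟨_, fun _ x => by
      simpa using abs_comp_sub_sub_le (b := x₀) (b' := 0) ha hG (fun x => hC () x) le_rfl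
        (by simp) x⟩
  cases n with
  | zero => exact ⟨fun _ => by have := hG.continuous; fun_prop, hb⟩
  | succ n =>
    refine ⟨fun _ => by fun_prop, hb, ?_⟩
    have h1 := (hG'.of_succ.reindex fun _ : ι => ()).comp_sub (a := fun _ => x₀)
      (fun x => (Real.exp_pos _).le) (fun _ x => exp_neg_mul_abs_sub_le ha le_rfl x)
    have h2 := (hG'.of_succ.reindex fun _ : ι => ()).const_mul (c := fun _ => -1) (M := 1)
      (fun _ => by simp) (fun x => (Real.exp_pos _).le)
    have h3 := h1.add h2
    simp only [neg_mul, one_mul, ← sub_eq_add_neg] at h3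
    convert h3 using 3 with _ x
    have := ((hG (x - x₀)).hasDerivAt.comp_sub_const x x₀).sub (hG x).hasDerivAt
    exact this.deriv

/-- The growth of the inverse envelope is absorbed by half of the decay rate, through t^k / k! ≤ e^t
at t = a(1 + |x|)/2. -/
theorem exists_pow_mul_exp_le {a : ℝ} (ha : 0 < a) (k : ℕ) :
    ∃ C, ∀ x : ℝ, (1 + |x|) ^ k * Real.exp (-(a * |x|)) ≤ C * Real.exp (-(a / 2 * |x|)) := by
  refine ⟨(k.factorial : ℝ) * (2 / a) ^ k * Real.exp (a / 2), fun x => ?_⟩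
  have h1 : (a / 2 * (1 + |x|)) ^ k / k.factorial ≤ Real.exp (a / 2 * (1 + |x|)) :=
    Real.pow_div_factorial_le_exp (a / 2 * (1 + |x|)) (by positivity) k
  rw [div_le_iff₀ (by positivity)] at h1
  have h2 : (1 + |x|) ^ k = (2 / a) ^ k * (a / 2 * (1 + |x|)) ^ k := by
    rw [← mul_pow]; congr 1; field_simp
  rw [h2]
  calc (2 / a) ^ k * (a / 2 * (1 + |x|)) ^ k * Real.exp (-(a * |x|))
      ≤ (2 / a) ^ k * (Real.exp (a / 2 * (1 + |x|)) * k.factorial) * Real.exp (-(a * |x|)) := by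
        gcongr
    _ = (k.factorial : ℝ) * (2 / a) ^ k * (Real.exp (a / 2 * (1 + |x|)) * Real.exp (-(a * |x|))) := by
        ring
    _ = (k.factorial : ℝ) * (2 / a) ^ k * (Real.exp (a / 2) * Real.exp (-(a / 2 * |x|))) := by
        rw [← Real.exp_add, ← Real.exp_add]; congr 2; ring
    _ = _ := by ring

theorem memLp_two_of_abs_le_exp {f : ℝ → ℝ} {a C : ℝ} (ha : 0 < a) (hf : Continuous f)
    (hC : ∀ x, |f x| ≤ C * Real.exp (-(a * |x|))) : MemLp f 2 := by
  rw [memLp_two_iff_integrable_sq hf.aestronglyMeasurable]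
  refine ((integrable_exp_neg_mul_abs (mul_pos two_pos ha)).const_mul (C ^ 2)).mono'
    (hf.pow 2).aestronglyMeasurable (ae_of_all _ fun x => ?_)
  rw [Real.norm_eq_abs, abs_of_nonneg (sq_nonneg _), ← sq_abs]
  calc |f x| ^ 2 ≤ (C * Real.exp (-(a * |x|))) ^ 2 := by gcongr; exact hC x
    _ = C ^ 2 * (Real.exp (-(a * |x|)) * Real.exp (-(a * |x|))) := by ring
    _ = _ := by rw [← Real.exp_add]; congr 2; ring

/-- The path and its x-derivative are Lipschitz in time with an exponentially decaying constant. As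
the path starts at U, comparison with time 0 also shows that its difference from U is square
integrable. -/
theorem memE1_wavePath {U : ℝ → ℝ} {a c κ x₀ T : ℝ} (ha : 0 < a)
    (hU : Differentiable ℝ U)
    (hU' : DerivBound (fun x => Real.exp (-(a * |x|))) 1 fun _ : Unit => deriv U) :
    MemE1 T U (wavePath U c κ x₀) := by
  obtain ⟨C, hC⟩ := hU'.bound
  obtain ⟨C', hC'⟩ := hU'.2.2.bound
  have hUc := hU.continuous
  have hU'd : Differentiable ℝ (deriv U) := hU'.1 ()
  have hU'c := hU'd.continuous
  set E : ℝ → ℝ := fun x => Real.exp (-(a * |x|)) with hE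
  have hE2 : MemLp E 2 := memLp_two_of_abs_le_exp (C := 1) ha (by fun_prop) fun x => by
    rw [abs_of_pos (Real.exp_pos _), one_mul]
  have key : ∀ {G : ℝ → ℝ} {C : ℝ}, Differentiable ℝ G → (∀ x, |deriv G x| ≤ C * E x) →
      ∃ K, 0 ≤ K ∧ ∀ t ∈ Icc 0 T, ∀ t₀ ∈ Icc 0 T, ∀ x,
        |wavePath G c κ x₀ t x - wavePath G c κ x₀ t₀ x| ≤ K * |t - t₀| * E x := by
    intro G C hG hGC
    have hC0 : 0 ≤ C := by
      have := (abs_nonneg _).trans (hGC 0)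
      simpa [hE] using this
    refine ⟨C * Real.exp (a * (|c| * T)) * |c| + |κ| * (C * Real.exp (a * |x₀|) * |x₀|),
      by positivity, fun t ht t₀ ht₀ x => ?_⟩
    have hct : ∀ t ∈ Icc 0 T, |c * t| ≤ |c| * T := fun t ht => by
      rw [abs_mul, abs_of_nonneg ht.1]; exact mul_le_mul_of_nonneg_left ht.2 (abs_nonneg c)
    have h1 := abs_comp_sub_sub_le ha.le hG hGC (hct t ht) (hct t₀ ht₀) x
    have h2 := abs_comp_sub_sub_le (b := x₀) (b' := 0) ha.le hG hGC le_rfl (by simp) x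
    rw [← mul_sub, abs_mul] at h1
    simp only [sub_zero] at h2
    have e1 : wavePath G c κ x₀ t x - wavePath G c κ x₀ t₀ x
        = (G (x - c * t) - G (x - c * t₀)) + κ * (t - t₀) * (G (x - x₀) - G x) := by
      simp only [wavePath]; ring
    rw [e1]
    refine (abs_add_le _ _).trans ?_
    rw [abs_mul, abs_mul]
    have h3 := mul_le_mul_of_nonneg_left h2 (by positivity : 0 ≤ |κ| * |t - t₀|)
    calc _ ≤ _ := add_le_add h1 h3
      _ = _ := by ring
  obtain ⟨K, hK0, hK⟩ := key hU (fun x => hC () x)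
  obtain ⟨K', hK'0, hK'⟩ := key hU'd (fun x => hC' () x)
  have hz0 : ∀ (G : ℝ → ℝ) x, wavePath G c κ x₀ 0 x = G x := fun G x => by simp [wavePath]
  have hslice : ∀ {G : ℝ → ℝ}, Continuous G → ∀ t, Continuous (wavePath G c κ x₀ t) := fun hG t =>
    (continuous_wavePath hG c κ x₀).comp (by fun_prop : Continuous fun x : ℝ => (t, x))
  refine ⟨fun t x => wavePath (deriv U) c κ x₀ t x - deriv U x, fun t ht => ⟨?_, ?_, ?_⟩,
    fun t₀ ht₀ => ?_⟩
  · refine memLp_two_of_abs_le_exp ha ((hslice hUc t).sub hUc) (C := K * |t - 0|) fun x => ?_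
    have := hK t ht 0 ⟨le_rfl, ht.1.trans ht.2⟩ x
    rwa [hz0] at this
  · refine memLp_two_of_abs_le_exp ha ((hslice hU'c t).sub hU'c) (C := K' * |t - 0|) fun x => ?_
    have := hK' t ht 0 ⟨le_rfl, ht.1.trans ht.2⟩ x
    rwa [hz0] at this
  · exact isWeakDeriv_of_hasDerivAt
      (fun x => (hasDerivAt_wavePath (fun x => (hU x).hasDerivAt) c κ x₀ t x).sub (hU x).hasDerivAt)
      ((hslice hU'c t).sub hU'c)
  · have hle : ∀ {G : ℝ → ℝ} {K : ℝ}, 0 ≤ K → (∀ t ∈ Icc 0 T, ∀ t₀ ∈ Icc 0 T, ∀ x,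
        |wavePath G c κ x₀ t x - wavePath G c κ x₀ t₀ x| ≤ K * |t - t₀| * E x) →
        ∀ t ∈ Icc 0 T, eLpNorm ((fun x => wavePath G c κ x₀ t x - G x)
          - fun x => wavePath G c κ x₀ t₀ x - G x) 2 volume
          ≤ ENNReal.ofReal (K * |t - t₀|) * eLpNorm E 2 volume := by
      intro G K _ hK t ht
      refine eLpNorm_le_mul_eLpNorm_of_ae_le_mul (ae_of_all _ fun x => ?_) 2
      simp only [Pi.sub_apply, sub_sub_sub_cancel_right, Real.norm_eq_abs]
      rw [abs_of_pos (Real.exp_pos _ : 0 < E x)]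
      exact hK t ht t₀ ht₀ x
    have hlim : ∀ K : ℝ, Tendsto (fun t => ENNReal.ofReal (K * |t - t₀|) * eLpNorm E 2 volume)
        (𝓝[Icc 0 T] t₀) (𝓝 0) := fun K => by
      have h1 : Tendsto (fun t => ENNReal.ofReal (K * |t - t₀|)) (𝓝[Icc 0 T] t₀) (𝓝 0) := by
        have : Continuous fun t => ENNReal.ofReal (K * |t - t₀|) :=
          ENNReal.continuous_ofReal.comp (by fun_prop)
        have h2 := (this.tendsto t₀).mono_left (nhdsWithin_le_nhds (s := Icc 0 T))
        simpa using h2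
      simpa using ENNReal.Tendsto.mul_const h1 (Or.inr hE2.2.ne)
    have hsum := (hlim K).add (hlim K')
    rw [add_zero] at hsum
    refine tendsto_of_tendsto_of_tendsto_of_le_of_le' tendsto_const_nhds hsum
      (Eventually.of_forall fun _ => zero_le) ?_
    filter_upwards [self_mem_nhdsWithin] with t ht
    exact add_le_add (hle hK0 hK t ht) (hle hK'0 hK' t ht)

/-- The forcing that drives the path `wavePath U c κ x₀`. -/
def wavePathForcing (F : ℝ → ℝ) (D : ℝ) (U : ℝ → ℝ) (c κ x₀ t x : ℝ) : ℝ :=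
  -c * deriv U (x - c * t) + κ * (U (x - x₀) - U x)
    + deriv F (wavePath U c κ x₀ t x) * wavePath (deriv U) c κ x₀ t x
    - D * wavePath (deriv (deriv U)) c κ x₀ t x

theorem exp_weight_translate {a : ℝ} (ha : 0 ≤ a) (B : ℝ) :
    ∃ C₀, ∀ b, |b| ≤ B → ∀ x, Real.exp (-(a * |x - b|)) ≤ C₀ * Real.exp (-(a * |x|)) :=
  ⟨_, fun _ hb => exp_neg_mul_abs_sub_le ha hb⟩

/-- Each term contains a derivative of U or an increment of U, whence the decay. The hypothesis `hv`
keeps the path where F is smooth; elsewhere F is only C². -/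
theorem derivBound_wavePathForcing {F U : ℝ → ℝ} {D um up c κ x₀ T : ℝ}
    (hF : IsAdmissibleFlux F) (hFs : ContDiffOn ℝ ∞ F (uIcc um up))
    (hU : IsViscousShock F D um up U) {a : ℝ} (ha : 0 < a)
    (hdb : ∀ n : ℕ, DerivBound (fun _ => 1) n (fun _ : Unit => U) ∧
      DerivBound (fun x => Real.exp (-(a * |x|))) n (fun _ : Unit => deriv U))
    (hv : ∀ t ∈ Icc 0 T, ∀ x, wavePath U c κ x₀ t x ∈ uIcc um up) (n : ℕ) :
    DerivBound (fun x => Real.exp (-(a * |x|))) n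
      fun t : Icc 0 T => wavePathForcing F D U c κ x₀ t := by
  have hE : ∀ x : ℝ, 0 ≤ Real.exp (-(a * |x|)) := fun x => (Real.exp_pos _).le
  have hUd : Differentiable ℝ U := (hdb 1).1.1 ()
  have hv1 : DerivBound (fun _ => 1) n fun t : Icc 0 T => wavePath U c κ x₀ t :=
    derivBound_wavePath (fun _ => zero_le_one) (fun B => ⟨1, fun _ _ _ => by simp⟩) (hdb n).1
  have hv2 : DerivBound _ n fun t : Icc 0 T => wavePath (deriv U) c κ x₀ t :=
    derivBound_wavePath hE (exp_weight_translate ha.le) (hdb n).2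
  have hv3 : DerivBound _ n fun t : Icc 0 T => wavePath (deriv (deriv U)) c κ x₀ t :=
    derivBound_wavePath hE (exp_weight_translate ha.le) (hdb (n + 1)).2.2.2
  have h1 := hv1.comp_left isCompact_uIcc hU.uniqueDiffOn (hU.contDiffOn_deriv hF hFs)
    fun t x => hv t t.2 x
  have h2 := h1.mul (fun _ => zero_le_one) hE hv2
  simp only [one_mul] at h2
  have h3 := hv3.const_mul (c := fun _ => -D) (M := |D|) (fun _ => by simp) hE
  obtain ⟨C₀, hC₀⟩ := exp_weight_translate ha.le (|c| * T)
  have h4 := ((hdb n).2.reindex fun _ : Icc 0 T => ()).comp_sub (a := fun t : Icc 0 T => c * t) hE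
    fun t x => hC₀ (c * t) (by
      rw [abs_mul, abs_of_nonneg t.2.1]
      exact mul_le_mul_of_nonneg_left t.2.2 (abs_nonneg c)) x
  have h5 := h4.const_mul (c := fun _ => -c) (M := |c|) (fun _ => by simp) hE
  have h6 := (derivBound_translate_sub (ι := Icc 0 T) ha.le hUd (hdb n).2 x₀).const_mul
    (c := fun _ => κ) (M := |κ|) (fun _ => le_rfl) hE
  have h7 := ((h5.add h6).add h2).add h3
  convert h7 using 3 with t x
  simp only [wavePathForcing]
  ring

theorem continuous_wavePathForcing {F U : ℝ → ℝ} {D c κ x₀ : ℝ} (hF : Continuous (deriv F))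
    (hU : Continuous U) (hU' : Continuous (deriv U)) (hU'' : Continuous (deriv (deriv U))) :
    Continuous (Function.uncurry (wavePathForcing F D U c κ x₀)) := by
  simp only [Function.uncurry_def, wavePathForcing, wavePath]
  fun_prop

theorem derivBound_inv_envelope {φ₀ : ℝ → ℝ} (hφ₀ : IsEnvelope φ₀) (σ L : ℝ) {ι : Type*} (n : ℕ) :
    ∃ k : ℕ, DerivBound (fun x => (1 + |x|) ^ k) n
      fun (_ : ι) x => 1 / (σ * φ₀ (x / L)) := by
  have h1 : Function.HasTemperateGrowth (fun x : ℝ => x / L) := by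
    simp only [div_eq_mul_inv]
    exact Function.HasTemperateGrowth.id'.mul (Function.HasTemperateGrowth.const L⁻¹)
  have h2 : Function.HasTemperateGrowth (fun x => 1 / (σ * φ₀ (x / L))) := by
    have := (Function.HasTemperateGrowth.const (1 / σ)).mul (hφ₀.inv_growth.comp h1)
    have e : (fun x => 1 / (σ * φ₀ (x / L))) = fun x => 1 / σ * (1 / φ₀ (x / L)) :=
      funext fun x => by rw [div_mul_div_comm, one_mul]
    rw [e]
    exact this
  exact derivBound_of_hasTemperateGrowth h2 n

theorem integrable_timeGaussian_of_bound {G : ℝ → ℝ → ℝ} {D T t x M : ℝ} (ht : t ≤ T)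
    (hG : Continuous (Function.uncurry G)) (hM : ∀ s ∈ Icc 0 T, ∀ y, |G s y| ≤ M) :
    Integrable (fun p : ℝ × ℝ => G p.1 (x + Real.sqrt (2 * D * (t - p.1)) * p.2))
      (timeGaussian t) := by
  have hc : Continuous fun p : ℝ × ℝ => G p.1 (x + Real.sqrt (2 * D * (t - p.1)) * p.2) :=
    hG.comp (by fun_prop : Continuous fun p : ℝ × ℝ =>
      (p.1, x + Real.sqrt (2 * D * (t - p.1)) * p.2))
  have hIcc : ∀ᵐ p ∂(timeGaussian t), p.1 ∈ Icc 0 t :=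
    Measure.quasiMeasurePreserving_fst.ae (ae_restrict_mem measurableSet_Icc)
  exact Integrable.of_bound hc.aestronglyMeasurable M
    (hIcc.mono fun p hp => hM _ ⟨hp.1, hp.2.trans ht⟩ _)

/-- `wavePath U c κ x₀` is the mild solution that is driven by its forcing. -/
theorem isMildSolution_wavePath {F U : ℝ → ℝ} {D um up c κ x₀ T : ℝ} {Φ : ℝ → ℝ → ℝ}
    {h : ℝ → ℝ → ℝ} (hF : IsAdmissibleFlux F) (hFs : ContDiffOn ℝ ∞ F (uIcc um up)) (hD : 0 < D)
    (hU : IsViscousShock F D um up U) (hγ : shockSpeed F um up = 0)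
    (hv : ∀ t ∈ Icc 0 T, ∀ x, wavePath U c κ x₀ t x ∈ uIcc um up)
    (hker : ∀ s ∈ Icc 0 T, kernelOp Φ (h s) = wavePathForcing F D U c κ x₀ s) :
    IsMildSolution F D T U Φ h (wavePath U c κ x₀) := by
  obtain ⟨a, ha, hdb⟩ := hU.exists_derivBound hγ hF hFs hD
  have hE : ∀ b x : ℝ, 0 ≤ Real.exp (-(b * |x|)) := fun b x => (Real.exp_pos _).le
  have hUd : Differentiable ℝ U := (hdb 1).1.1 ()
  have hU'd : Differentiable ℝ (deriv U) := (hdb 1).2.1 ()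
  have hU''d : Differentiable ℝ (deriv (deriv U)) := (hdb 2).2.2.2.1 ()
  have hFc : Continuous (deriv F) := hF.contDiff_deriv.continuous
  set g := wavePathForcing F D U c κ x₀ with hg
  have hgdb := derivBound_wavePathForcing hF hFs hU ha hdb hv
  have hgc : Continuous (Function.uncurry g) :=
    continuous_wavePathForcing hFc hUd.continuous hU'd.continuous hU''d.continuous
  have hE1 : MemE1 T U (wavePath U c κ x₀) := memE1_wavePath ha hUd (hdb 1).2
  have hvc := continuous_wavePath hUd.continuous c κ x₀
  have hv'c := continuous_wavePath hU'd.continuous c κ x₀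
  have hv''c := continuous_wavePath hU''d.continuous c κ x₀
  have hvd := hasDerivAt_wavePath (fun x => (hUd x).hasDerivAt) c κ x₀
  have hv'd := hasDerivAt_wavePath (fun x => (hU'd x).hasDerivAt) c κ x₀
  set vt : ℝ → ℝ → ℝ := fun t x => -c * deriv U (x - c * t) + κ * (U (x - x₀) - U x) with hvt
  have hvtc : Continuous (Function.uncurry vt) := by
    have := hUd.continuous
    have := hU'd.continuous
    simp only [hvt, Function.uncurry_def]
    fun_prop
  set N : ℝ → ℝ → ℝ := fun s x =>
    deriv F (wavePath U c κ x₀ s x) * wavePath (deriv U) c κ x₀ s x with hN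
  have hNc : Continuous (Function.uncurry N) := (hFc.comp hvc).mul hv'c
  refine ⟨hE1, N, fun s hs => ?_, fun t ht => ae_of_all _ fun x => ?_⟩
  · exact isWeakDeriv_of_hasDerivAt
      (fun x => (hF.differentiable _).hasDerivAt.comp x (hvd s x))
      (hNc.comp (by fun_prop : Continuous fun y : ℝ => (s, y)))
  -- bounds on the path and its derivatives
  have hEle : ∀ x : ℝ, Real.exp (-(a * |x|)) ≤ 1 := fun x => Real.exp_le_one_iff.2 (by
    simp only [Left.neg_nonpos_iff]; positivity)
  have hbd : ∀ {f : ℝ → ℝ → ℝ} {ρ : ℝ → ℝ}, (∀ x, 0 ≤ ρ x) → (∀ x, ρ x ≤ 1) →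
      DerivBound ρ 0 (fun t : Icc 0 T => f t) → ∃ M, ∀ s ∈ Icc 0 T, ∀ x, |f s x| ≤ M := by
    intro f ρ h0 h1 hf
    obtain ⟨C, hC⟩ := hf.bound
    refine ⟨|C|, fun s hs x => (hC ⟨s, hs⟩ x).trans ?_⟩
    calc C * ρ x ≤ |C| * 1 :=
          mul_le_mul (le_abs_self C) (h1 x) (h0 x) (abs_nonneg C)
      _ = _ := mul_one _
  obtain ⟨M₀, hM₀⟩ := hbd (f := wavePath U c κ x₀) (fun _ => zero_le_one) (fun _ => le_rfl)
    (derivBound_wavePath (fun _ => zero_le_one) (fun B => ⟨1, fun _ _ _ => by simp⟩) (hdb 0).1)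
  obtain ⟨M₁, hM₁⟩ := hbd (f := wavePath (deriv U) c κ x₀) (hE a) hEle
    (derivBound_wavePath (hE a) (exp_weight_translate ha.le) (hdb 0).2)
  obtain ⟨M₂, hM₂⟩ := hbd (f := wavePath (deriv (deriv U)) c κ x₀) (hE a) hEle
    (derivBound_wavePath (hE a) (exp_weight_translate ha.le) (hdb 1).2.2.2)
  obtain ⟨M₃, hM₃⟩ := hbd (f := g) (hE a) hEle (hgdb 0)
  obtain ⟨L₀, hL₀, -⟩ := hF.exists_lipschitz
  have hNM : ∀ s ∈ Icc 0 T, ∀ x, |N s x| ≤ L₀ * M₁ := fun s hs x => by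
    rw [hN, abs_mul]
    exact mul_le_mul (hL₀ _) (hM₁ s hs x) (abs_nonneg _) L₀.coe_nonneg
  -- The equation expresses the time derivative through terms that are already bounded.
  have hge : ∀ s x, vt s x = g s x - N s x + D * wavePath (deriv (deriv U)) c κ x₀ s x :=
    fun s x => by simp only [hg, hvt, hN, wavePathForcing]; ring
  have hvtM : ∀ s ∈ Icc 0 T, ∀ x, |vt s x| ≤ M₃ + L₀ * M₁ + D * M₂ := fun s hs x => by
    rw [hge]
    refine (abs_add_le _ _).trans (add_le_add ((abs_sub _ _).trans
      (add_le_add (hM₃ s hs x) (hNM s hs x))) ?_)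
    rw [abs_mul, abs_of_pos hD]
    exact mul_le_mul_of_nonneg_left (hM₂ s hs x) hD.le
  have hduh := duhamel (T := T) (M := max (max M₀ (M₃ + L₀ * M₁ + D * M₂)) (max M₁ M₂)) hD
    (v := wavePath U c κ x₀) (vt := vt) (vx := wavePath (deriv U) c κ x₀)
    (vxx := wavePath (deriv (deriv U)) c κ x₀)
    (fun y y' s hy => by
      have e1 := (hUd (y s - c * s)).hasDerivAt.comp s (hy.sub ((hasDerivAt_id s).const_mul c))
      have e2 := (hUd (y s - x₀)).hasDerivAt.comp s (hy.sub_const x₀)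
      have e3 := (hUd (y s)).hasDerivAt.comp s hy
      have e4 := e1.add (((hasDerivAt_id s).const_mul κ).mul (e2.sub e3))
      convert! e4 using 1
      simp only [hvt, wavePath, id, Pi.sub_apply, Function.comp_apply]
      ring)
    hv'd hvc hvtc hv'c hv''c
    (fun s hs x => (hM₀ s hs x).trans ((le_max_left _ _).trans (le_max_left _ _)))
    (fun s hs x => (hvtM s hs x).trans ((le_max_right _ _).trans (le_max_left _ _)))
    (fun s hs x => (hM₁ s hs x).trans ((le_max_left _ _).trans (le_max_right _ _)))
    (fun s hs x => (hM₂ s hs x).trans ((le_max_right _ _).trans (le_max_right _ _))) ht x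
  have hv0 : wavePath U c κ x₀ 0 = U := by ext y; simp [wavePath]
  have hdiff : (fun (s y : ℝ) => vt s y - D * wavePath (deriv (deriv U)) c κ x₀ s y)
      = fun s y => g s y - N s y := by
    ext s y; rw [hge]; ring
  have hgi := integrable_timeGaussian_of_bound (D := D) (x := x) ht.2 hgc hM₃
  have hNi := integrable_timeGaussian_of_bound (D := D) (x := x) ht.2 hNc hNM
  have hdiff' : ∀ s, (fun y => vt s y - D * wavePath (deriv (deriv U)) c κ x₀ s y)
      = fun y => g s y - N s y := congrFun hdiff
  simp only [hdiff'] at hduh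
  rw [hduh, hv0, integral_heatSemigroup_eq (G := fun s y => g s y - N s y) hD ht.1 (hgi.sub hNi),
    integral_sub hgi hNi, ← integral_heatSemigroup_eq hD ht.1 hgi,
    ← integral_heatSemigroup_eq hD ht.1 hNi]
  have hk2 : ∫ s in (0 : ℝ)..t, heatSemigroup D (t - s) (kernelOp (Φ) (h s)) x
      = ∫ s in (0 : ℝ)..t, heatSemigroup D (t - s) (g s) x :=
    integral_heatSemigroup_congr ht.1 ((ae_restrict_mem measurableSet_Icc).mono fun s hs => by
      rw [hker s ⟨hs.1, hs.2.trans ht.2⟩])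
  rw [hk2]
  ring

/-- The cost of a displacement is at most that of the path `wavePath U c κ x₀`. -/
theorem eventually_infRate_le {F U φ₀ φ₁ : ℝ → ℝ} {D um up c κ x₀ T σ L : ℝ}
    (hF : IsAdmissibleFlux F) (hFs : ContDiffOn ℝ ∞ F (uIcc um up)) (hD : 0 < D)
    (hU : IsViscousShock F D um up U) (hγ : shockSpeed F um up = 0) (hσ : 0 < σ)
    (hφ₀ : IsEnvelope φ₀) (hφ₁ : IsCorrelationProfile φ₁)
    (hv : ∀ t ∈ Icc 0 T, ∀ x, wavePath U c κ x₀ t x ∈ uIcc um up)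
    (hvT : ∀ x, wavePath U c κ x₀ T x = U (x - x₀)) {K : ℝ≥0∞}
    (hK : (1 / 2) * ∫⁻ t in Icc 0 T, ∫⁻ x, ENNReal.ofReal
      ((wavePathForcing F D U c κ x₀ t x * (1 / (σ * φ₀ (x / L)))) ^ 2) < K) :
    ∀ᶠ lc in 𝓝[>] (0 : ℝ),
      infRate F D T U (noiseKernel σ L lc φ₀ φ₁) (displacementEvent T 0 x₀ U) ≤ K := by
  obtain ⟨a, ha, hdb⟩ := hU.exists_derivBound hγ hF hFs hD
  have hE : ∀ b x : ℝ, 0 ≤ Real.exp (-(b * |x|)) := fun b x => (Real.exp_pos _).le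
  have hUd : Differentiable ℝ U := (hdb 1).1.1 ()
  have hU'd : Differentiable ℝ (deriv U) := (hdb 1).2.1 ()
  have hU''d : Differentiable ℝ (deriv (deriv U)) := (hdb 2).2.2.2.1 ()
  have hFc : Continuous (deriv F) := hF.contDiff_deriv.continuous
  set g := wavePathForcing F D U c κ x₀ with hg
  have hgdb := derivBound_wavePathForcing hF hFs hU ha hdb hv
  have hgc : Continuous (Function.uncurry g) :=
    continuous_wavePathForcing hFc hUd.continuous hU'd.continuous hU''d.continuous
  set w : ℝ → ℝ → ℝ := fun t x => g t x * (1 / (σ * φ₀ (x / L))) with hw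
  -- Division by the envelope costs a polynomial factor, hence half of the rate.
  have hwdb : ∀ n, DerivBound (fun x => Real.exp (-(a / 2 * |x|))) n fun t : Icc 0 T => w t := by
    intro n
    obtain ⟨k, hk⟩ := derivBound_inv_envelope hφ₀ σ L (ι := Icc 0 T) n
    obtain ⟨C, hC⟩ := exists_pow_mul_exp_le ha k
    refine DerivBound.mono (C₀ := C) (fun x => mul_nonneg (hE a x) (by positivity)) (fun x => ?_)
      ((hgdb n).mul (hE a) (fun x => by positivity) hk)
    rw [mul_comm]
    exact hC x
  have hφne : ∀ x, σ * φ₀ (x / L) ≠ 0 := fun x => mul_ne_zero hσ.ne' (hφ₀.pos _).ne'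
  have hwc : Continuous (Function.uncurry w) := by
    have h1 : Continuous fun p : ℝ × ℝ => 1 / (σ * φ₀ (p.2 / L)) := by
      have := hφ₀.smooth.continuous
      exact continuous_const.div (by fun_prop) fun p => hφne _
    exact hgc.mul h1
  obtain ⟨C, hC⟩ := (hwdb 0).bound
  have hi := integrable_exp_neg_mul_abs (half_pos ha)
  have hm := memLp_two_of_abs_le_exp (f := fun x => C * Real.exp (-(a / 2 * |x|))) (C := |C|)
    (half_pos ha) (by fun_prop) fun x => by rw [abs_mul, abs_of_pos (Real.exp_pos _)]
  filter_upwards [eventually_exists_control hφ₁ hwc (hi.const_mul C) hm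
    (fun t ht x => hC ⟨t, ht⟩ x) (fun n => by
      obtain ⟨C', hC'⟩ := (hwdb n).fourier_decay hi
      exact ⟨C', fun t ht ξ => hC' ⟨t, ht⟩ ξ⟩) hK] with lc hlc
  obtain ⟨h, hhc, hhK, hh⟩ := hlc
  have hmem : wavePath U c κ x₀ ∈ displacementEvent T 0 x₀ U :=
    ⟨memE1_wavePath ha hUd (hdb 1).2, ae_of_all _ fun x => by simp [wavePath],
      ae_of_all _ fun x => by simpa using hvT x⟩
  have hker : ∀ s ∈ Icc 0 T, kernelOp (noiseKernel σ L lc φ₀ φ₁) (h s) = g s := fun s hs => by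
    ext y
    have h1 := hh s hs y
    have h2 : kernelOp (noiseKernel σ L lc φ₀ φ₁) (h s) y
        = σ * φ₀ (y / L) * ∫ x', 1 / lc * φ₁ ((y - x') / lc) * h s x' := by
      rw [← integral_const_mul]
      refine integral_congr_ae (ae_of_all _ fun x' => ?_)
      simp only [noiseKernel]; ring
    rw [h2, h1]
    simp only [hw]
    rw [mul_left_comm, mul_one_div_cancel (hφne y), mul_one]
  exact (iInf₂_le _ hmem).trans ((iInf_le _ h).trans
    ((iInf₂_le hhc (isMildSolution_wavePath hF hFs hD hU hγ hv hker)).trans hhK))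

/-! ### The costs of translation and of interpolation. -/

theorem half_lintegral_sq_le {w : ℝ → ℝ → ℝ} {T V : ℝ} (hV : 0 ≤ V)
    (hw : ∀ t ∈ Icc 0 T, ∃ H : ℝ → ℝ, Integrable H ∧ (∀ x, w t x ^ 2 ≤ H x) ∧ ∫ x, H x ≤ V) :
    (1 / 2) * ∫⁻ t in Icc 0 T, ∫⁻ x, ENNReal.ofReal (w t x ^ 2) ≤ ENNReal.ofReal (V * T) := by
  calc (1 / 2) * ∫⁻ t in Icc 0 T, ∫⁻ x, ENNReal.ofReal (w t x ^ 2)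
      ≤ 1 * ∫⁻ _ in Icc 0 T, ENNReal.ofReal V := by
        gcongr ?_ * ?_
        · simp
        · refine setLIntegral_mono measurable_const fun t ht => ?_
          obtain ⟨H, hHi, hwH, hHV⟩ := hw t ht
          calc ∫⁻ x, ENNReal.ofReal (w t x ^ 2) ≤ ∫⁻ x, ENNReal.ofReal (H x) :=
                lintegral_mono fun x => ENNReal.ofReal_le_ofReal (hwH x)
            _ = ENNReal.ofReal (∫ x, H x) := (ofReal_integral_eq_lintegral_ofReal hHi
                (ae_of_all _ fun x => (sq_nonneg _).trans (hwH x))).symm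
            _ ≤ _ := ENNReal.ofReal_le_ofReal hHV
    _ = _ := by simp [ENNReal.ofReal_mul hV]

/-- The function f + (C/a) e^{-ax} is nonincreasing on [0, ∞) and so stays above its limit e. -/
theorem sub_le_of_deriv_le_exp {f : ℝ → ℝ} {a C e : ℝ} (ha : 0 < a) (hf : Differentiable ℝ f)
    (hC : ∀ x, 0 ≤ x → deriv f x ≤ C * Real.exp (-(a * x))) (hlim : Tendsto f atTop (𝓝 e)) {x : ℝ}
    (hx : 0 ≤ x) : e - f x ≤ C / a * Real.exp (-(a * x)) := by
  set p : ℝ → ℝ := fun x => f x + C / a * Real.exp (-(a * x)) with hp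
  have hd : ∀ x, HasDerivAt p (deriv f x - C * Real.exp (-(a * x))) x := fun x => by
    have h1 : HasDerivAt (fun x => Real.exp (-(a * x))) (Real.exp (-(a * x)) * -a) x := by
      simpa using (((hasDerivAt_id x).const_mul a).neg).exp
    convert! (hf x).hasDerivAt.add (h1.const_mul (C / a)) using 1
    field_simp
    ring
  have hanti : AntitoneOn p (Ici 0) := by
    refine antitoneOn_of_deriv_nonpos (convex_Ici 0)
      (fun x _ => (hd x).continuousAt.continuousWithinAt)
      (fun x _ => (hd x).differentiableAt.differentiableWithinAt) fun x hx => ?_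
    rw [interior_Ici] at hx
    rw [(hd x).deriv]
    linarith [hC x (le_of_lt hx)]
  have hplim : Tendsto p atTop (𝓝 (e + C / a * 0)) := by
    refine hlim.add (Tendsto.const_mul _ ?_)
    exact Real.tendsto_exp_neg_atTop_nhds_zero.comp (tendsto_id.const_mul_atTop ha)
  have h := le_of_tendsto hplim ((eventually_ge_atTop x).mono fun y hy =>
    hanti (mem_Ici.2 hx) (mem_Ici.2 (hx.trans hy)) hy)
  simp only [hp] at h
  linarith

theorem abs_sub_le_of_abs_deriv_le_exp {f : ℝ → ℝ} {a C e : ℝ} (ha : 0 < a)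
    (hf : Differentiable ℝ f) (hC : ∀ x, |deriv f x| ≤ C * Real.exp (-(a * |x|)))
    (hlim : Tendsto f atTop (𝓝 e)) {x : ℝ} (hx : 0 ≤ x) :
    |f x - e| ≤ C / a * Real.exp (-(a * |x|)) := by
  have hC' : ∀ x, 0 ≤ x → |deriv f x| ≤ C * Real.exp (-(a * x)) := fun x hx => by
    have := hC x
    rwa [abs_of_nonneg hx] at this
  rw [abs_of_nonneg hx, abs_le]
  constructor
  · linarith [sub_le_of_deriv_le_exp ha hf (fun x hx => (le_abs_self _).trans (hC' x hx)) hlim hx]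
  · have := sub_le_of_deriv_le_exp (f := fun x => -f x) ha hf.neg
      (fun x hx => by
        rw [deriv.fun_neg]; exact (neg_le_abs _).trans (hC' x hx)) hlim.neg hx
    linarith

/-- Outside [0, x₀] both arguments lie on the same side of the origin, so both values are
exponentially close to the same end state; inside, the jump bounds the difference. The constants do
not depend on x₀. -/
theorem abs_translate_sub_le {U : ℝ → ℝ} {a C um up x₀ : ℝ} (ha : 0 < a)
    (hU : Differentiable ℝ U) (hC : ∀ x, |deriv U x| ≤ C * Real.exp (-(a * |x|)))
    (hl : Tendsto U atBot (𝓝 um)) (hr : Tendsto U atTop (𝓝 up)) (hI : ∀ x, U x ∈ uIcc um up)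
    (hx₀ : 0 ≤ x₀) (x : ℝ) :
    |U (x - x₀) - U x| ≤ (Icc 0 x₀).indicator (fun _ => |um - up|) x
      + C / a * (Real.exp (-(a * |x|)) + Real.exp (-(a * |x - x₀|))) := by
  have hC0 : 0 ≤ C := by
    have := (abs_nonneg _).trans (hC 0)
    simpa using this
  have htr := fun {x : ℝ} (hx : 0 ≤ x) => abs_sub_le_of_abs_deriv_le_exp ha hU hC hr hx
  have htl : ∀ {x : ℝ}, x ≤ 0 → |U x - um| ≤ C / a * Real.exp (-(a * |x|)) := fun {x} hx => by
    have := abs_sub_le_of_abs_deriv_le_exp (f := fun x => U (-x)) ha (by fun_prop)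
      (fun x => by
        rw [deriv_comp_neg, abs_neg]
        simpa using hC (-x)) (hl.comp tendsto_neg_atTop_atBot) (neg_nonneg.2 hx)
    simpa using this
  rcases lt_or_ge x 0 with h | h
  · have h1 := htl (x := x - x₀) (by linarith)
    have h2 := htl h.le
    rw [indicator_of_notMem fun hm => absurd hm.1 (not_le.2 h)]
    have h3 := abs_sub (U (x - x₀) - um) (U x - um)
    rw [sub_sub_sub_cancel_right] at h3
    linarith
  rcases le_or_gt x x₀ with h' | h'
  · rw [indicator_of_mem (show x ∈ Icc 0 x₀ from ⟨h, h'⟩)]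
    have h1 : |U (x - x₀) - U x| ≤ |um - up| := Real.dist_le_of_mem_uIcc (hI _) (hI _)
    have h2 : 0 ≤ C / a * (Real.exp (-(a * |x|)) + Real.exp (-(a * |x - x₀|))) := by positivity
    linarith
  · have h1 := htr (x := x - x₀) (by linarith)
    have h2 := htr h
    rw [indicator_of_notMem fun hm => absurd hm.2 (not_le.2 h')]
    have h3 := abs_sub (U (x - x₀) - up) (U x - up)
    rw [sub_sub_sub_cancel_right] at h3
    linarith

theorem IsEnvelope.exists_inv_le {φ₀ : ℝ → ℝ} (h : IsEnvelope φ₀) :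
    ∃ (A : ℝ) (k : ℕ), 0 ≤ A ∧ ∀ x, 1 / φ₀ x ≤ A * (1 + |x|) ^ k := by
  obtain ⟨k, hk⟩ := derivBound_of_hasTemperateGrowth (ι := Unit) h.inv_growth 0
  obtain ⟨A, hA⟩ := hk.bound
  refine ⟨A, k, ?_, fun x => (le_abs_self _).trans (hA () x)⟩
  have := (abs_nonneg _).trans (hA () 0)
  simpa using this

theorem integrable_exp_neg_mul_abs_sq {b : ℝ} (hb : 0 < b) :
    Integrable fun x : ℝ => Real.exp (-(b * |x|)) ^ 2 := by
  refine (integrable_exp_neg_mul_abs (mul_pos two_pos hb)).congr (ae_of_all _ fun x => ?_)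
  simp only
  rw [sq, ← Real.exp_add]
  congr 1
  ring

/-- The cost of moving the wave with constant speed. -/
theorem exists_translation_cost_le {F U φ₀ : ℝ → ℝ} {D um up σ : ℝ}
    (hF : IsAdmissibleFlux F) (hFs : ContDiffOn ℝ ∞ F (uIcc um up)) (hD : 0 < D)
    (hU : IsViscousShock F D um up U) (hγ : shockSpeed F um up = 0) (hσ : 0 < σ)
    (hφ₀ : IsEnvelope φ₀) :
    ∃ (K : ℝ) (k : ℕ), 0 < K ∧ ∀ x₀ T L : ℝ, 0 ≤ x₀ → 0 < T → 1 ≤ L →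
      (1 / 2) * ∫⁻ t in Icc 0 T, ∫⁻ x, ENNReal.ofReal
        ((wavePathForcing F D U (x₀ / T) 0 x₀ t x * (1 / (σ * φ₀ (x / L)))) ^ 2)
        ≤ ENNReal.ofReal (K * (1 + x₀) ^ k * (x₀ ^ 2 / T)) := by
  obtain ⟨a, ha, hdb⟩ := hU.exists_derivBound hγ hF hFs hD
  obtain ⟨C, hC⟩ := (hdb 0).2.bound
  replace hC := fun x => hC () x
  have hC0 : 0 ≤ C := by
    have := (abs_nonneg _).trans (hC 0)
    simpa using this
  obtain ⟨A, k, hA, hAk⟩ := hφ₀.exists_inv_le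
  obtain ⟨B, hB⟩ := exists_pow_mul_exp_le ha k
  have hB0 : 0 ≤ B := by
    have := (mul_nonneg (by positivity) (Real.exp_pos _).le).trans (hB 0)
    simpa using this
  set R : ℝ → ℝ := fun x => Real.exp (-(a / 2 * |x|)) with hR
  have hR2 : Integrable fun x => R x ^ 2 := integrable_exp_neg_mul_abs_sq (half_pos ha)
  set J := ∫ x, R x ^ 2 with hJ
  have hJ0 : 0 ≤ J := integral_nonneg fun x => sq_nonneg _
  refine ⟨(C * (1 / σ * A * B)) ^ 2 * J + 1, 2 * k, by positivity, fun x₀ T L hx₀ hT hL => ?_⟩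
  set V := (x₀ / T * (C * (1 / σ * A * B)) * (1 + x₀) ^ k) ^ 2 * J with hV
  refine (half_lintegral_sq_le (V := V) (by positivity) fun t ht =>
    ⟨fun x => (x₀ / T * (C * (1 / σ * A * B)) * (1 + x₀) ^ k) ^ 2 * R (x - x₀ / T * t) ^ 2,
      (hR2.comp_sub_right (x₀ / T * t)).const_mul _, fun x => ?_, ?_⟩).trans
    (ENNReal.ofReal_le_ofReal ?_)
  · have hct : |x₀ / T * t| ≤ x₀ := by
      rw [abs_of_nonneg (mul_nonneg (by positivity) ht.1), div_mul_eq_mul_div,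
        div_le_iff₀ hT]
      exact mul_le_mul_of_nonneg_left ht.2 hx₀
    set y := x - x₀ / T * t with hy
    -- Flux and viscosity balance along any translate of the stationary profile, so only the time
    -- derivative needs forcing.
    have hg : wavePathForcing F D U (x₀ / T) 0 x₀ t x = -(x₀ / T) * deriv U y := by
      simp only [wavePathForcing, wavePath, zero_mul, add_zero]
      rw [← hy, (hU.hasDerivAt_deriv hγ hF y).deriv]
      field_simp
      ring
    -- Recentering the polynomial weight at the moving wave is the source of the factor (1 + x₀)^k.
    have hxy : 1 + |x / L| ≤ (1 + x₀) * (1 + |y|) := by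
      have h1 : |x / L| ≤ |x| := by
        rw [abs_div, abs_of_pos (by linarith : 0 < L)]
        exact div_le_self (abs_nonneg _) hL
      have h2 : |x| ≤ |y| + |x₀ / T * t| := by
        simpa [hy] using abs_add_le y (x₀ / T * t)
      nlinarith [mul_nonneg hx₀ (abs_nonneg y)]
    have hinv : 1 / (σ * φ₀ (x / L)) ≤ 1 / σ * (A * ((1 + x₀) * (1 + |y|)) ^ k) := by
      rw [← one_div_mul_one_div]
      refine mul_le_mul_of_nonneg_left ((hAk _).trans ?_) (by positivity)
      gcongr
    have hmain : |wavePathForcing F D U (x₀ / T) 0 x₀ t x * (1 / (σ * φ₀ (x / L)))|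
        ≤ x₀ / T * (C * (1 / σ * A * B)) * (1 + x₀) ^ k * R y := by
      have hφp : 0 < 1 / (σ * φ₀ (x / L)) := by have := hφ₀.pos (x / L); positivity
      rw [hg, abs_mul, abs_mul, abs_neg, abs_of_nonneg (by positivity : 0 ≤ x₀ / T),
        abs_of_pos hφp]
      calc x₀ / T * |deriv U y| * (1 / (σ * φ₀ (x / L)))
          ≤ x₀ / T * (C * Real.exp (-(a * |y|)))
            * (1 / σ * (A * ((1 + x₀) * (1 + |y|)) ^ k)) := by
            gcongr
            exact hC y
        _ = x₀ / T * (C * (1 / σ * A)) * (1 + x₀) ^ k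
            * ((1 + |y|) ^ k * Real.exp (-(a * |y|))) := by rw [mul_pow]; ring
        _ ≤ x₀ / T * (C * (1 / σ * A)) * (1 + x₀) ^ k * (B * R y) := by
            exact mul_le_mul_of_nonneg_left (hB y) (by positivity)
        _ = _ := by ring
    have h := sq_le_sq' (abs_le.1 hmain).1 (abs_le.1 hmain).2
    rwa [mul_pow _ (R y)] at h
  · rw [integral_const_mul, integral_sub_right_eq_self (fun x => R x ^ 2)]
  · have e1 : V * T = (C * (1 / σ * A * B)) ^ 2 * J * (1 + x₀) ^ (2 * k) * (x₀ ^ 2 / T) := by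
      rw [hV, pow_mul, ← pow_mul, mul_comm 2 k, pow_mul]
      field_simp
    rw [e1]
    gcongr
    linarith

theorem abs_interpolate_le {θ p q : ℝ} (h0 : 0 ≤ θ) (h1 : θ ≤ 1) :
    |p + θ * (q - p)| ≤ |p| + |q| := by
  have e : p + θ * (q - p) = (1 - θ) * p + θ * q := by ring
  rw [e]
  refine (abs_add_le _ _).trans ?_
  rw [abs_mul, abs_mul, abs_of_nonneg h0, abs_of_nonneg (sub_nonneg.2 h1)]
  nlinarith [abs_nonneg p, abs_nonneg q]

/-- The time derivative is (U(· - x₀) - U)/T, a plateau on [0, x₀] with exponential tails. Flux and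
viscosity contain derivatives of U, localized at the fronts 0 and x₀, and do not shrink with 1/T.
That `G` depends on neither x₀ nor T is the point. -/
theorem exists_abs_interpolation_forcing_le {F U : ℝ → ℝ} {D um up a : ℝ}
    (hF : IsAdmissibleFlux F) (hD : 0 < D)
    (hU : IsViscousShock F D um up U) (hγ : shockSpeed F um up = 0) (ha : 0 < a)
    (hdb : ∀ n : ℕ, DerivBound (fun _ => 1) n (fun _ : Unit => U) ∧
      DerivBound (fun x => Real.exp (-(a * |x|))) n (fun _ : Unit => deriv U)) :
    ∃ G : ℝ, 0 ≤ G ∧ ∀ x₀ T : ℝ, 0 ≤ x₀ → 0 < T → ∀ t ∈ Icc 0 T, ∀ x,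
      |wavePathForcing F D U 0 (1 / T) x₀ t x|
        ≤ 1 / T * (Icc 0 x₀).indicator (fun _ => |um - up|) x
          + (1 + 1 / T) * G * (Real.exp (-(a * |x|)) + Real.exp (-(a * |x - x₀|))) := by
  have hUd : Differentiable ℝ U := (hdb 1).1.1 ()
  obtain ⟨C, hC⟩ := (hdb 0).2.bound
  obtain ⟨C', hC'⟩ := (hdb 1).2.2.2.bound
  replace hC := fun x => hC () x
  replace hC' := fun x => hC' () x
  have hC0 : 0 ≤ C := by
    have := (abs_nonneg _).trans (hC 0)
    simpa using this
  have hC'0 : 0 ≤ C' := by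
    have := (abs_nonneg _).trans (hC' 0)
    simpa using this
  obtain ⟨N, hN, -⟩ := hF.exists_lipschitz
  set E : ℝ → ℝ := fun x => Real.exp (-(a * |x|)) with hE
  have hE0 : ∀ x, 0 < E x := fun x => Real.exp_pos _
  set G := C / a + (N * C + D * C') with hG
  refine ⟨G, by positivity, fun x₀ T hx₀ hT t ht x => ?_⟩
  have hθ0 : 0 ≤ 1 / T * t := mul_nonneg (by positivity) ht.1
  have hθ1 : 1 / T * t ≤ 1 := by
    rw [one_div_mul_eq_div, div_le_one hT]; exact ht.2
  set I : ℝ → ℝ := (Icc 0 x₀).indicator (fun _ => |um - up|) with hI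
  have h1 := abs_translate_sub_le ha hUd hC hU.tendsto_left hU.tendsto_right
    (hU.mem_uIcc hγ hF) hx₀ x
  have h2 : |wavePath (deriv U) 0 (1 / T) x₀ t x| ≤ C * (E x + E (x - x₀)) := by
    simp only [wavePath, zero_mul, sub_zero]
    refine (abs_interpolate_le hθ0 hθ1).trans ?_
    rw [mul_add]
    exact add_le_add (hC _) (hC _)
  have h3 : |wavePath (deriv (deriv U)) 0 (1 / T) x₀ t x| ≤ C' * (E x + E (x - x₀)) := by
    simp only [wavePath, zero_mul, sub_zero]
    refine (abs_interpolate_le hθ0 hθ1).trans ?_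
    rw [mul_add]
    exact add_le_add (hC' _) (hC' _)
  set S := E x + E (x - x₀) with hS
  have hS0 : 0 ≤ S := add_nonneg (hE0 _).le (hE0 _).le
  have e : wavePathForcing F D U 0 (1 / T) x₀ t x = 1 / T * (U (x - x₀) - U x)
      + deriv F (wavePath U 0 (1 / T) x₀ t x) * wavePath (deriv U) 0 (1 / T) x₀ t x
      - D * wavePath (deriv (deriv U)) 0 (1 / T) x₀ t x := by
    simp only [wavePathForcing]; ring
  rw [e]
  calc _ ≤ |1 / T * (U (x - x₀) - U x)|
        + |deriv F (wavePath U 0 (1 / T) x₀ t x) * wavePath (deriv U) 0 (1 / T) x₀ t x|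
        + |D * wavePath (deriv (deriv U)) 0 (1 / T) x₀ t x| :=
        (abs_sub _ _).trans (add_le_add (abs_add_le _ _) le_rfl)
    _ ≤ 1 / T * (I x + C / a * S) + N * (C * S) + D * (C' * S) := by
        rw [abs_mul, abs_mul, abs_mul, abs_of_pos hD,
          abs_of_nonneg (by positivity : 0 ≤ 1 / T)]
        gcongr
        exact hN _
    _ ≤ 1 / T * I x + (1 + 1 / T) * G * S := by
        have h4 : 0 ≤ C / a * S := by positivity
        have h5 : 0 ≤ 1 / T * ((N * C + D * C') * S) := by positivity
        have e2 : 1 / T * I x + (1 + 1 / T) * G * S = 1 / T * (I x + C / a * S) + N * (C * S)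
          + D * (C' * S) + C / a * S + 1 / T * ((N * C + D * C') * S) := by rw [hG]; ring
        rw [e2]
        linarith

theorem sq_le_three_mul_of_abs_le {w p q r : ℝ} (h : |w| ≤ p + q + r) :
    w ^ 2 ≤ 3 * p ^ 2 + 3 * q ^ 2 + 3 * r ^ 2 := by
  have h1 := sq_le_sq' (abs_le.1 h).1 (abs_le.1 h).2
  nlinarith [sq_nonneg (p - q), sq_nonneg (p - r), sq_nonneg (q - r)]

/-- The cost of interpolating linearly between the initial and the displaced wave. -/
theorem exists_interpolation_cost_le {F U φ₀ : ℝ → ℝ} {D um up σ : ℝ}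
    (hF : IsAdmissibleFlux F) (hFs : ContDiffOn ℝ ∞ F (uIcc um up)) (hD : 0 < D)
    (hU : IsViscousShock F D um up U) (hγ : shockSpeed F um up = 0) (hσ : 0 < σ)
    (hφ₀ : IsEnvelope φ₀) :
    ∃ K : ℝ, 0 < K ∧ ∀ x₀ T : ℝ, 0 ≤ x₀ → 0 < T →
      (1 / 2) * ∫⁻ t in Icc 0 T, ∫⁻ x, ENNReal.ofReal
        ((wavePathForcing F D U 0 (1 / T) x₀ t x * (1 / (σ * φ₀ (x / (x₀ + 1))))) ^ 2)
        ≤ ENNReal.ofReal (K * (x₀ / T + (1 + T) ^ 2 / T)) := by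
  obtain ⟨a, ha, hdb⟩ := hU.exists_derivBound hγ hF hFs hD
  obtain ⟨G, hG0, hG⟩ := exists_abs_interpolation_forcing_le hF hD hU hγ ha hdb
  obtain ⟨A, k, hA, hAk⟩ := hφ₀.exists_inv_le
  obtain ⟨B, hB⟩ := exists_pow_mul_exp_le ha k
  have hB0 : 0 ≤ B := by
    have := (mul_nonneg (by positivity) (Real.exp_pos _).le).trans (hB 0)
    simpa using this
  set E : ℝ → ℝ := fun x => Real.exp (-(a * |x|)) with hE
  have hE0 : ∀ x, 0 < E x := fun x => Real.exp_pos _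
  set R : ℝ → ℝ := fun x => Real.exp (-(a / 2 * |x|)) with hR
  have hR2 : Integrable fun x => R x ^ 2 := integrable_exp_neg_mul_abs_sq (half_pos ha)
  set J := ∫ x, R x ^ 2 with hJ
  have hJ0 : 0 ≤ J := integral_nonneg fun x => sq_nonneg _
  set M := |um - up| with hM
  have hM0 : 0 ≤ M := abs_nonneg _
  refine ⟨3 * (M / σ) ^ 2 + 6 * (G * (A * 2 ^ k * B) / σ) ^ 2 * J + 1, by positivity,
    fun x₀ T hx₀ hT => ?_⟩
  set L := x₀ + 1 with hL
  have hL0 : 0 < L := by positivity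
  set P := 1 / T * (1 / σ) with hP
  set Q := (1 + 1 / T) * (G * (A * 2 ^ k * B) / σ) with hQ
  have hP0 : 0 ≤ P := by positivity
  have hQ0 : 0 ≤ Q := by positivity
  set I : ℝ → ℝ := (Icc 0 x₀).indicator (fun _ => M) with hI
  have hI0 : ∀ x, 0 ≤ I x := fun x => indicator_nonneg (fun _ _ => hM0) x
  have hIsq : ∀ x, I x ^ 2 = (Icc 0 x₀).indicator (fun _ => M ^ 2) x := fun x => by
    by_cases hx : x ∈ Icc 0 x₀ <;> simp [hI, hx]
  have hIi : Integrable fun x => I x ^ 2 := by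
    simp only [hIsq]
    exact (integrable_indicator_iff measurableSet_Icc).2 (by simp)
  have hIint : ∫ x, I x ^ 2 = x₀ * M ^ 2 := by
    simp only [hIsq]
    rw [integral_indicator measurableSet_Icc]
    simp [hx₀]
  set V := 3 * P ^ 2 * (x₀ * M ^ 2) + 3 * Q ^ 2 * J + 3 * Q ^ 2 * J with hV
  refine (half_lintegral_sq_le (V := V) (by positivity) fun t ht =>
    ⟨fun x => 3 * P ^ 2 * I x ^ 2 + 3 * Q ^ 2 * R x ^ 2 + 3 * Q ^ 2 * R (x - x₀) ^ 2,
      ((hIi.const_mul _).add (hR2.const_mul _)).add ((hR2.comp_sub_right x₀).const_mul _),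
      fun x => ?_, ?_⟩).trans (ENNReal.ofReal_le_ofReal ?_)
  · set φ := 1 / φ₀ (x / L) with hφ
    have hφ0 : 0 < φ := one_div_pos.2 (hφ₀.pos _)
    have hg : |wavePathForcing F D U 0 (1 / T) x₀ t x|
        ≤ 1 / T * I x + (1 + 1 / T) * G * (E x + E (x - x₀)) := hG x₀ T hx₀ hT t ht x
    -- For L = x₀ + 1 the envelope equals 1 on the plateau, whose cost is therefore linear in x₀.
    have hIφ : I x * φ = I x := by
      by_cases hx : x ∈ Icc 0 x₀
      · have : φ₀ (x / L) = 1 := hφ₀.eq_one _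
          ⟨by have := div_nonneg hx.1 hL0.le; linarith,
            (div_le_one hL0).2 (by linarith [hx.2])⟩
        rw [hφ, this]; simp
      · simp [hI, hx]
    have hEφ : ∀ z, 1 + |x / L| ≤ 2 * (1 + |z|) → E z * φ ≤ A * 2 ^ k * B * R z := fun z hz => by
      calc E z * φ ≤ E z * (A * (2 * (1 + |z|)) ^ k) := by
            refine mul_le_mul_of_nonneg_left ((hAk _).trans ?_) (hE0 z).le
            gcongr
        _ = A * 2 ^ k * ((1 + |z|) ^ k * E z) := by rw [mul_pow]; ring
        _ ≤ A * 2 ^ k * (B * R z) := mul_le_mul_of_nonneg_left (hB z) (by positivity)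
        _ = _ := by ring
    have habs : |x / L| = |x| / L := by rw [abs_div, abs_of_pos hL0]
    have hE1 := hEφ x (by
      have : |x| / L ≤ |x| := div_le_self (abs_nonneg _) (by linarith)
      linarith [abs_nonneg x])
    -- The scale L exceeds x₀, so the inverse envelope near the second front is bounded
    -- independently of x₀.
    have hE2 := hEφ (x - x₀) (by
      have h1 : |x| ≤ |x - x₀| + |x₀| := by simpa using abs_add_le (x - x₀) x₀
      rw [abs_of_nonneg hx₀] at h1
      have : |x| / L ≤ |x - x₀| + 1 := by
        rw [div_le_iff₀ hL0]
        nlinarith [mul_nonneg hx₀ (abs_nonneg (x - x₀)), abs_nonneg (x - x₀)]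
      linarith [abs_nonneg (x - x₀)])
    have hw : |wavePathForcing F D U 0 (1 / T) x₀ t x * (1 / (σ * φ₀ (x / L)))|
        ≤ P * I x + Q * R x + Q * R (x - x₀) := by
      rw [← one_div_mul_one_div, ← hφ, abs_mul, abs_of_pos (by positivity : 0 < 1 / σ * φ)]
      calc _ ≤ (1 / T * I x + (1 + 1 / T) * G * (E x + E (x - x₀))) * (1 / σ * φ) := by gcongr
        _ = P * (I x * φ) + (1 + 1 / T) * G * (1 / σ) * (E x * φ + E (x - x₀) * φ) := by
            rw [hP]; ring
        _ ≤ P * I x + (1 + 1 / T) * G * (1 / σ)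
            * (A * 2 ^ k * B * R x + A * 2 ^ k * B * R (x - x₀)) := by
            rw [hIφ]
            gcongr
        _ = _ := by rw [hQ]; ring
    have h := sq_le_three_mul_of_abs_le hw
    simp only [mul_pow, ← mul_assoc] at h ⊢
    exact h
  · have i1 : Integrable fun x => 3 * P ^ 2 * I x ^ 2 := hIi.const_mul _
    have i2 : Integrable fun x => 3 * Q ^ 2 * R x ^ 2 := hR2.const_mul _
    have i3 : Integrable fun x => 3 * Q ^ 2 * R (x - x₀) ^ 2 :=
      (hR2.comp_sub_right x₀).const_mul _
    have i4 : Integrable fun x => 3 * P ^ 2 * I x ^ 2 + 3 * Q ^ 2 * R x ^ 2 := i1.add i2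
    refine le_of_eq ?_
    simp only
    rw [integral_add i4 i3, integral_add i1 i2, integral_const_mul, integral_const_mul, integral_const_mul, hIint,
      integral_sub_right_eq_self (fun x => R x ^ 2)]
  · set G' := G * (A * 2 ^ k * B) / σ with hG'
    have e1 : V * T = 3 * (M / σ) ^ 2 * (x₀ / T) + 6 * G' ^ 2 * J * ((1 + T) ^ 2 / T) := by
      rw [hV, hP, hQ]
      field_simp
      ring
    rw [e1]
    have h1 : 0 ≤ x₀ / T := by positivity
    have h2 : 0 ≤ (1 + T) ^ 2 / T := by positivity
    have h3 : 0 ≤ 3 * (M / σ) ^ 2 := by positivity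
    have h4 : 0 ≤ 6 * G' ^ 2 * J := by positivity
    nlinarith [mul_nonneg h3 h2, mul_nonneg h4 h1]

/-! ### Assembly of the bounds and the four regimes. -/

theorem infRate_zero_displacement {F U φ₀ φ₁ : ℝ → ℝ} {D um up T σ L lc : ℝ}
    (hF : IsAdmissibleFlux F) (hFs : ContDiffOn ℝ ∞ F (uIcc um up)) (hD : 0 < D)
    (hU : IsViscousShock F D um up U) (hγ : shockSpeed F um up = 0) :
    infRate F D T U (noiseKernel σ L lc φ₀ φ₁) (displacementEvent T 0 0 U) = 0 := by
  obtain ⟨a, ha, hdb⟩ := hU.exists_derivBound hγ hF hFs hD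
  have hUd : Differentiable ℝ U := (hdb 1).1.1 ()
  have hmild : IsMildSolution F D T U (noiseKernel σ L lc φ₀ φ₁) (fun _ _ => 0)
      (wavePath U 0 0 0) := by
    refine isMildSolution_wavePath hF hFs hD hU hγ
      (fun t _ x => by simpa [wavePath] using hU.mem_uIcc hγ hF x) fun s _ => ?_
    ext x
    simp only [kernelOp, mul_zero, integral_zero, wavePathForcing, wavePath, zero_mul, sub_zero,
      neg_zero, sub_self, add_zero, zero_add]
    rw [(hU.hasDerivAt_deriv hγ hF x).deriv]
    field_simp
    ring
  have hc : IsControl T fun _ _ => 0 := MemLp.zero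
  have hmem : wavePath U 0 0 0 ∈ displacementEvent T 0 0 U :=
    ⟨memE1_wavePath ha hUd (hdb 1).2, ae_of_all _ fun x => by simp [wavePath],
      ae_of_all _ fun x => by simp [wavePath]⟩
  refine le_antisymm ((iInf₂_le _ hmem).trans ((iInf_le _ fun _ _ => 0).trans
    ((iInf₂_le hc hmild).trans (le_of_eq ?_)))) zero_le
  simp [controlCost]

/-- All the bounds on the cost of a displacement. -/
theorem exists_infRate_bounds {F U φ₀ : ℝ → ℝ} {D um up σ : ℝ}
    (hF : IsAdmissibleFlux F) (hFs : ContDiffOn ℝ ∞ F (uIcc um up)) (hD : 0 < D)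
    (hU : IsViscousShock F D um up U) (hγ : shockSpeed F um up = 0) (hσ : 0 < σ)
    (hφ₀ : IsEnvelope φ₀) :
    ∃ (m K : ℝ) (k : ℕ), 0 < m ∧ 0 < K ∧ ∀ φ₁, IsCorrelationProfile φ₁ → ∀ x₀ T : ℝ,
      0 ≤ x₀ → 0 < T → ∀ᶠ lc in 𝓝[>] (0 : ℝ),
        ENNReal.ofReal (m * (x₀ ^ 2 / (T * (x₀ + 1))))
          ≤ displacementRate F D um up U 1 σ φ₀ φ₁ T x₀ lc ∧
        displacementRate F D um up U 1 σ φ₀ φ₁ T x₀ lc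
          ≤ ENNReal.ofReal (K * (1 + x₀) ^ k * (x₀ ^ 2 / T)) ∧
        displacementRate F D um up U 1 σ φ₀ φ₁ T x₀ lc
          ≤ ENNReal.ofReal (K * (x₀ / T + (1 + T) ^ 2 / T)) := by
  obtain ⟨K₁, k, hK₁, h₁⟩ := exists_translation_cost_le hF hFs hD hU hγ hσ hφ₀
  obtain ⟨K₂, hK₂, h₂⟩ := exists_interpolation_cost_le hF hFs hD hU hγ hσ hφ₀
  have hS := hφ₀.integral_sq_pos
  set S := ∫ x, φ₀ x ^ 2 with hSd
  have hΔ : 0 < (um - up) ^ 2 := by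
    have := sub_ne_zero.2 hU.ne
    positivity
  -- The factor 2 creates the strict inequality that `eventually_infRate_le` requires of its bound.
  refine ⟨(um - up) ^ 2 / (8 * σ ^ 2 * S), 2 * (K₁ + K₂), k, by positivity, by positivity,
    fun φ₁ hφ₁ x₀ T hx₀ hT => ?_⟩
  have hrate : ∀ lc, displacementRate F D um up U 1 σ φ₀ φ₁ T x₀ lc
      = infRate F D T U (noiseKernel σ (x₀ + 1) lc φ₀ φ₁) (displacementEvent T 0 x₀ U) :=
    fun lc => by simp only [displacementRate, hγ, zero_mul, zero_add]
  simp only [hrate]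
  have hlow := eventually_le_infRate (x₀ := x₀) (L := x₀ + 1) hF hFs hD hU hγ hT hσ (by positivity)
    hφ₀ hφ₁
  rw [← hSd] at hlow
  have e : x₀ ^ 2 * (um - up) ^ 2 / (8 * T * σ ^ 2 * (x₀ + 1) * S)
      = (um - up) ^ 2 / (8 * σ ^ 2 * S) * (x₀ ^ 2 / (T * (x₀ + 1))) := by
    field_simp
  rw [e] at hlow
  -- For x₀ = 0 the translation bound is 0 and no strict inequality is available; there the unforced
  -- wave has cost 0.
  rcases hx₀.eq_or_lt with rfl | hx
  · filter_upwards [hlow] with lc hlc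
    rw [infRate_zero_displacement hF hFs hD hU hγ] at hlc ⊢
    exact ⟨hlc, zero_le, zero_le⟩
  have hI := hU.mem_uIcc hγ hF
  have hup1 := eventually_infRate_le (c := x₀ / T) (κ := 0) (x₀ := x₀) (T := T) (L := x₀ + 1)
    hF hFs hD hU hγ hσ hφ₀ hφ₁ (fun t _ x => by simpa [wavePath] using hI _)
    (fun x => by simp [wavePath, div_mul_cancel₀ x₀ hT.ne'])
    (K := ENNReal.ofReal (2 * (K₁ + K₂) * (1 + x₀) ^ k * (x₀ ^ 2 / T)))
    ((h₁ x₀ T (x₀ + 1) hx₀ hT (by linarith)).trans_lt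
      ((ENNReal.ofReal_lt_ofReal_iff (by positivity)).2 (by gcongr; linarith)))
  have hup2 := eventually_infRate_le (c := 0) (κ := 1 / T) (x₀ := x₀) (T := T) (L := x₀ + 1)
    hF hFs hD hU hγ hσ hφ₀ hφ₁
    (fun t ht x => by
      have := (convex_uIcc um up).add_smul_sub_mem (hI x) (hI (x - x₀)) (t := 1 / T * t)
        ⟨mul_nonneg (by positivity) ht.1, by
          rw [one_div_mul_eq_div, div_le_one hT]; exact ht.2⟩
      simpa [wavePath] using this)
    (fun x => by simp [wavePath, hT.ne'])
    (K := ENNReal.ofReal (2 * (K₁ + K₂) * (x₀ / T + (1 + T) ^ 2 / T)))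
    ((h₂ x₀ T hx₀ hT).trans_lt
      ((ENNReal.ofReal_lt_ofReal_iff (by positivity)).2 (by gcongr; linarith)))
  filter_upwards [hlow, hup1, hup2] with lc a b c using ⟨a, b, c⟩

end

end ShockDisplacement

theorem mainTheorem2 (F : ℝ → ℝ) (D um up : ℝ) (U : ℝ → ℝ)
    (hD : 0 < D) (hF : IsAdmissibleFlux F)
    (hFsmooth : ContDiffOn ℝ ∞ F (Set.uIcc um up))
    (hU : IsViscousShock F D um up U)
    (hγ : shockSpeed F um up = 0) :
    ∃ C₀ : ℝ, 0 < C₀ ∧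
      ∀ (σ : ℝ) (φ₀ : ℝ → ℝ), 0 < σ → IsEnvelope φ₀ →
        -- order `x₀² / T` for small `x₀`, for all `T`
        (∃ C₁ C₂ r : ℝ, 0 < C₁ ∧ 0 < C₂ ∧ 0 < r ∧
          ∀ φ₁ : ℝ → ℝ, IsCorrelationProfile φ₁ →
            ∀ x₀ T : ℝ, 0 ≤ x₀ → x₀ ≤ r → 0 < T →
              BoundedAsLcToZero C₁ C₂ (x₀ ^ 2 / T)
                (displacementRate F D um up U C₀ σ φ₀ φ₁ T x₀)) ∧
        -- order `x₀` for large `x₀` and any fixed `T`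
        (∀ T : ℝ, 0 < T → ∃ C₁ C₂ R : ℝ, 0 < C₁ ∧ 0 < C₂ ∧ 0 < R ∧
          ∀ φ₁ : ℝ → ℝ, IsCorrelationProfile φ₁ →
            ∀ x₀ : ℝ, R ≤ x₀ →
              BoundedAsLcToZero C₁ C₂ x₀
                (displacementRate F D um up U C₀ σ φ₀ φ₁ T x₀)) ∧
        -- order `x₀ / T` for large `x₀` and small `T`
        (∃ C₁ C₂ R τ : ℝ, 0 < C₁ ∧ 0 < C₂ ∧ 0 < R ∧ 0 < τ ∧
          ∀ φ₁ : ℝ → ℝ, IsCorrelationProfile φ₁ →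
            ∀ x₀ T : ℝ, R ≤ x₀ → 0 < T → T ≤ τ →
              BoundedAsLcToZero C₁ C₂ (x₀ / T)
                (displacementRate F D um up U C₀ σ φ₀ φ₁ T x₀)) ∧
        -- order `1 / T` for any fixed `x₀ > 0`, for all `T`
        (∀ x₀ : ℝ, 0 < x₀ → ∃ C₁ C₂ : ℝ, 0 < C₁ ∧ 0 < C₂ ∧
          ∀ φ₁ : ℝ → ℝ, IsCorrelationProfile φ₁ →
            ∀ T : ℝ, 0 < T →
              BoundedAsLcToZero C₁ C₂ (1 / T)
                (displacementRate F D um up U C₀ σ φ₀ φ₁ T x₀)) := by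
  refine ⟨1, one_pos, fun σ φ₀ hσ hφ₀ => ?_⟩
  obtain ⟨m, K, k, hm, hK, h⟩ := exists_infRate_bounds hF hFsmooth hD hU hγ hσ hφ₀
  -- For x₀ ≤ 1 one has 1 + x₀ ≤ 2; for x₀ ≥ 1 one has x₀ + 1 ≤ 2x₀ and (1 + T)² ≤ (1 + T)²x₀. The 5
  -- is 1 + 4, from (1 + T)² ≤ 4 ≤ 4x₀ when T ≤ 1. For fixed x₀ the lower bound and the translation
  -- bound are exact multiples of 1/T.
  refine ⟨⟨m / 2, K * 2 ^ k, 1, by positivity, by positivity, one_pos,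
    fun φ₁ hφ₁ x₀ T hx₀ hx₁ hT => ?_⟩, fun T hT => ⟨m / (2 * T), K * (1 / T + (1 + T) ^ 2 / T), 1,
      by positivity, by positivity, one_pos, fun φ₁ hφ₁ x₀ hx₀ => ?_⟩,
    ⟨m / 2, K * 5, 1, 1, by positivity, by positivity, one_pos, one_pos,
      fun φ₁ hφ₁ x₀ T hx₀ hT hT1 => ?_⟩,
    fun x₀ hx₀ => ⟨m * (x₀ ^ 2 / (x₀ + 1)), K * (1 + x₀) ^ k * x₀ ^ 2, by positivity,
      by positivity, fun φ₁ hφ₁ T hT => ?_⟩⟩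
  · filter_upwards [h φ₁ hφ₁ x₀ T hx₀ hT] with lc hlc
    refine ⟨le_trans (ENNReal.ofReal_le_ofReal ?_) hlc.1,
      hlc.2.1.trans (ENNReal.ofReal_le_ofReal ?_)⟩
    · have : x₀ ^ 2 / (T * 2) ≤ x₀ ^ 2 / (T * (x₀ + 1)) := by gcongr; linarith
      calc m / 2 * (x₀ ^ 2 / T) = m * (x₀ ^ 2 / (T * 2)) := by field_simp
        _ ≤ _ := by gcongr
    · gcongr
      linarith
  · have hx : 0 < x₀ := by linarith
    filter_upwards [h φ₁ hφ₁ x₀ T hx.le hT] with lc hlc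
    refine ⟨le_trans (ENNReal.ofReal_le_ofReal ?_) hlc.1,
      hlc.2.2.trans (ENNReal.ofReal_le_ofReal ?_)⟩
    · have : x₀ ^ 2 / (T * (x₀ + x₀)) ≤ x₀ ^ 2 / (T * (x₀ + 1)) := by gcongr
      calc m / (2 * T) * x₀ = m * (x₀ ^ 2 / (T * (x₀ + x₀))) := by field_simp; ring
        _ ≤ _ := by gcongr
    · have h1 : (1 + T) ^ 2 / T * 1 ≤ (1 + T) ^ 2 / T * x₀ := by gcongr
      calc K * (x₀ / T + (1 + T) ^ 2 / T) ≤ K * (x₀ / T + (1 + T) ^ 2 / T * x₀) := by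
            gcongr; linarith
        _ = _ := by ring
  · have hx : 0 < x₀ := by linarith
    filter_upwards [h φ₁ hφ₁ x₀ T hx.le hT] with lc hlc
    refine ⟨le_trans (ENNReal.ofReal_le_ofReal ?_) hlc.1,
      hlc.2.2.trans (ENNReal.ofReal_le_ofReal ?_)⟩
    · have : x₀ ^ 2 / (T * (x₀ + x₀)) ≤ x₀ ^ 2 / (T * (x₀ + 1)) := by gcongr
      calc m / 2 * (x₀ / T) = m * (x₀ ^ 2 / (T * (x₀ + x₀))) := by field_simp; ring
        _ ≤ _ := by gcongr
    · have h1 : (1 + T) ^ 2 / T ≤ 4 * x₀ / T := by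
        gcongr
        nlinarith
      calc K * (x₀ / T + (1 + T) ^ 2 / T) ≤ K * (x₀ / T + 4 * x₀ / T) := by gcongr
        _ = _ := by ring
  · filter_upwards [h φ₁ hφ₁ x₀ T hx₀.le hT] with lc hlc
    refine ⟨le_trans (ENNReal.ofReal_le_ofReal (le_of_eq ?_)) hlc.1,
      hlc.2.1.trans (ENNReal.ofReal_le_ofReal (le_of_eq ?_))⟩
    · field_simp
    · field_simp
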